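/- **Lemma 3.4 (Optimal synthesis).** Let $T>0$ and $\varepsilon\in[0,1]$. For $x=(x_1,x_2,x_3)\in\mathbb R^3$ put $$B^\varepsilon(x)=\begin{pmatrix}1&0&0\\0&1&0\\-x_2&x_1&\varepsilon\end{pmatrix},\qquad H^\varepsilon(x,p)=\tfrac12|pB^\varepsilon(x)|^2 .$$ Let $f\in C^0([0,T];C^2(\mathbb R^3))$ and $g\in C^2(\mathbb R^3)$ satisfy $\|f(\cdot,t)\|_{C^2}+\|g\|_{C^2}\le C$ for all $t\in[0,T]$ and some constant $C$, where $\|h\|_{C^2}=\sup_x(|h|+|Dh|+|D^2h|)$. Let $u_\varepsilon$ be a bounded continuous function on $\mathbb R^3\times[0,T]$ that is a viscosity solution of $$-\partial_tu_\varepsilon+H^\varepsilon(x,Du_\varepsilon)=f(x,t)\ \text{ in }\mathbb R^3\times(0,T),\qquad u_\varepsilon(x,T)=g(x)\ \text{ on }\mathbb R^3 .$$ Here and below $D$ is the (row) gradient in $x$. For $(x,t)\in\mathbb R^3\times[0,T]$ call $(y,\alpha)$ admissible if $y\in AC([t,T];\mathbb R^3)$, $\alpha\in L^2([t,T];\mathbb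 R^3)$, $y(t)=x$ and $y'=B^\varepsilon(y)\alpha$ a.e. in $(t,T)$; call it optimal for $u_\varepsilon(x,t)$ if it minimizes $$\int_t^T\Big(\tfrac12|\alpha(s)|^2+f(y(s),s)\Big)ds+g(y(T))$$ among all admissible pairs; $y$ is then called an optimal trajectory. Consider the problem $$\dot\gamma(s)=-Du_\varepsilon(\gamma(s),s)\,B^\varepsilon(\gamma(s))\,(B^\varepsilon(\gamma(s)))^T\ \text{ for a.e. } s\in(t,T),\qquad \gamma(t)=x, \tag{1}$$ a solution of which is a curve $\gamma\in AC([t,T];\mathbb R^3)$ such that, for a.e. $s\in(t,T)$, $u_\varepsilon(\cdot,s)$ is differentiable at $\gamma(s)$ and the equation holds at $s$. (a) For all $(x,t)\in\mathbb R^3\times[0,T]$: if $\gamma$ is a solution of (1), then the pair $(\gamma,\alpha)$ with the control law $\alpha(s)=-Du_\varepsilon(\gamma(s),s)B^\varepsilon(\gamma(s))$ is admissible and optimal for $u_\varepsilon(x,t)$. (b) Let $\varepsilon\ne0$. For all $(x,t)\in\mathbb R^3\times[0,T]$: if $u_\varepsilon(\cdot,t)$ is differentiable at $x$, then problem (1)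 has a unique solution, there is a unique optimal trajectory for $u_\varepsilon(x,t)$, and the two coincide on $[t,T]$. In particular, for a.e. $x\in\mathbb R^3$ there exists a unique optimal trajectory for $u_\varepsilon(x,0)$. -/

import Mathlib

open MeasureTheory Set Filter Topology
open scoped ENNReal

noncomputable section

namespace HeisenbergControl

/-- Three-dimensional Euclidean space. The coordinates `x₁, x₂, x₃` are `x 0, x 1, x 2`. -/
abbrev E3 : Type := EuclideanSpace ℝ (Fin 3)

/-- The matrix `B^ε(x)`, with rows `(1, 0, 0)`, `(0, 1, 0)`, `(-x₂, x₁, ε)`. -/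
def B (ε : ℝ) (x : E3) : Matrix (Fin 3) (Fin 3) ℝ :=
  !![1, 0, 0; 0, 1, 0; -x 1, x 0, ε]

/-- Row vector times matrix, `p M`. -/
def rowMul (p : E3) (M : Matrix (Fin 3) (Fin 3) ℝ) : E3 :=
  WithLp.toLp 2 (Matrix.vecMul p.ofLp M)

/-- Matrix times column vector, `M a`. -/
def mulCol (M : Matrix (Fin 3) (Fin 3) ℝ) (a : E3) : E3 :=
  WithLp.toLp 2 (Matrix.mulVec M a.ofLp)

/-- The Hamiltonian `H^ε(x, p) = |p B^ε(x)|² / 2`. -/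
def hamiltonian (ε : ℝ) (x p : E3) : ℝ :=
  ‖rowMul p (B ε x)‖ ^ 2 / 2

/-- The `C²` norm `sup_x (|h(x)| + |Dh(x)| + |D²h(x)|)`, as an extended nonnegative number. -/
def c2Norm (h : E3 → ℝ) : ℝ≥0∞ :=
  ⨆ x, ENNReal.ofReal (|h x| + ‖fderiv ℝ h x‖ + ‖fderiv ℝ (fderiv ℝ h) x‖)

/-- The standing assumptions on the costs: `f ∈ C⁰([0,T]; C²(ℝ³))`, `g ∈ C²(ℝ³)`, and
`‖f(·,t)‖_{C²} + ‖g‖_{C²} ≤ C` for all `t ∈ [0,T]` and some constant `C`. -/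
structure CostData (T : ℝ) (f : E3 → ℝ → ℝ) (g : E3 → ℝ) : Prop where
  contDiff_f : ∀ t ∈ Icc 0 T, ContDiff ℝ 2 (fun x => f x t)
  continuous_f : ∀ t₀ ∈ Icc 0 T,
    Tendsto (fun t => c2Norm (fun x => f x t - f x t₀)) (𝓝[Icc 0 T] t₀) (𝓝 0)
  contDiff_g : ContDiff ℝ 2 g
  bounded : ∃ C : ℝ, ∀ t ∈ Icc 0 T,
    c2Norm (fun x => f x t) + c2Norm g ≤ ENNReal.ofReal C

/-- `(y, α)` is an admissible pair for the starting point `(x, t)`: `y ∈ AC([t,T]; ℝ³)`,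
`α ∈ L²([t,T]; ℝ³)`, `y(t) = x` and `y' = B^ε(y) α` almost everywhere in `(t,T)`, that is
`y₁' = α₁`, `y₂' = α₂`, `y₃' = -y₂ α₁ + y₁ α₂ + ε α₃`. -/
structure Admissible (ε T : ℝ) (x : E3) (t : ℝ) (y α : ℝ → E3) : Prop where
  ac : AbsolutelyContinuousOnInterval y t T
  memLp : MemLp α 2 (volume.restrict (Icc t T))
  init : y t = x
  dynamics : ∀ᵐ s ∂(volume.restrict (Ioo t T)), HasDerivAt y (mulCol (B ε (y s)) (α s)) s

/-- The cost `J_{x,t}(α) = ∫_t^T (|α|²/2 + f(y(s),s)) ds + g(y(T))` of a pair `(y, α)`. -/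
def cost (T : ℝ) (f : E3 → ℝ → ℝ) (g : E3 → ℝ) (t : ℝ) (y α : ℝ → E3) : ℝ :=
  (∫ s in t..T, (‖α s‖ ^ 2 / 2 + f (y s) s)) + g (y T)

/-- `(y, α)` is an optimal pair for `(x, t)`: admissible, with minimal cost among all admissible
pairs. -/
def IsOptimalPair (ε T : ℝ) (f : E3 → ℝ → ℝ) (g : E3 → ℝ) (x : E3) (t : ℝ)
    (y α : ℝ → E3) : Prop :=
  Admissible ε T x t y α ∧
    ∀ z β : ℝ → E3, Admissible ε T x t z β → cost T f g t y α ≤ cost T f g t z β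

/-- `y` is an optimal trajectory for `(x, t)`: it belongs to an optimal pair. Only the values of
`y` on `[t, T]` matter. -/
def IsOptimalTrajectory (ε T : ℝ) (f : E3 → ℝ → ℝ) (g : E3 → ℝ) (x : E3) (t : ℝ)
    (y : ℝ → E3) : Prop :=
  ∃ α : ℝ → E3, IsOptimalPair ε T f g x t y α

/-- `u` is a bounded viscosity solution of `-∂ₜu + H^ε(x, Du) = f` in `ℝ³ × (0,T)` with
`u(·,T) = g`: it is bounded and continuous on `ℝ³ × [0,T]`, takes the terminal value, and is a
viscosity sub- and supersolution. -/
structure IsBoundedViscositySolution (ε T : ℝ) (f : E3 → ℝ → ℝ) (g : E3 → ℝ)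
    (u : E3 → ℝ → ℝ) : Prop where
  bounded : ∃ C : ℝ, ∀ x : E3, ∀ t ∈ Icc 0 T, |u x t| ≤ C
  continuousOn : ContinuousOn (fun q : E3 × ℝ => u q.1 q.2) (univ ×ˢ Icc 0 T)
  terminal : ∀ x : E3, u x T = g x
  subsolution : ∀ φ : E3 × ℝ → ℝ, ContDiffOn ℝ 1 φ (univ ×ˢ Ioo 0 T) →
    ∀ x : E3, ∀ t ∈ Ioo 0 T, IsLocalMax (fun q : E3 × ℝ => u q.1 q.2 - φ q) (x, t) →
      -deriv (fun s => φ (x, s)) t + hamiltonian ε x (gradient (fun y => φ (y, t)) x) ≤ f x t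
  supersolution : ∀ φ : E3 × ℝ → ℝ, ContDiffOn ℝ 1 φ (univ ×ˢ Ioo 0 T) →
    ∀ x : E3, ∀ t ∈ Ioo 0 T, IsLocalMin (fun q : E3 × ℝ => u q.1 q.2 - φ q) (x, t) →
      f x t ≤ -deriv (fun s => φ (x, s)) t + hamiltonian ε x (gradient (fun y => φ (y, t)) x)

/-- The Euclidean gradient `Du(x, t)` with respect to the space variable. -/
def spaceGradient (u : E3 → ℝ → ℝ) (x : E3) (t : ℝ) : E3 :=
  gradient (fun y => u y t) x

/-- The feedback control `s ↦ -Du(γ(s), s) B^ε(γ(s))` along a curve `γ`. -/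
def feedback (ε : ℝ) (u : E3 → ℝ → ℝ) (γ : ℝ → E3) (s : ℝ) : E3 :=
  -rowMul (spaceGradient u (γ s) s) (B ε (γ s))

/-- `γ ∈ AC([t,T]; ℝ³)` solves `γ'(s) = -Du(γ(s),s) B^ε(γ(s)) B^ε(γ(s))ᵀ` for almost every
`s ∈ (t,T)`, with `γ(t) = x`; for the right-hand side to make sense, `u(·,s)` is required to be
differentiable at `γ(s)` for almost every `s ∈ (t,T)`. -/
structure IsFeedbackSolution (ε T : ℝ) (u : E3 → ℝ → ℝ) (x : E3) (t : ℝ)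
    (γ : ℝ → E3) : Prop where
  ac : AbsolutelyContinuousOnInterval γ t T
  differentiable : ∀ᵐ s ∂(volume.restrict (Ioo t T)), DifferentiableAt ℝ (fun y => u y s) (γ s)
  init : γ t = x
  ode : ∀ᵐ s ∂(volume.restrict (Ioo t T)),
    HasDerivAt γ
      (-rowMul (rowMul (spaceGradient u (γ s) s) (B ε (γ s))) (B ε (γ s)).transpose) s

end HeisenbergControl

end

open MeasureTheory Set Filter Topology
open scoped ENNReal

noncomputable section

namespace HeisenbergControl

/-! ### Absolutely continuous functions -/

section AbsolutelyContinuous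

variable {X Y F : Type*} [PseudoMetricSpace X] [PseudoMetricSpace Y]
  [NormedAddCommGroup F] [NormedSpace ℝ F]

/-! The viscosity solution is identified with the value function V of the control problem; both
parts are then statements about V alone.

Identification. Nearly optimal controls have bounded energy, so Gronwall's inequality makes V
Lipschitz in space, uniformly in time (`abs_value_sub_le`). Over a short time h, dynamic programming
reduces to a constant control up to an error of order h² (`exists_expansion_below`,
`exists_expansion_above`), which yields both viscosity inequalities. The comparison
`sign_mul_value_sub_le` doubles the variables. The coefficients of the Hamiltonian grow with x, so
the penalization is the logarithm of a homogeneous gauge: its derivative along the control fields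
decays fast enough to offset that growth, while the doubled gradient is bounded by twice the
Lipschitz constant of V. The unknown solution only has to be bounded and continuous.

Part (a). Along a feedback curve γ the function V(γ(s), s) is Lipschitz, and almost everywhere its
derivative is at most minus the running cost (`deriv_value_le_of_feedback`). Only differentiability
in space is available, so this is read off from a backward difference and a short time expansion
ending at time s. Integration bounds the cost of γ by V(x, t).

Part (b). Everything rests on `exists_cost_expansion`, a second order expansion of the cost around a
trajectory in terms of its adjoint curve p. Varying the control shows that α + pB is small in L² for
nearly optimal pairs. Varying the initial point, where V(·, t) is differentiable, shows that p(t) is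
close to DV(x, t). Gronwall's inequality for the coupled system of state and adjoint then makes any
two nearly optimal pairs close (`exists_near_stability`). Hence minimizing sequences of controls
converge strongly, which gives existence, and two optimal trajectories agree.

For nonzero ε, V(·, s) is differentiable at γ(s) for every s > t along an optimal γ, with gradient
p(s): the expansion gives a quadratic upper bound, and since B is invertible, steering γ to γ(s) + v
gives a quadratic lower bound whose leading part is odd in v. With α = -pB this is the feedback
equation. Conversely, feedback solutions are optimal by (a), so they coincide with the optimal
trajectory. Rademacher's theorem supplies the differentiability for almost every starting point. -/

lemma absolutelyContinuous_of_dist_le {f : ℝ → X} {g : ℝ → Y} {a b K : ℝ} (hK : 0 ≤ K)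
    (hf : AbsolutelyContinuousOnInterval f a b)
    (h : ∀ s ∈ uIcc a b, ∀ r ∈ uIcc a b, dist (g s) (g r) ≤ K * dist (f s) (f r)) :
    AbsolutelyContinuousOnInterval g a b := by
  rw [absolutelyContinuousOnInterval_iff] at hf ⊢
  intro e he
  obtain ⟨d, hd, H⟩ := hf (e / (K + 1)) (by positivity)
  refine ⟨d, hd, fun E hE hs => ?_⟩
  calc _ ≤ ∑ i ∈ Finset.range E.1, K * dist (f (E.2 i).1) (f (E.2 i).2) :=
        Finset.sum_le_sum fun i hi => h _ (hE.1 i hi).1 _ (hE.1 i hi).2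
    _ = K * ∑ i ∈ Finset.range E.1, dist (f (E.2 i).1) (f (E.2 i).2) := by
        rw [Finset.mul_sum]
    _ ≤ K * (e / (K + 1)) := by gcongr; exact (H E hE hs).le
    _ < e := by
        rw [mul_div_assoc', div_lt_iff₀ (by positivity)]
        nlinarith

lemma absolutelyContinuous_integral {ψ : ℝ → F} {a b : ℝ}
    (hψ : IntervalIntegrable ψ volume a b) :
    AbsolutelyContinuousOnInterval (fun s => ∫ r in a..s, ψ r) a b := by
  refine absolutelyContinuous_of_dist_le zero_le_one
    (hψ.norm.absolutelyContinuousOnInterval_intervalIntegral (c := a) left_mem_uIcc) ?_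
  intro s hs r hr
  have h1 : IntervalIntegrable ψ volume a s := hψ.mono_set (uIcc_subset_uIcc_left hs)
  have h2 : IntervalIntegrable ψ volume a r := hψ.mono_set (uIcc_subset_uIcc_left hr)
  rw [one_mul, dist_eq_norm, dist_eq_norm, intervalIntegral.integral_interval_sub_left h1 h2,
    intervalIntegral.integral_interval_sub_left h1.norm h2.norm]
  exact intervalIntegral.norm_integral_le_abs_integral_norm

/-- The difference between `y` and the primitive of `ψ` is absolutely continuous with zero
derivative almost everywhere, hence constant. This links the differential form of the dynamics to
the integral form used throughout. -/
lemma eq_add_integral_of_absolutelyContinuous [CompleteSpace F] {y ψ : ℝ → F} {a b : ℝ} (hab : a ≤ b)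
    (hy : AbsolutelyContinuousOnInterval y a b)
    (h : ∀ᵐ s ∂(volume.restrict (Ioo a b)), HasDerivAt y (ψ s) s)
    (hψ : IntervalIntegrable ψ volume a b) :
    ∀ s ∈ Icc a b, y s = y a + ∫ r in a..s, ψ r := by
  have hac := hy.fun_sub (absolutelyContinuous_integral hψ)
  have hne : ∀ c : ℝ, ∀ᵐ s, s ≠ c := fun c => by simp [ae_iff, measure_singleton]
  obtain ⟨C, hC⟩ := hac.const_of_ae_hasDerivAt_zero (by
    rw [ae_restrict_iff' measurableSet_Ioo] at h
    filter_upwards [h, hψ.ae_hasDerivAt_integral, hne a, hne b] with s h1 h2 h3 h4 hs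
    rw [uIcc_of_le hab] at hs
    have hs' : s ∈ Ioo a b := ⟨lt_of_le_of_ne hs.1 h3.symm, lt_of_le_of_ne hs.2 h4⟩
    have := (h1 hs').sub (h2 (by rwa [uIcc_of_le hab]) a left_mem_uIcc)
    rwa [sub_self] at this)
  intro s hs
  have h1 := hC s (by rwa [uIcc_of_le hab])
  have h2 := hC a left_mem_uIcc
  simp only [intervalIntegral.integral_same, sub_zero] at h2
  rw [h2, ← h1]
  abel

lemma ae_hasDerivAt_of_eq_add_integral [CompleteSpace F] {y ψ : ℝ → F} {a b : ℝ} (hab : a ≤ b)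
    (hψ : IntervalIntegrable ψ volume a b)
    (h : ∀ s ∈ Icc a b, y s = y a + ∫ r in a..s, ψ r) :
    ∀ᵐ s ∂(volume.restrict (Ioo a b)), HasDerivAt y (ψ s) s := by
  rw [ae_restrict_iff' measurableSet_Ioo]
  filter_upwards [hψ.ae_hasDerivAt_integral] with s h2 hs
  have h3 := (h2 (by rw [uIcc_of_le hab]; exact Ioo_subset_Icc_self hs) a left_mem_uIcc).const_add
    (y a)
  refine h3.congr_of_eventuallyEq ?_
  filter_upwards [Icc_mem_nhds hs.1 hs.2] with r hr using h r hr

lemma absolutelyContinuous_of_eq_add_integral {y ψ : ℝ → F} {a b : ℝ} (hab : a ≤ b)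
    (hψ : IntervalIntegrable ψ volume a b)
    (h : ∀ s ∈ Icc a b, y s = y a + ∫ r in a..s, ψ r) :
    AbsolutelyContinuousOnInterval y a b := by
  refine absolutelyContinuous_of_dist_le zero_le_one (absolutelyContinuous_integral hψ) ?_
  intro s hs r hr
  rw [uIcc_of_le hab] at hs hr
  rw [h s hs, h r hr, dist_add_left, one_mul]

/-- Real absolutely continuous functions with nonpositive derivative do not increase. -/
lemma le_of_absolutelyContinuous_of_deriv_le {φ ψ : ℝ → ℝ} {a b : ℝ} (hab : a ≤ b)
    (hφ : AbsolutelyContinuousOnInterval φ a b) (hψ : IntervalIntegrable ψ volume a b)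
    (h : ∀ᵐ s ∂(volume.restrict (Ioo a b)), ∀ d, HasDerivAt φ d s → d ≤ ψ s) :
    φ b ≤ φ a + ∫ s in a..b, ψ s := by
  have h1 := hφ.integral_deriv_eq_sub
  have h2 : ∫ s in a..b, deriv φ s ≤ ∫ s in a..b, ψ s := by
    refine intervalIntegral.integral_mono_ae_restrict hab hφ.intervalIntegrable_deriv hψ ?_
    rw [← Measure.restrict_congr_set (Ioo_ae_eq_Icc (a := a) (b := b))]
    rw [Filter.EventuallyLE, ae_restrict_iff' measurableSet_Ioo]
    rw [ae_restrict_iff' measurableSet_Ioo] at h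
    filter_upwards [h, hφ.ae_differentiableAt] with s h1 h2 hs
    exact h1 hs _ (h2 (by rw [uIcc_of_le hab]; exact Ioo_subset_Icc_self hs)).hasDerivAt
  linarith

/-! ### Gronwall's inequality with an integrable coefficient. -/

lemma abs_exp_neg_sub_exp_neg_le {p q : ℝ} (hp : 0 ≤ p) (hq : 0 ≤ q) :
    |Real.exp (-p) - Real.exp (-q)| ≤ |p - q| := by
  wlog h : p ≤ q generalizing p q
  · rw [abs_sub_comm, abs_sub_comm p]; exact this hq hp (le_of_not_ge h)
  rw [abs_of_nonneg (sub_nonneg.2 (Real.exp_le_exp.2 (by linarith))), abs_of_nonpos (by linarith)]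
  have h1 : Real.exp (-q) = Real.exp (-p) * Real.exp (p - q) := by
    rw [← Real.exp_add]; congr 1; ring
  have h2 := Real.add_one_le_exp (p - q)
  have h3 : Real.exp (-p) ≤ 1 := Real.exp_le_one_iff.2 (by linarith)
  have h4 := Real.exp_pos (-p)
  rw [h1]
  nlinarith

/-- Gronwall's inequality in integral form, with an integrable coefficient. -/
lemma gronwall_integral {a b A : ℝ} {D k : ℝ → ℝ} (hab : a ≤ b) (hD : ContinuousOn D (Icc a b))
    (hk : IntervalIntegrable k volume a b) (hk0 : ∀ s, 0 ≤ k s)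
    (h : ∀ s ∈ Icc a b, D s ≤ A + ∫ r in a..s, k r * D r) :
    ∀ s ∈ Icc a b, D s ≤ A * Real.exp (∫ r in a..s, k r) := by
  intro s hs
  have hD' : ContinuousOn D (uIcc a s) := by
    rw [uIcc_of_le hs.1]; exact hD.mono (Icc_subset_Icc_right hs.2)
  have hks : IntervalIntegrable k volume a s :=
    hk.mono_set (by rw [uIcc_of_le hs.1, uIcc_of_le hab]; exact Icc_subset_Icc_right hs.2)
  have hkD : IntervalIntegrable (fun r => k r * D r) volume a s := hks.mul_continuousOn hD'
  have hpos : ∀ r ∈ Icc a s, 0 ≤ ∫ q in a..r, k q := fun r hr =>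
    intervalIntegral.integral_nonneg hr.1 fun q _ => hk0 q
  have hE : AbsolutelyContinuousOnInterval (fun r => Real.exp (-∫ q in a..r, k q)) a s := by
    refine absolutelyContinuous_of_dist_le zero_le_one (absolutelyContinuous_integral hks) ?_
    intro r hr q hq
    rw [uIcc_of_le hs.1] at hr hq
    rw [one_mul]
    exact abs_exp_neg_sub_exp_neg_le (hpos r hr) (hpos q hq)
  have hG : AbsolutelyContinuousOnInterval (fun r => A + ∫ q in a..r, k q * D q) a s :=
    absolutelyContinuous_of_dist_le zero_le_one (absolutelyContinuous_integral hkD) (by simp)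
  -- With G = A + ∫ k D, the product of G and exp(-∫ k) has derivative k (D - G) exp(-∫ k), which is
  -- nonpositive because D ≤ G and k ≥ 0.
  have key := le_of_absolutelyContinuous_of_deriv_le hs.1 (hG.fun_mul hE)
    (ψ := fun _ => 0) (by simp) (by
      rw [ae_restrict_iff' measurableSet_Ioo]
      filter_upwards [hks.ae_hasDerivAt_integral, hkD.ae_hasDerivAt_integral] with r h1 h2 hr d hd
      have hr' : r ∈ uIcc a s := by rw [uIcc_of_le hs.1]; exact Ioo_subset_Icc_self hr
      have h3 := ((h2 hr' a left_mem_uIcc).const_add A).mul (h1 hr' a left_mem_uIcc).neg.exp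
      rw [hd.unique h3]
      have h4 := h r ⟨hr.1.le, hr.2.le.trans hs.2⟩
      have h5 := Real.exp_pos (-∫ q in a..r, k q)
      have h6 := hk0 r
      have : k r * D r ≤ k r * (A + ∫ q in a..r, k q * D q) := by gcongr
      have h7 := mul_le_mul_of_nonneg_right this h5.le
      simp only [Pi.neg_apply]
      linarith)
  simp only [intervalIntegral.integral_same, neg_zero, Real.exp_zero, add_zero, mul_one,
    intervalIntegral.integral_zero] at key
  have h1 := h s hs
  have h2 : (A + ∫ r in a..s, k r * D r) ≤ A * Real.exp (∫ r in a..s, k r) := by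
    have := mul_le_mul_of_nonneg_right key (Real.exp_pos (∫ r in a..s, k r)).le
    rwa [mul_assoc, ← Real.exp_add, neg_add_cancel, Real.exp_zero, mul_one] at this
  exact h1.trans h2

end AbsolutelyContinuous

/-- Integration by parts for curves in `E3` given as primitives. -/
lemma inner_sub_inner_eq_integral {P W φ ψ : ℝ → E3} {a b : ℝ} (hab : a ≤ b)
    (hφ : IntervalIntegrable φ volume a b) (hψ : IntervalIntegrable ψ volume a b)
    (hP : ∀ s ∈ Icc a b, P s = P a + ∫ r in a..s, φ r)
    (hW : ∀ s ∈ Icc a b, W s = W a + ∫ r in a..s, ψ r) :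
    inner ℝ (P b) (W b) - inner ℝ (P a) (W a) =
      ∫ s in a..b, (inner ℝ (φ s) (W s) + inner ℝ (P s) (ψ s)) := by
  have aP := absolutelyContinuous_of_eq_add_integral hab hφ hP
  have aW := absolutelyContinuous_of_eq_add_integral hab hψ hW
  have dP := ae_hasDerivAt_of_eq_add_integral hab hφ hP
  have dW := ae_hasDerivAt_of_eq_add_integral hab hψ hW
  have coord : ∀ {Q : ℝ → E3}, AbsolutelyContinuousOnInterval Q a b → ∀ i,
      AbsolutelyContinuousOnInterval (fun s => Q s i) a b := by
    intro Q hQ i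
    refine absolutelyContinuous_of_dist_le zero_le_one hQ fun s _ r _ => ?_
    rw [one_mul, dist_eq_norm, dist_eq_norm]
    exact PiLp.norm_apply_le (Q s - Q r) i
  have coordD : ∀ {Q : ℝ → E3} {q : E3} {s : ℝ}, HasDerivAt Q q s → ∀ i,
      HasDerivAt (fun s => Q s i) (q i) s := fun {Q q s} h i =>
    ((EuclideanSpace.proj i : E3 →L[ℝ] ℝ).hasFDerivAt.comp_hasDerivAt s h)
  have hsum : AbsolutelyContinuousOnInterval (fun s => inner ℝ (P s) (W s)) a b := by
    have : (fun s => inner ℝ (P s) (W s)) =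
        fun s => P s 0 * W s 0 + P s 1 * W s 1 + P s 2 * W s 2 := by
      ext s; simp [PiLp.inner_apply, Fin.sum_univ_three, mul_comm]
    rw [this]
    exact (((coord aP 0).fun_mul (coord aW 0)).fun_add ((coord aP 1).fun_mul (coord aW 1))).fun_add
      ((coord aP 2).fun_mul (coord aW 2))
  rw [← hsum.integral_deriv_eq_sub]
  refine intervalIntegral.integral_congr_ae_restrict ?_
  rw [uIoc_of_le hab, ← Measure.restrict_congr_set (Ioo_ae_eq_Ioc (a := a) (b := b))]
  filter_upwards [dP, dW] with s h1 h2
  rw [(h1.inner ℝ h2).deriv, add_comm]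

/-! ### The matrix `B` -/

lemma mulCol_B (ε : ℝ) (y a : E3) :
    mulCol (B ε y) a = !₂[a 0, a 1, -y 1 * a 0 + y 0 * a 1 + ε * a 2] := by
  ext i
  fin_cases i <;> simp [mulCol, B, dotProduct, Fin.sum_univ_three]

lemma rowMul_B (ε : ℝ) (y p : E3) :
    rowMul p (B ε y) = !₂[p 0 - y 1 * p 2, p 1 + y 0 * p 2, ε * p 2] := by
  ext i
  fin_cases i <;> simp [rowMul, B, Matrix.vecHead, Matrix.vecTail] <;> ring

/-- Transposition, moving `M` between velocities and covectors; bounds for `rowMul` follow by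
duality from those for `mulCol`. -/
lemma inner_mulCol (M : Matrix (Fin 3) (Fin 3) ℝ) (p a : E3) :
    inner ℝ p (mulCol M a) = inner ℝ (rowMul p M) a := by
  simp only [mulCol, rowMul, PiLp.inner_apply, Fin.sum_univ_three, Matrix.mulVec, Matrix.vecMul,
    dotProduct, RCLike.inner_apply, conj_trivial]
  ring

lemma rowMul_transpose (M : Matrix (Fin 3) (Fin 3) ℝ) (v : E3) :
    rowMul v M.transpose = mulCol M v := by
  simp [rowMul, mulCol, Matrix.vecMul_transpose]

lemma mulCol_add (M : Matrix (Fin 3) (Fin 3) ℝ) (a b : E3) :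
    mulCol M (a + b) = mulCol M a + mulCol M b := by
  simp [mulCol, Matrix.mulVec_add]

lemma mulCol_smul (M : Matrix (Fin 3) (Fin 3) ℝ) (c : ℝ) (a : E3) :
    mulCol M (c • a) = c • mulCol M a := by
  simp [mulCol, Matrix.mulVec_smul]

lemma mulCol_neg (M : Matrix (Fin 3) (Fin 3) ℝ) (a : E3) :
    mulCol M (-a) = -mulCol M a := by
  simp [mulCol, Matrix.mulVec_neg]

lemma mulCol_sub (M : Matrix (Fin 3) (Fin 3) ℝ) (a b : E3) :
    mulCol M (a - b) = mulCol M a - mulCol M b := by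
  rw [sub_eq_add_neg, mulCol_add, mulCol_neg, sub_eq_add_neg]

lemma rowMul_add (M : Matrix (Fin 3) (Fin 3) ℝ) (a b : E3) :
    rowMul (a + b) M = rowMul a M + rowMul b M := by
  simp [rowMul, Matrix.add_vecMul]

lemma rowMul_smul (M : Matrix (Fin 3) (Fin 3) ℝ) (c : ℝ) (a : E3) :
    rowMul (c • a) M = c • rowMul a M := by
  simp [rowMul, Matrix.smul_vecMul]

lemma rowMul_neg (M : Matrix (Fin 3) (Fin 3) ℝ) (a : E3) :
    rowMul (-a) M = -rowMul a M := by
  simp [rowMul, Matrix.neg_vecMul]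

lemma rowMul_sub (M : Matrix (Fin 3) (Fin 3) ℝ) (a b : E3) :
    rowMul (a - b) M = rowMul a M - rowMul b M := by
  rw [sub_eq_add_neg, rowMul_add, rowMul_neg, sub_eq_add_neg]

lemma norm_sq_E3 (a : E3) : ‖a‖ ^ 2 = a 0 ^ 2 + a 1 ^ 2 + a 2 ^ 2 := by
  simp [EuclideanSpace.norm_sq_eq, Fin.sum_univ_three]

/-- The vertical vector `(0, 0, w₁ a₂ - w₂ a₁)` by which `B(y) a` changes with `y`. -/
def vert (w a : E3) : E3 := !₂[0, 0, w 0 * a 1 - w 1 * a 0]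

/-- B is affine in the state and the state enters only through its last row. The correction is
vertical and reads only horizontal coordinates, so the state equation is triangular. -/
lemma mulCol_B_add_left (ε : ℝ) (y w a : E3) :
    mulCol (B ε (y + w)) a = mulCol (B ε y) a + vert w a := by
  rw [mulCol_B, mulCol_B, vert]
  ext i
  fin_cases i <;> simp
  ring

lemma mulCol_B_sub (ε : ℝ) (y z a : E3) :
    mulCol (B ε y) a - mulCol (B ε z) a = vert (y - z) a := by
  have := mulCol_B_add_left ε z (y - z) a
  rw [add_sub_cancel] at this
  rw [this, add_sub_cancel_left]

lemma norm_vert_le (w a : E3) : ‖vert w a‖ ≤ ‖w‖ * ‖a‖ := by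
  refine abs_le_of_sq_le_sq' ?_ (by positivity) |>.2
  rw [mul_pow, norm_sq_E3, norm_sq_E3, norm_sq_E3]
  simp only [vert, PiLp.toLp_apply, Matrix.cons_val]
  -- Lagrange's identity in the horizontal plane; the remaining squares are the terms of the product
  -- that involve a third coordinate.
  nlinarith [sq_nonneg (w 0 * a 0 + w 1 * a 1), sq_nonneg (w 0 * a 2), sq_nonneg (w 1 * a 2),
    sq_nonneg (w 2 * a 2), sq_nonneg (w 2 * a 0), sq_nonneg (w 2 * a 1)]

lemma norm_mulCol_B_sub_le (ε : ℝ) (y z a : E3) :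
    ‖mulCol (B ε y) a - mulCol (B ε z) a‖ ≤ ‖y - z‖ * ‖a‖ := by
  rw [mulCol_B_sub]; exact norm_vert_le _ _

lemma norm_mulCol_B_le {ε : ℝ} (hε : ε ∈ Icc (0 : ℝ) 1) (y a : E3) :
    ‖mulCol (B ε y) a‖ ≤ (1 + ‖y‖) * ‖a‖ := by
  have h1 := mulCol_B_add_left ε 0 y a
  rw [zero_add] at h1
  have h2 : ‖mulCol (B ε 0) a‖ ≤ ‖a‖ := by
    refine abs_le_of_sq_le_sq' ?_ (by positivity) |>.2
    rw [norm_sq_E3, norm_sq_E3, mulCol_B]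
    simp only [PiLp.zero_apply, Matrix.cons_val]
    nlinarith [mul_nonneg (sub_nonneg.2 (pow_le_one₀ hε.1 hε.2 : ε ^ 2 ≤ 1)) (sq_nonneg (a 2))]
  calc _ ≤ ‖a‖ + ‖y‖ * ‖a‖ := by
        rw [h1]; exact (norm_add_le _ _).trans (add_le_add h2 (norm_vert_le _ _))
    _ = _ := by ring

lemma norm_le_of_inner_le {v : E3} {c : ℝ} (hc : 0 ≤ c)
    (h : ∀ q : E3, inner ℝ v q ≤ c * ‖q‖) : ‖v‖ ≤ c := by
  have := h v
  rw [real_inner_self_eq_norm_sq] at this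
  by_contra! hlt
  nlinarith [norm_nonneg v]

lemma norm_rowMul_B_le {ε : ℝ} (hε : ε ∈ Icc (0 : ℝ) 1) (y p : E3) :
    ‖rowMul p (B ε y)‖ ≤ (1 + ‖y‖) * ‖p‖ := by
  refine norm_le_of_inner_le (by positivity) fun q => ?_
  rw [← inner_mulCol]
  calc _ ≤ ‖p‖ * ((1 + ‖y‖) * ‖q‖) := (real_inner_le_norm _ _).trans
        (by gcongr; exact norm_mulCol_B_le hε y q)
    _ = _ := by ring

lemma norm_rowMul_B_sub_le (ε : ℝ) (y z p : E3) :
    ‖rowMul p (B ε y) - rowMul p (B ε z)‖ ≤ ‖y - z‖ * ‖p‖ := by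
  refine norm_le_of_inner_le (by positivity) fun q => ?_
  rw [inner_sub_left, ← inner_mulCol, ← inner_mulCol, ← inner_sub_right]
  calc _ ≤ ‖p‖ * (‖y - z‖ * ‖q‖) := (real_inner_le_norm _ _).trans
        (by gcongr; exact norm_mulCol_B_sub_le ε y z q)
    _ = _ := by ring

lemma continuous_mulCol_B (ε : ℝ) : Continuous fun q : E3 × E3 => mulCol (B ε q.1) q.2 := by
  simp only [mulCol_B]
  refine (PiLp.continuous_toLp 2 _).comp (continuous_pi fun i => ?_)
  fin_cases i <;> simp <;> fun_prop

lemma continuous_rowMul_B (ε : ℝ) : Continuous fun q : E3 × E3 => rowMul q.2 (B ε q.1) := by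
  simp only [rowMul_B]
  refine (PiLp.continuous_toLp 2 _).comp (continuous_pi fun i => ?_)
  fin_cases i <;> simp <;> fun_prop

lemma continuous_vert : Continuous fun q : E3 × E3 => vert q.1 q.2 := by
  simp only [vert]
  refine (PiLp.continuous_toLp 2 _).comp (continuous_pi fun i => ?_)
  fin_cases i <;> simp <;> fun_prop

/-! ### Square integrable controls -/

/-- Square integrable controls on `[a, b]`. -/
abbrev Control (a b : ℝ) (α : ℝ → E3) : Prop := MemLp α 2 (volume.restrict (Ioc a b))

namespace Control

variable {a b c d : ℝ} {α β : ℝ → E3}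

lemma mono (h : Control a b α) (hac : a ≤ c) (hdb : d ≤ b) : Control c d α :=
  h.mono_measure (Measure.restrict_mono (Ioc_subset_Ioc hac hdb) le_rfl)

lemma intervalIntegrable (h : Control a b α) (hab : a ≤ b) : IntervalIntegrable α volume a b := by
  rw [intervalIntegrable_iff_integrableOn_Ioc_of_le hab]
  exact h.integrable one_le_two

lemma intervalIntegrable_sq (h : Control a b α) (hab : a ≤ b) :
    IntervalIntegrable (fun s => ‖α s‖ ^ 2) volume a b := by
  rw [intervalIntegrable_iff_integrableOn_Ioc_of_le hab]
  exact (memLp_two_iff_integrable_sq_norm h.1).1 h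

lemma intervalIntegrable_inner (h : Control a b α) (h' : Control a b β) (hab : a ≤ b) :
    IntervalIntegrable (fun s => inner ℝ (α s) (β s)) volume a b := by
  rw [intervalIntegrable_iff_integrableOn_Ioc_of_le hab]
  refine Integrable.mono' (((memLp_two_iff_integrable_sq_norm h.1).1 h).add
    ((memLp_two_iff_integrable_sq_norm h'.1).1 h')) (h.1.inner h'.1) (ae_of_all _ fun s => ?_)
  simp only [Pi.add_apply]
  refine (norm_inner_le_norm _ _).trans ?_
  nlinarith [sq_nonneg (‖α s‖ - ‖β s‖), sq_nonneg ‖α s‖, sq_nonneg ‖β s‖]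

lemma sub (h : Control a b α) (h' : Control a b β) : Control a b (fun s => α s - β s) :=
  MemLp.sub h h'

lemma add (h : Control a b α) (h' : Control a b β) : Control a b (fun s => α s + β s) :=
  MemLp.add h h'

lemma const (v : E3) : Control a b (fun _ => v) := memLp_const v

lemma of_bound (hm : AEStronglyMeasurable α (volume.restrict (Ioc a b))) (C : ℝ)
    (hC : ∀ᵐ s ∂(volume.restrict (Ioc a b)), ‖α s‖ ≤ C) : Control a b α :=
  MemLp.of_bound hm C hC

end Control

/-- Cauchy-Schwarz on an interval, obtained by expanding the nonnegative variance of `k` about its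
mean. -/
lemma sq_integral_le {a b : ℝ} {k : ℝ → ℝ} (hab : a ≤ b) (hk : IntervalIntegrable k volume a b)
    (hk2 : IntervalIntegrable (fun s => k s ^ 2) volume a b) :
    (∫ s in a..b, k s) ^ 2 ≤ (b - a) * ∫ s in a..b, k s ^ 2 := by
  rcases hab.eq_or_lt with rfl | hlt
  · simp
  set I := ∫ s in a..b, k s
  have h0 : 0 ≤ ∫ s in a..b, (k s - I / (b - a)) ^ 2 :=
    intervalIntegral.integral_nonneg hab fun s _ => sq_nonneg _
  have h1 : ∫ s in a..b, (k s - I / (b - a)) ^ 2 =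
      (∫ s in a..b, k s ^ 2) - 2 * (I / (b - a)) * I + (b - a) * (I / (b - a)) ^ 2 := by
    have : ∀ s, (k s - I / (b - a)) ^ 2 =
        k s ^ 2 - 2 * (I / (b - a)) * k s + (I / (b - a)) ^ 2 := fun s => by ring
    simp_rw [this]
    rw [intervalIntegral.integral_add (hk2.sub (hk.const_mul _)) (by simp),
      intervalIntegral.integral_sub hk2 (hk.const_mul _), intervalIntegral.integral_const_mul,
      intervalIntegral.integral_const, smul_eq_mul]
  have hpos : 0 < b - a := sub_pos.2 hlt
  have h2 : (b - a) * ((∫ s in a..b, k s ^ 2) - 2 * (I / (b - a)) * I +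
      (b - a) * (I / (b - a)) ^ 2) = (b - a) * (∫ s in a..b, k s ^ 2) - I ^ 2 := by
    field_simp; ring
  have := mul_nonneg hpos.le (h1 ▸ h0)
  linarith

/-- The energy `∫ |α|²` of a control. -/
def energy (a b : ℝ) (α : ℝ → E3) : ℝ := ∫ s in a..b, ‖α s‖ ^ 2

lemma energy_nonneg {a b : ℝ} (hab : a ≤ b) (α : ℝ → E3) : 0 ≤ energy a b α :=
  intervalIntegral.integral_nonneg hab fun _ _ => sq_nonneg _

lemma integral_mono_interval_of_nonneg {k : ℝ → ℝ} {a b c d : ℝ} (hac : a ≤ c) (hcd : c ≤ d)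
    (hdb : d ≤ b) (hk : IntervalIntegrable k volume a b) (hk0 : ∀ s, 0 ≤ k s) :
    ∫ s in c..d, k s ≤ ∫ s in a..b, k s :=
  intervalIntegral.integral_mono_interval hac hcd hdb (ae_of_all _ hk0) hk

lemma integral_norm_le_sqrt {a b : ℝ} {α : ℝ → E3} (hab : a ≤ b) (h : Control a b α) :
    ∫ s in a..b, ‖α s‖ ≤ √((b - a) * energy a b α) :=
  Real.le_sqrt_of_sq_le
    (sq_integral_le hab (h.intervalIntegrable hab).norm (h.intervalIntegrable_sq hab))

/-! ### Controlled trajectories -/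

/-- `y` is the trajectory on `[a, b]` driven by the square integrable control `α`. -/
structure Traj (ε a b : ℝ) (y α : ℝ → E3) : Prop where
  control : Control a b α
  cont : ContinuousOn y (Icc a b)
  eq : ∀ s ∈ Icc a b, y s = y a + ∫ r in a..s, mulCol (B ε (y r)) (α r)

section Bilinear

variable {a b : ℝ} {y α : ℝ → E3}

lemma aestronglyMeasurable_of_continuousOn (hy : ContinuousOn y (Icc a b)) :
    AEStronglyMeasurable y (volume.restrict (Ioc a b)) :=
  (hy.mono Ioc_subset_Icc_self).aestronglyMeasurable measurableSet_Ioc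

/-- A continuous map which is bilinearly bounded gives an integrable function when composed
with a continuous curve and a square integrable one. -/
lemma control_comp {Φ : E3 × E3 → E3} (hΦ : Continuous Φ)
    (hb : ∀ p q, ‖Φ (p, q)‖ ≤ (1 + ‖p‖) * ‖q‖)
    (hy : ContinuousOn y (Icc a b)) (hα : Control a b α) :
    Control a b (fun r => Φ (y r, α r)) := by
  obtain ⟨M, hM⟩ := isCompact_Icc.exists_bound_of_continuousOn hy
  refine MemLp.of_le_mul (c := 1 + M) hα
    (hΦ.comp_aestronglyMeasurable ((aestronglyMeasurable_of_continuousOn hy).prodMk hα.1)) ?_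
  rw [ae_restrict_iff' measurableSet_Ioc]
  refine ae_of_all _ fun s hs => (hb _ _).trans ?_
  have := hM s (Ioc_subset_Icc_self hs)
  gcongr

lemma control_mulCol {ε : ℝ} (hε : ε ∈ Icc (0 : ℝ) 1)
    (hy : ContinuousOn y (Icc a b)) (hα : Control a b α) :
    Control a b (fun r => mulCol (B ε (y r)) (α r)) :=
  control_comp (continuous_mulCol_B ε) (fun p q => norm_mulCol_B_le hε p q) hy hα

lemma control_vert (hy : ContinuousOn y (Icc a b)) (hα : Control a b α) :
    Control a b (fun r => vert (y r) (α r)) :=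
  control_comp continuous_vert
    (fun p q => (norm_vert_le p q).trans (by nlinarith [norm_nonneg p, norm_nonneg q])) hy hα

end Bilinear

namespace Traj

variable {ε a b c d : ℝ} {y α z β : ℝ → E3}

lemma intervalIntegrable (h : Traj ε a b y α) (hε : ε ∈ Icc (0 : ℝ) 1) (hab : a ≤ b) :
    IntervalIntegrable (fun r => mulCol (B ε (y r)) (α r)) volume a b :=
  (control_mulCol hε h.cont h.control).intervalIntegrable hab

lemma eq_from (h : Traj ε a b y α) (hε : ε ∈ Icc (0 : ℝ) 1) {r s : ℝ} (har : a ≤ r) (hrs : r ≤ s)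
    (hsb : s ≤ b) : y s = y r + ∫ q in r..s, mulCol (B ε (y q)) (α q) := by
  have hi := h.intervalIntegrable hε (har.trans (hrs.trans hsb))
  have hab := har.trans (hrs.trans hsb)
  rw [h.eq s ⟨har.trans hrs, hsb⟩, h.eq r ⟨har, hrs.trans hsb⟩, add_assoc,
    intervalIntegral.integral_add_adjacent_intervals]
  · exact hi.mono_set (by
      rw [uIcc_of_le har, uIcc_of_le hab]; exact Icc_subset_Icc_right (hrs.trans hsb))
  · exact hi.mono_set (by rw [uIcc_of_le hrs, uIcc_of_le hab]; exact Icc_subset_Icc har hsb)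

lemma mono (h : Traj ε a b y α) (hε : ε ∈ Icc (0 : ℝ) 1) (hac : a ≤ c) (hdb : d ≤ b) : Traj ε c d y α where
  control := h.control.mono hac hdb
  cont := h.cont.mono (Icc_subset_Icc hac hdb)
  eq _ hs := h.eq_from hε hac hs.1 (hs.2.trans hdb)

lemma one_add_norm_le (h : Traj ε a b y α) (hε : ε ∈ Icc (0 : ℝ) 1) (hab : a ≤ b) :
    ∀ s ∈ Icc a b, 1 + ‖y s‖ ≤ (1 + ‖y a‖) * Real.exp (∫ r in a..b, ‖α r‖) := by
  intro s hs
  have hk := (h.control.intervalIntegrable hab).norm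
  have h1 := gronwall_integral (D := fun s => 1 + ‖y s‖) (k := fun r => ‖α r‖) hab
    (continuousOn_const.add h.cont.norm) hk (fun _ => norm_nonneg _) (A := 1 + ‖y a‖) (by
      intro s hs
      have hT := h.mono hε le_rfl hs.2
      have : ‖∫ r in a..s, mulCol (B ε (y r)) (α r)‖ ≤ ∫ r in a..s, ‖α r‖ * (1 + ‖y r‖) := by
        refine (intervalIntegral.norm_integral_le_integral_norm hs.1).trans ?_
        refine intervalIntegral.integral_mono_on hs.1 (hT.intervalIntegrable hε hs.1).norm
          ((hT.control.intervalIntegrable hs.1).norm.mul_continuousOn ?_) fun r _ => ?_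
        · rw [uIcc_of_le hs.1]; exact continuousOn_const.add hT.cont.norm
        · rw [mul_comm]; exact norm_mulCol_B_le hε _ _
      have h2 := norm_add_le (y a) (∫ r in a..s, mulCol (B ε (y r)) (α r))
      rw [← h.eq s hs] at h2
      linarith) s hs
  refine h1.trans ?_
  gcongr
  exact integral_mono_interval_of_nonneg le_rfl hs.1 hs.2 hk fun _ => norm_nonneg _

lemma norm_sub_init_le (h : Traj ε a b y α) (hε : ε ∈ Icc (0 : ℝ) 1) (hab : a ≤ b) {M : ℝ}
    (hM : ∀ s ∈ Icc a b, 1 + ‖y s‖ ≤ M) :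
    ∀ s ∈ Icc a b, ‖y s - y a‖ ≤ M * ∫ r in a..b, ‖α r‖ := by
  intro s hs
  have hT := h.mono hε le_rfl hs.2
  have hM0 : 0 ≤ M := le_trans (by positivity) (hM s hs)
  rw [h.eq s hs, add_sub_cancel_left]
  calc _ ≤ ∫ r in a..s, M * ‖α r‖ := by
        refine (intervalIntegral.norm_integral_le_integral_norm hs.1).trans ?_
        refine intervalIntegral.integral_mono_on hs.1 (hT.intervalIntegrable hε hs.1).norm
          ((hT.control.intervalIntegrable hs.1).norm.const_mul _) fun r hr => ?_
        refine (norm_mulCol_B_le hε _ _).trans ?_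
        have := hM r ⟨hr.1, hr.2.trans hs.2⟩
        gcongr
    _ = M * ∫ r in a..s, ‖α r‖ := intervalIntegral.integral_const_mul _ _
    _ ≤ _ := by
        gcongr
        exact integral_mono_interval_of_nonneg le_rfl hs.1 hs.2
          (h.control.intervalIntegrable hab).norm fun _ => norm_nonneg _

/-- The difference of two trajectories. -/
lemma sub_eq (h : Traj ε a b y α) (h' : Traj ε a b z β) (hε : ε ∈ Icc (0 : ℝ) 1) :
    ∀ s ∈ Icc a b, z s - y s = (z a - y a) +
      ∫ r in a..s, (vert (z r - y r) (β r) + mulCol (B ε (y r)) (β r - α r)) := by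
  intro s hs
  have hT := h.mono hε le_rfl hs.2
  have hT' := h'.mono hε le_rfl hs.2
  rw [h.eq s hs, h'.eq s hs, add_sub_add_comm,
    ← intervalIntegral.integral_sub (hT'.intervalIntegrable hε hs.1)
      (hT.intervalIntegrable hε hs.1)]
  congr 2
  ext1 r
  rw [mulCol_sub, ← mulCol_B_sub ε]
  abel

lemma intervalIntegrable_sub (h : Traj ε a b y α) (h' : Traj ε a b z β) (hε : ε ∈ Icc (0 : ℝ) 1)
    (hab : a ≤ b) :
    IntervalIntegrable (fun r => vert (z r - y r) (β r) + mulCol (B ε (y r)) (β r - α r))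
      volume a b :=
  ((control_vert (h'.cont.sub h.cont) h'.control).intervalIntegrable hab).add
    ((control_mulCol hε h.cont (h'.control.sub h.control)).intervalIntegrable hab)

/-- Stability of trajectories with respect to the initial point and the control. -/
lemma norm_sub_le (h : Traj ε a b y α) (h' : Traj ε a b z β) (hε : ε ∈ Icc (0 : ℝ) 1)
    (hab : a ≤ b) {M : ℝ} (hM : ∀ s ∈ Icc a b, 1 + ‖y s‖ ≤ M) :
    ∀ s ∈ Icc a b, ‖z s - y s‖ ≤ (‖z a - y a‖ + M * ∫ r in a..b, ‖β r - α r‖) *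
      Real.exp (∫ r in a..b, ‖β r‖) := by
  intro s hs
  have hM0 : 0 ≤ M := le_trans (by positivity) (hM s hs)
  have hk := (h'.control.intervalIntegrable hab).norm
  have hη := ((h'.control.sub h.control).intervalIntegrable hab).norm
  have hη0 : 0 ≤ ∫ r in a..b, ‖β r - α r‖ :=
    intervalIntegral.integral_nonneg hab fun _ _ => norm_nonneg _
  have h1 := gronwall_integral (D := fun s => ‖z s - y s‖) (k := fun r => ‖β r‖) hab
    (h'.cont.sub h.cont).norm hk (fun _ => norm_nonneg _)
    (A := ‖z a - y a‖ + M * ∫ r in a..b, ‖β r - α r‖) (by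
      intro s hs
      have hT := h.mono hε le_rfl hs.2
      have hT' := h'.mono hε le_rfl hs.2
      have i1 : IntervalIntegrable (fun r => ‖β r‖ * ‖z r - y r‖) volume a s :=
        (hT'.control.intervalIntegrable hs.1).norm.mul_continuousOn (by
          rw [uIcc_of_le hs.1]; exact (hT'.cont.sub hT.cont).norm)
      have i2 : IntervalIntegrable (fun r => M * ‖β r - α r‖) volume a s :=
        ((hT'.control.sub hT.control).intervalIntegrable hs.1).norm.const_mul M
      have h3 : ‖∫ r in a..s, (vert (z r - y r) (β r) + mulCol (B ε (y r)) (β r - α r))‖ ≤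
          (∫ r in a..s, ‖β r‖ * ‖z r - y r‖) + M * ∫ r in a..b, ‖β r - α r‖ := by
        refine (intervalIntegral.norm_integral_le_integral_norm hs.1).trans ?_
        calc _ ≤ ∫ r in a..s, (‖β r‖ * ‖z r - y r‖ + M * ‖β r - α r‖) := by
              refine intervalIntegral.integral_mono_on hs.1
                (hT.intervalIntegrable_sub hT' hε hs.1).norm (i1.add i2) fun r hr => ?_
              refine (norm_add_le _ _).trans (add_le_add ?_ ?_)
              · rw [mul_comm]; exact norm_vert_le _ _
              · refine (norm_mulCol_B_le hε _ _).trans ?_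
                have := hM r ⟨hr.1, hr.2.trans hs.2⟩
                gcongr
          _ ≤ _ := by
              rw [intervalIntegral.integral_add i1 i2, intervalIntegral.integral_const_mul]
              gcongr
              exact integral_mono_interval_of_nonneg le_rfl hs.1 hs.2 hη fun _ => norm_nonneg _
      have h2 := norm_add_le (z a - y a)
        (∫ r in a..s, (vert (z r - y r) (β r) + mulCol (B ε (y r)) (β r - α r)))
      rw [← h.sub_eq h' hε s hs] at h2
      linarith) s hs
  refine h1.trans ?_
  gcongr
  exact integral_mono_interval_of_nonneg le_rfl hs.1 hs.2 hk fun _ => norm_nonneg _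

/-- Changing a trajectory and its control outside a neighbourhood of the interval. -/
lemma congr (h : Traj ε a b y α) (hab : a ≤ b) (hz : EqOn z y (Icc a b))
    (hβ : β =ᵐ[volume.restrict (Ioc a b)] α) : Traj ε a b z β where
  control := (memLp_congr_ae hβ).2 h.control
  cont := h.cont.congr hz
  eq s hs := by
    rw [hz hs, hz (left_mem_Icc.2 hab), h.eq s hs]
    congr 1
    refine intervalIntegral.integral_congr_ae ?_
    rw [Filter.EventuallyEq, ae_restrict_iff' measurableSet_Ioc] at hβ
    filter_upwards [hβ] with r hr hr'
    rw [uIoc_of_le hs.1] at hr'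
    rw [hr ⟨hr'.1, hr'.2.trans hs.2⟩, hz ⟨hr'.1.le, hr'.2.trans hs.2⟩]

/-- Concatenation of trajectories. -/
lemma concat (h : Traj ε a b y α) (h' : Traj ε b c z β) (hε : ε ∈ Icc (0 : ℝ) 1) (hab : a ≤ b)
    (hbc : b ≤ c) (hz : z b = y b) :
    Traj ε a c (fun s => if s ≤ b then y s else z s) (fun s => if s ≤ b then α s else β s) := by
  have e1 : EqOn (fun s => if s ≤ b then y s else z s) y (Icc a b) := fun s hs => by
    simp [hs.2]
  have e2 : EqOn (fun s => if s ≤ b then y s else z s) z (Icc b c) := fun s hs => by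
    rcases hs.1.eq_or_lt with rfl | hlt
    · simp [hz]
    · simp [hlt.not_ge]
  have T1 : Traj ε a b (fun s => if s ≤ b then y s else z s) (fun s => if s ≤ b then α s else β s) :=
    h.congr hab e1 (by
      rw [Filter.EventuallyEq, ae_restrict_iff' measurableSet_Ioc]
      exact ae_of_all _ fun s hs => by simp [hs.2])
  have T2 : Traj ε b c (fun s => if s ≤ b then y s else z s) (fun s => if s ≤ b then α s else β s) :=
    h'.congr hbc e2 (by
      rw [Filter.EventuallyEq, ae_restrict_iff' measurableSet_Ioc]
      exact ae_of_all _ fun s hs => by simp [hs.1.not_ge])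
  refine ⟨?_, ?_, ?_⟩
  · have hm : volume.restrict (Ioc a c) = volume.restrict (Ioc a b) + volume.restrict (Ioc b c) := by
      rw [← Ioc_union_Ioc_eq_Ioc hab hbc, Measure.restrict_union (Ioc_disjoint_Ioc_of_le le_rfl)
        measurableSet_Ioc]
    rw [Control, hm]
    have hm1 := T1.control.1.add_measure T2.control.1
    rw [memLp_two_iff_integrable_sq_norm hm1]
    exact ((memLp_two_iff_integrable_sq_norm T1.control.1).1 T1.control).add_measure
      ((memLp_two_iff_integrable_sq_norm T2.control.1).1 T2.control)
  · rw [← Icc_union_Icc_eq_Icc hab hbc]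
    exact T1.cont.union_of_isClosed T2.cont isClosed_Icc isClosed_Icc
  · intro s hs
    rcases le_total s b with hsb | hbs
    · exact T1.eq s ⟨hs.1, hsb⟩
    · have hT2 := T2.mono hε le_rfl hs.2
      rw [T2.eq s ⟨hbs, hs.2⟩, T1.eq b ⟨hab, le_rfl⟩, add_assoc,
        intervalIntegral.integral_add_adjacent_intervals (T1.intervalIntegrable hε hab)
          (hT2.intervalIntegrable hε hbs)]

end Traj

/-- Existence of the trajectory with given control and initial point. -/
lemma exists_traj {ε a b : ℝ} (hε : ε ∈ Icc (0 : ℝ) 1) (hab : a ≤ b) (x : E3) {α : ℝ → E3}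
    (hα : Control a b α) : ∃ y, Traj ε a b y α ∧ y a = x := by
  have i0 := (control_mulCol hε (continuousOn_const (c := (0 : E3))) hα).intervalIntegrable hab
  -- No fixed point is needed. The curve `h` already has the correct horizontal coordinates; the
  -- integral of `vert` added below changes only the third one, which the dynamics never reads.
  set h : ℝ → E3 := fun s => x + ∫ r in a..s, mulCol (B ε 0) (α r) with hh
  have hc : ContinuousOn h (Icc a b) := by
    rw [← uIcc_of_le hab]
    exact continuousOn_const.add (absolutelyContinuous_integral i0).continuousOn
  have i1 := (control_vert hc hα).intervalIntegrable hab
  refine ⟨fun s => h s + ∫ r in a..s, vert (h r) (α r), ⟨hα, ?_, ?_⟩, by simp [hh]⟩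
  · refine hc.add ?_
    rw [← uIcc_of_le hab]
    exact (absolutelyContinuous_integral i1).continuousOn
  · intro s hs
    have hsub : uIcc a s ⊆ uIcc a b := by
      rw [uIcc_of_le hs.1, uIcc_of_le hab]; exact Icc_subset_Icc_right hs.2
    have key : ∀ r ∈ uIcc a s, mulCol (B ε (h r + ∫ q in a..r, vert (h q) (α q))) (α r) =
        mulCol (B ε 0) (α r) + vert (h r) (α r) := by
      intro r hr
      have hir : IntervalIntegrable (fun q => vert (h q) (α q)) volume a r :=
        i1.mono_set (uIcc_subset_uIcc_left (hsub hr))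
      have hcoord : ∀ i : Fin 3, (∫ q in a..r, vert (h q) (α q)) i =
          ∫ q in a..r, (vert (h q) (α q)) i := fun i =>
        ((EuclideanSpace.proj i : E3 →L[ℝ] ℝ).intervalIntegral_comp_comm hir).symm
      have h0 : (∫ q in a..r, vert (h q) (α q)) 0 = 0 := by rw [hcoord]; simp [vert]
      have h1 : (∫ q in a..r, vert (h q) (α q)) 1 = 0 := by rw [hcoord]; simp [vert]
      have hz := mulCol_B_add_left ε 0 (h r + ∫ q in a..r, vert (h q) (α q)) (α r)
      rw [zero_add] at hz
      rw [hz]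
      congr 1
      simp only [vert] at h0 h1 ⊢
      simp [h0, h1]
    rw [intervalIntegral.integral_congr key, intervalIntegral.integral_add (i0.mono_set hsub)
      (i1.mono_set hsub)]
    simp [hh, add_assoc]

/-- Square integrability of the control makes the velocity integrable along a continuous curve, so
the almost everywhere equation and the integral equation are equivalent. -/
lemma admissible_iff_traj {ε T t : ℝ} (hε : ε ∈ Icc (0 : ℝ) 1) (ht : t ≤ T) {x : E3}
    {y α : ℝ → E3} : Admissible ε T x t y α ↔ Traj ε t T y α ∧ y t = x := by
  constructor
  · intro h
    have hc := h.ac.continuousOn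
    rw [uIcc_of_le ht] at hc
    have hα : Control t T α := by
      rw [Control, Measure.restrict_congr_set Ioc_ae_eq_Icc]; exact h.memLp
    exact ⟨⟨hα, hc, eq_add_integral_of_absolutelyContinuous ht h.ac h.dynamics
      ((control_mulCol hε hc hα).intervalIntegrable ht)⟩, h.init⟩
  · rintro ⟨h, h0⟩
    refine ⟨absolutelyContinuous_of_eq_add_integral ht (h.intervalIntegrable hε ht) h.eq, ?_, h0,
      ae_hasDerivAt_of_eq_add_integral ht (h.intervalIntegrable hε ht) h.eq⟩
    rw [← Measure.restrict_congr_set Ioc_ae_eq_Icc]; exact h.control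

/-! ### The control problem and its value function -/

lemma c2Norm_le_iff {h : E3 → ℝ} {C : ℝ} (hC : 0 ≤ C) : c2Norm h ≤ ENNReal.ofReal C ↔
    ∀ x, |h x| + ‖fderiv ℝ h x‖ + ‖fderiv ℝ (fderiv ℝ h) x‖ ≤ C := by
  rw [c2Norm, iSup_le_iff]
  exact forall_congr' fun x => ENNReal.ofReal_le_ofReal_iff hC

lemma norm_gradient (h : E3 → ℝ) (x : E3) : ‖gradient h x‖ = ‖fderiv ℝ h x‖ := by
  simp [gradient]

lemma norm_gradient_sub (h k : E3 → ℝ) (x y : E3) :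
    ‖gradient h x - gradient k y‖ = ‖fderiv ℝ h x - fderiv ℝ k y‖ := by
  rw [gradient, gradient, ← map_sub, LinearIsometryEquiv.norm_map]

/-- The bounds on a `C²` function with bounded norm that are used below. -/
structure C2Bound (C : ℝ) (h : E3 → ℝ) : Prop where
  abs_le : ∀ x, |h x| ≤ C
  lip : ∀ x y, |h x - h y| ≤ C * ‖x - y‖
  grad_le : ∀ x, ‖gradient h x‖ ≤ C
  grad_lip : ∀ x y, ‖gradient h x - gradient h y‖ ≤ C * ‖x - y‖
  taylor : ∀ x y, |h y - h x - inner ℝ (gradient h x) (y - x)| ≤ C * ‖y - x‖ ^ 2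

lemma C2Bound.of_c2Norm {C : ℝ} (hC : 0 ≤ C) {h : E3 → ℝ} (hh : ContDiff ℝ 2 h)
    (hn : c2Norm h ≤ ENNReal.ofReal C) : C2Bound C h := by
  rw [c2Norm_le_iff hC] at hn
  have hd : Differentiable ℝ h := hh.differentiable (by norm_num)
  have hd2 : Differentiable ℝ (fderiv ℝ h) :=
    (hh.fderiv_right (m := 1) (by norm_num)).differentiable (by norm_num)
  have b0 : ∀ x, |h x| ≤ C := fun x => by
    linarith [hn x, norm_nonneg (fderiv ℝ h x), norm_nonneg (fderiv ℝ (fderiv ℝ h) x)]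
  have b1 : ∀ x, ‖fderiv ℝ h x‖ ≤ C := fun x => by
    linarith [hn x, abs_nonneg (h x), norm_nonneg (fderiv ℝ (fderiv ℝ h) x)]
  have b2 : ∀ x, ‖fderiv ℝ (fderiv ℝ h) x‖ ≤ C := fun x => by
    linarith [hn x, abs_nonneg (h x), norm_nonneg (fderiv ℝ h x)]
  have l1 : ∀ x y, ‖fderiv ℝ h x - fderiv ℝ h y‖ ≤ C * ‖x - y‖ := fun x y =>
    convex_univ.norm_image_sub_le_of_norm_fderiv_le (fun z _ => hd2 z) (fun z _ => b2 z)
      (mem_univ y) (mem_univ x)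
  refine ⟨b0, fun x y => ?_, fun x => (norm_gradient h x).trans_le (b1 x), fun x y => ?_,
    fun x y => ?_⟩
  · exact convex_univ.norm_image_sub_le_of_norm_fderiv_le (𝕜 := ℝ) (fun z _ => hd z)
      (fun z _ => b1 z) (mem_univ y) (mem_univ x)
  · rw [norm_gradient_sub]; exact l1 x y
  · have hin : inner ℝ (gradient h x) (y - x) = fderiv ℝ h x (y - x) := by
      rw [gradient, InnerProductSpace.toDual_symm_apply]
    rw [hin]
    -- Mean value inequality for h minus its linear part on the ball about x through y, where the
    -- derivatives of h differ from the one at x by at most C‖y - x‖. The sharper constant C/2 is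
    -- not needed.
    have := (convex_closedBall x ‖y - x‖).norm_image_sub_le_of_norm_hasFDerivWithin_le'
      (f := h) (f' := fderiv ℝ h) (φ := fderiv ℝ h x) (C := C * ‖y - x‖) (x := x) (y := y)
      (fun z _ => (hd z).hasFDerivAt.hasFDerivWithinAt) (fun z hz => by
        refine (l1 z x).trans ?_
        rw [mem_closedBall_iff_norm] at hz
        gcongr) (by simp) (by simp [dist_eq_norm])
    rw [Real.norm_eq_abs] at this
    refine this.trans (le_of_eq (by ring))

/-- The data of the optimal control problem, with the bounds on the costs in usable form. -/
structure Problem (ε T C : ℝ) (f : E3 → ℝ → ℝ) (g : E3 → ℝ) : Prop where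
  hε : ε ∈ Icc (0 : ℝ) 1
  hT : 0 < T
  hC : 0 ≤ C
  f_bound : ∀ t ∈ Icc 0 T, C2Bound C (fun x => f x t)
  f_cont : ContinuousOn (fun q : E3 × ℝ => f q.1 q.2) (univ ×ˢ Icc 0 T)
  grad_cont : ContinuousOn (fun q : E3 × ℝ => spaceGradient f q.1 q.2) (univ ×ˢ Icc 0 T)
  g_bound : C2Bound C g

/-- A Lipschitz bound in space uniform in time, together with continuity in time uniform in space,
gives joint continuity. It is applied both to the running cost and to its gradient. -/
lemma continuousOn_of_slices {F : Type*} [NormedAddCommGroup F] {T C : ℝ} (hC : 0 ≤ C)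
    {h : E3 → ℝ → F} (hx : ∀ t ∈ Icc 0 T, ∀ x y, ‖h x t - h y t‖ ≤ C * ‖x - y‖)
    (ht : ∀ t₀ ∈ Icc 0 T, ∀ e > 0, ∀ᶠ t in 𝓝[Icc 0 T] t₀, ∀ x, ‖h x t - h x t₀‖ ≤ e) :
    ContinuousOn (fun q : E3 × ℝ => h q.1 q.2) (univ ×ˢ Icc 0 T) := by
  rintro ⟨x₀, t₀⟩ ⟨-, ht₀⟩
  rw [ContinuousWithinAt, Metric.tendsto_nhds]
  intro e he
  have e1 : ∀ᶠ q : E3 × ℝ in 𝓝[univ ×ˢ Icc 0 T] (x₀, t₀), ∀ x, ‖h x q.2 - h x t₀‖ ≤ e / 3 := by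
    rw [nhdsWithin_prod_eq]
    exact (ht t₀ ht₀ (e / 3) (by positivity)).prod_inr _
  have e2 : ∀ᶠ q : E3 × ℝ in 𝓝[univ ×ˢ Icc 0 T] (x₀, t₀), ‖q.1 - x₀‖ < e / (3 * (C + 1)) := by
    have : Tendsto (fun q : E3 × ℝ => ‖q.1 - x₀‖) (𝓝 (x₀, t₀)) (𝓝 ‖x₀ - x₀‖) :=
      (Continuous.tendsto (by fun_prop) _)
    rw [sub_self, norm_zero] at this
    exact (this.mono_left nhdsWithin_le_nhds).eventually (gt_mem_nhds (by positivity))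
  filter_upwards [e1, e2] with q h1 h2
  rw [dist_eq_norm]
  calc _ ≤ ‖h q.1 q.2 - h q.1 t₀‖ + ‖h q.1 t₀ - h x₀ t₀‖ := norm_sub_le_norm_sub_add_norm_sub _ _ _
    _ ≤ e / 3 + C * (e / (3 * (C + 1))) := by
        refine add_le_add (h1 _) ((hx t₀ ht₀ _ _).trans ?_)
        gcongr
    _ ≤ e / 3 + e / 3 := by
        gcongr
        rw [mul_div_assoc', div_le_div_iff₀ (by positivity) (by positivity)]
        nlinarith
    _ < e := by linarith

lemma CostData.exists_problem {ε T : ℝ} (hε : ε ∈ Icc (0 : ℝ) 1) (hT : 0 < T) {f : E3 → ℝ → ℝ}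
    {g : E3 → ℝ} (h : CostData T f g) : ∃ C, Problem ε T C f g := by
  obtain ⟨C₀, hC₀⟩ := h.bounded
  -- The given constant could be negative, since `ENNReal.ofReal` truncates at zero; the maximum
  -- with zero restores a usable bound.
  have hb : ∀ t ∈ Icc 0 T, c2Norm (fun x => f x t) + c2Norm g ≤ ENNReal.ofReal (max C₀ 0) :=
    fun t ht => (hC₀ t ht).trans (ENNReal.ofReal_le_ofReal (le_max_left _ _))
  have hC : 0 ≤ max C₀ 0 := le_max_right _ _
  have hf : ∀ t ∈ Icc 0 T, C2Bound (max C₀ 0) (fun x => f x t) := fun t ht =>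
    C2Bound.of_c2Norm hC (h.contDiff_f t ht) (le_self_add.trans (hb t ht))
  have hdist : ∀ t₀ ∈ Icc 0 T, ∀ e > 0, ∀ᶠ t in 𝓝[Icc 0 T] t₀, ∀ x,
      |f x t - f x t₀| + ‖spaceGradient f x t - spaceGradient f x t₀‖ ≤ e := by
    intro t₀ ht₀ e he
    have := (h.continuous_f t₀ ht₀).eventually (gt_mem_nhds (ENNReal.ofReal_pos.2 he))
    filter_upwards [this, self_mem_nhdsWithin] with t h1 ht x
    have h2 := (c2Norm_le_iff he.le).1 h1.le x
    have d1 := (h.contDiff_f t ht).differentiable (by norm_num) x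
    have d2 := (h.contDiff_f t₀ ht₀).differentiable (by norm_num) x
    rw [fderiv_fun_sub d1 d2] at h2
    rw [spaceGradient, spaceGradient, norm_gradient_sub]
    have h3 := norm_nonneg (fderiv ℝ (fderiv ℝ (fun x => f x t - f x t₀)) x)
    linarith
  refine ⟨max C₀ 0, hε, hT, hC, hf,
    continuousOn_of_slices hC (fun t ht => (hf t ht).lip) fun t₀ ht₀ e he => ?_,
    continuousOn_of_slices hC (fun t ht => (hf t ht).grad_lip) fun t₀ ht₀ e he => ?_,
    C2Bound.of_c2Norm hC h.contDiff_g (le_add_self.trans (hb 0 ⟨le_rfl, hT.le⟩))⟩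
  · filter_upwards [hdist t₀ ht₀ e he] with t ht x
    rw [Real.norm_eq_abs]
    linarith [ht x, norm_nonneg (spaceGradient f x t - spaceGradient f x t₀)]
  · filter_upwards [hdist t₀ ht₀ e he] with t ht x
    linarith [ht x, abs_nonneg (f x t - f x t₀)]

/-- The running cost over `[a, b]`. -/
def runCost (f : E3 → ℝ → ℝ) (a b : ℝ) (y α : ℝ → E3) : ℝ :=
  ∫ s in a..b, (‖α s‖ ^ 2 / 2 + f (y s) s)

/-- The value function. -/
def value (ε T : ℝ) (f : E3 → ℝ → ℝ) (g : E3 → ℝ) (x : E3) (t : ℝ) : ℝ :=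
  sInf {c | ∃ y α, Traj ε t T y α ∧ y t = x ∧ c = runCost f t T y α + g (y T)}

namespace Problem

variable {ε T C : ℝ} {f : E3 → ℝ → ℝ} {g : E3 → ℝ} {y α z β : ℝ → E3} {a b c t s : ℝ} {x : E3}

lemma continuousOn_along (S : Problem ε T C f g) (ha : 0 ≤ a) (hb : b ≤ T)
    (hy : ContinuousOn y (Icc a b)) : ContinuousOn (fun s => f (y s) s) (Icc a b) :=
  S.f_cont.comp (hy.prodMk continuousOn_id) fun _ hs => ⟨mem_univ _, ha.trans hs.1, hs.2.trans hb⟩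

lemma continuousOn_grad_along (S : Problem ε T C f g) (ha : 0 ≤ a) (hb : b ≤ T)
    (hy : ContinuousOn y (Icc a b)) :
    ContinuousOn (fun s => spaceGradient f (y s) s) (Icc a b) :=
  S.grad_cont.comp (hy.prodMk continuousOn_id) fun _ hs => ⟨mem_univ _, ha.trans hs.1, hs.2.trans hb⟩

lemma intervalIntegrable_along (S : Problem ε T C f g) (ha : 0 ≤ a) (hab : a ≤ b) (hb : b ≤ T)
    (hy : ContinuousOn y (Icc a b)) : IntervalIntegrable (fun s => f (y s) s) volume a b :=
  ContinuousOn.intervalIntegrable (by rw [uIcc_of_le hab]; exact S.continuousOn_along ha hb hy)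

lemma intervalIntegrable_run (S : Problem ε T C f g) (ha : 0 ≤ a) (hab : a ≤ b) (hb : b ≤ T)
    (h : Traj ε a b y α) :
    IntervalIntegrable (fun s => ‖α s‖ ^ 2 / 2 + f (y s) s) volume a b :=
  ((h.control.intervalIntegrable_sq hab).div_const 2).add
    (S.intervalIntegrable_along ha hab hb h.cont)

lemma runCost_eq (S : Problem ε T C f g) (ha : 0 ≤ a) (hab : a ≤ b) (hb : b ≤ T)
    (h : Traj ε a b y α) :
    runCost f a b y α = energy a b α / 2 + ∫ s in a..b, f (y s) s := by
  rw [runCost, energy, intervalIntegral.integral_add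
    ((h.control.intervalIntegrable_sq hab).div_const 2) (S.intervalIntegrable_along ha hab hb h.cont),
    intervalIntegral.integral_div]

lemma abs_integral_along_le (S : Problem ε T C f g) (ha : 0 ≤ a) (hab : a ≤ b) (hb : b ≤ T) :
    |∫ s in a..b, f (y s) s| ≤ C * (b - a) := by
  have := intervalIntegral.norm_integral_le_of_norm_le_const (a := a) (b := b) (C := C)
    (f := fun s => f (y s) s) fun s hs => by
      rw [uIoc_of_le hab] at hs
      exact (S.f_bound s ⟨ha.trans hs.1.le, hs.2.trans hb⟩).abs_le _
  rwa [Real.norm_eq_abs, abs_of_nonneg (sub_nonneg.2 hab)] at this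

lemma runCost_add (S : Problem ε T C f g) (ha : 0 ≤ a) (hab : a ≤ b) (hbc : b ≤ c) (hc : c ≤ T)
    (h : Traj ε a c y α) :
    runCost f a b y α + runCost f b c y α = runCost f a c y α :=
  intervalIntegral.integral_add_adjacent_intervals
    (S.intervalIntegrable_run ha hab (hbc.trans hc) (h.mono S.hε le_rfl hbc))
    (S.intervalIntegrable_run (ha.trans hab) hbc hc (h.mono S.hε hab le_rfl))

lemma runCost_congr (hab : a ≤ b) (hy : EqOn z y (Ioc a b)) (hα : EqOn β α (Ioc a b)) :
    runCost f a b z β = runCost f a b y α := by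
  refine intervalIntegral.integral_congr_ae (ae_of_all _ fun s hs => ?_)
  rw [uIoc_of_le hab] at hs
  simp only [hy hs, hα hs]

/-- Coercivity: f and g are bounded by C, so the cost controls the energy. Both the finiteness of
the infimum and the energy bound for nearly optimal controls come from this. -/
lemma le_cost (S : Problem ε T C f g) (ht : t ∈ Icc 0 T) (h : Traj ε t T y α) :
    energy t T α / 2 - C * (T + 1) ≤ runCost f t T y α + g (y T) := by
  rw [S.runCost_eq ht.1 ht.2 le_rfl h]
  have h1 := abs_le.1 (S.abs_integral_along_le (y := y) ht.1 ht.2 le_rfl)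
  have h2 := abs_le.1 (S.g_bound.abs_le (y T))
  have := S.hC
  have h3 : C * (T - t) ≤ C * T := by gcongr; linarith [ht.1]
  linarith [h1.1, h2.1]

lemma bddBelow (S : Problem ε T C f g) (ht : t ∈ Icc 0 T) :
    BddBelow {c | ∃ y α, Traj ε t T y α ∧ y t = x ∧ c = runCost f t T y α + g (y T)} := by
  refine ⟨-(C * (T + 1)), ?_⟩
  rintro _ ⟨y, α, h, -, rfl⟩
  linarith [S.le_cost ht h, energy_nonneg ht.2 α]

lemma value_le (S : Problem ε T C f g) (ht : t ∈ Icc 0 T) (h : Traj ε t T y α) :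
    value ε T f g (y t) t ≤ runCost f t T y α + g (y T) :=
  csInf_le (S.bddBelow ht) ⟨y, α, h, rfl, rfl⟩

lemma _root_.HeisenbergControl.traj_const (x : E3) : Traj ε a b (fun _ => x) (fun _ => 0) where
  control := Control.const 0
  cont := continuousOn_const
  eq s _ := by
    have : mulCol (B ε x) 0 = 0 := by simp [mulCol]
    simp [this]

lemma exists_near (_ : Problem ε T C f g) (x : E3) (t : ℝ) {θ : ℝ} (hθ : 0 < θ) :
    ∃ y α, Traj ε t T y α ∧ y t = x ∧ runCost f t T y α + g (y T) < value ε T f g x t + θ := by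
  obtain ⟨_, ⟨y, α, h, h0, rfl⟩, hlt⟩ := Real.lt_sInf_add_pos
    (s := {c | ∃ y α, Traj ε t T y α ∧ y t = x ∧ c = runCost f t T y α + g (y T)})
    ⟨_, fun _ => x, fun _ => 0, traj_const x, rfl, rfl⟩ hθ
  exact ⟨y, α, h, h0, hlt⟩

lemma value_terminal (_ : Problem ε T C f g) (x : E3) : value ε T f g x T = g x := by
  have : {c | ∃ y α, Traj ε T T y α ∧ y T = x ∧ c = runCost f T T y α + g (y T)} = {g x} := by
    ext c
    simp only [runCost, intervalIntegral.integral_same, zero_add, mem_ofPred_eq, mem_singleton_iff]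
    constructor
    · rintro ⟨y, α, -, rfl, rfl⟩; rfl
    · rintro rfl; exact ⟨fun _ => x, fun _ => 0, traj_const x, rfl, rfl⟩
  rw [value, this, csInf_singleton]

lemma abs_value_le (S : Problem ε T C f g) (ht : t ∈ Icc 0 T) (x : E3) :
    |value ε T f g x t| ≤ C * (T + 1) := by
  have hC := S.hC
  rw [abs_le]
  constructor
  · refine le_csInf ⟨_, fun _ => x, fun _ => 0, traj_const x, rfl, rfl⟩ ?_
    rintro _ ⟨y, α, h, -, rfl⟩
    linarith [S.le_cost ht h, energy_nonneg ht.2 α]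
  · have h := traj_const (ε := ε) (a := t) (b := T) x
    refine (S.value_le ht h).trans ?_
    rw [S.runCost_eq ht.1 ht.2 le_rfl h]
    have h1 := abs_le.1 (S.abs_integral_along_le (y := fun _ => x) ht.1 ht.2 le_rfl)
    have h2 := abs_le.1 (S.g_bound.abs_le x)
    have h3 : C * (T - t) ≤ C * T := by gcongr; linarith [ht.1]
    simp only [energy, norm_zero]
    norm_num
    linarith [h1.2, h2.2]

/-- Dynamic programming, upper bound. -/
lemma value_le_runCost_add (S : Problem ε T C f g) (ha : 0 ≤ a) (hab : a ≤ b) (hb : b ≤ T)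
    (h : Traj ε a b y α) :
    value ε T f g (y a) a ≤ runCost f a b y α + value ε T f g (y b) b := by
  -- Follow the given arc up to time b, then a θ-optimal trajectory from its endpoint.
  refine le_of_forall_pos_lt_add fun θ hθ => ?_
  obtain ⟨z, β, h', h0, hlt⟩ := S.exists_near (y b) b hθ
  have hc := h.concat h' S.hε hab hb h0
  have h1 := S.value_le ⟨ha, hab.trans hb⟩ hc
  rw [← S.runCost_add ha hab hb le_rfl hc,
    runCost_congr (y := y) (α := α) hab (fun s hs => by simp [hs.2]) (fun s hs => by simp [hs.2]),
    runCost_congr (y := z) (α := β) hb (fun s hs => by simp [hs.1.not_ge])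
      (fun s hs => by simp [hs.1.not_ge])] at h1
  -- When b = T the concatenation evaluates to the first arc at T; the matching condition at b
  -- identifies the two endpoints.
  have h2 : (if T ≤ b then y T else z T) = z T := by
    split_ifs with hTb
    · rw [le_antisymm hb hTb] at h0; exact h0.symm
    · rfl
  simp only [hab, if_true, h2] at h1
  linarith

/-- Dynamic programming, lower bound. -/
lemma exists_near_step (S : Problem ε T C f g) (x : E3) (ha : 0 ≤ a) (hab : a ≤ b) (hb : b ≤ T)
    {θ : ℝ} (hθ : 0 < θ) :
    ∃ y α, Traj ε a T y α ∧ y a = x ∧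
      runCost f a T y α + g (y T) < value ε T f g x a + θ ∧
      runCost f a b y α + value ε T f g (y b) b < value ε T f g x a + θ := by
  obtain ⟨y, α, h, h0, hlt⟩ := S.exists_near x a hθ
  refine ⟨y, α, h, h0, hlt, ?_⟩
  have := S.value_le ⟨ha.trans hab, hb⟩ (h.mono S.hε hab le_rfl)
  rw [← S.runCost_add ha hab hb le_rfl h] at hlt
  linarith

/-- A bound for the energy of controls which are optimal up to an error `1`. -/
def energyBound (_ : Problem ε T C f g) : ℝ := 4 * (C * (T + 1)) + 2

lemma energyBound_nonneg (S : Problem ε T C f g) : 0 ≤ S.energyBound := by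
  have := mul_nonneg S.hC (by linarith [S.hT] : 0 ≤ T + 1)
  unfold energyBound; linarith

lemma energy_le (S : Problem ε T C f g) (ht : t ∈ Icc 0 T) (h : Traj ε t T y α)
    (hc : runCost f t T y α + g (y T) ≤ value ε T f g (y t) t + 1) :
    energy t T α ≤ S.energyBound := by
  -- Coercivity against the a priori bound on the value gives E/2 ≤ 2C(T + 1) + 1, hence the
  -- constant.
  have h1 := S.le_cost ht h
  have h2 := (abs_le.1 (S.abs_value_le ht (y t))).2
  unfold energyBound
  linarith

/-- A bound for the `L¹` norm of controls with energy at most `E`. -/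
lemma integral_norm_le (S : Problem ε T C f g) (ha : 0 ≤ a) (hab : a ≤ b) (hb : b ≤ T) {E : ℝ}
    (h : Control a b α) (hE : energy a b α ≤ E) : ∫ s in a..b, ‖α s‖ ≤ √(T * E) := by
  refine (integral_norm_le_sqrt hab h).trans (Real.sqrt_le_sqrt ?_)
  have := energy_nonneg hab α
  have hT := S.hT
  gcongr
  linarith

/-- The Lipschitz constant of the value function in space. -/
def lipBound (S : Problem ε T C f g) : ℝ :=
  C * (T + 1) * Real.exp √(T * S.energyBound)

lemma lipBound_nonneg (S : Problem ε T C f g) : 0 ≤ S.lipBound := by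
  have := S.hC
  have := S.hT
  unfold lipBound; positivity

/-- A nearly optimal control for one point is reused from the other. The trajectories separate at
most by the factor exp(∫|α|), which the energy bound controls independently of the starting point;
capping the error by 1 makes that bound available. -/
lemma abs_value_sub_le (S : Problem ε T C f g) (ht : t ∈ Icc 0 T) (x x' : E3) :
    |value ε T f g x t - value ε T f g x' t| ≤ S.lipBound * ‖x - x'‖ := by
  suffices H : ∀ x x', value ε T f g x' t - value ε T f g x t ≤ S.lipBound * ‖x' - x‖ by
    rw [abs_le]
    constructor
    · have := H x x'; rw [norm_sub_rev] at this; linarith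
    · exact H x' x
  intro x x'
  refine le_of_forall_pos_lt_add fun θ hθ => ?_
  obtain ⟨y, α, h, h0, hlt⟩ := S.exists_near x t (lt_min hθ one_pos)
  obtain ⟨z, h', hz0⟩ := exists_traj S.hε ht.2 x' h.control
  have hE := S.energy_le ht h (by rw [h0]; linarith [min_le_right θ 1])
  have hI := S.integral_norm_le ht.1 ht.2 le_rfl h.control hE
  have hd : ∀ s ∈ Icc t T, ‖z s - y s‖ ≤ ‖x' - x‖ * Real.exp √(T * S.energyBound) := by
    intro s hs
    refine (h.norm_sub_le h' S.hε ht.2 (h.one_add_norm_le S.hε ht.2) s hs).trans ?_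
    simp only [sub_self, norm_zero, intervalIntegral.integral_zero, mul_zero, add_zero, h0, hz0]
    gcongr
  have hC := S.hC
  set D := ‖x' - x‖ * Real.exp √(T * S.energyBound) with hD
  have hg : g (z T) ≤ g (y T) + C * D := by
    have := (abs_le.1 (S.g_bound.lip (z T) (y T))).2
    have := mul_le_mul_of_nonneg_left (hd T ⟨ht.2, le_rfl⟩) hC
    linarith
  have hr : (∫ s in t..T, f (z s) s) ≤ (∫ s in t..T, f (y s) s) + C * D * (T - t) := by
    have i1 := S.intervalIntegrable_along ht.1 ht.2 le_rfl h'.cont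
    have i2 := S.intervalIntegrable_along ht.1 ht.2 le_rfl h.cont
    have := intervalIntegral.integral_mono_on ht.2 i1
      (i2.add (intervalIntegrable_const (c := C * D))) fun s hs => by
        have h1 := (abs_le.1 ((S.f_bound s ⟨ht.1.trans hs.1, hs.2⟩).lip (z s) (y s))).2
        have h2 := mul_le_mul_of_nonneg_left (hd s hs) hC
        show f (z s) s ≤ f (y s) s + C * D
        linarith
    rw [intervalIntegral.integral_add i2 (by simp), intervalIntegral.integral_const,
      smul_eq_mul] at this
    linarith
  have hv := S.value_le ht h'
  rw [hz0, S.runCost_eq ht.1 ht.2 le_rfl h'] at hv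
  rw [S.runCost_eq ht.1 ht.2 le_rfl h] at hlt
  have hCD : 0 ≤ C * D := by positivity
  have h5 : S.lipBound * ‖x' - x‖ = C * D * T + C * D := by rw [hD]; unfold lipBound; ring
  have h6 : C * D * (T - t) ≤ C * D * T := by gcongr; linarith [ht.1]
  have := min_le_left θ 1
  linarith

end Problem

/-! ### Short time expansions of the value function -/

/-- `a ↦ B a` as a continuous linear map. -/
def mulColCLM (M : Matrix (Fin 3) (Fin 3) ℝ) : E3 →L[ℝ] E3 :=
  LinearMap.toContinuousLinearMap
    { toFun := mulCol M
      map_add' := mulCol_add M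
      map_smul' := mulCol_smul M }

lemma mulCol_integral (M : Matrix (Fin 3) (Fin 3) ℝ) {α : ℝ → E3} {a b : ℝ}
    (h : IntervalIntegrable α volume a b) :
    ∫ s in a..b, mulCol M (α s) = mulCol M (∫ s in a..b, α s) :=
  (mulColCLM M).intervalIntegral_comp_comm h

namespace Traj

variable {ε a b : ℝ} {y α : ℝ → E3}

/-- First order expansion of a trajectory. -/
lemma norm_sub_first_order_le (h : Traj ε a b y α) (hε : ε ∈ Icc (0 : ℝ) 1) (hab : a ≤ b) {M : ℝ}
    (hM : ∀ s ∈ Icc a b, 1 + ‖y s‖ ≤ M) :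
    ‖y b - y a - mulCol (B ε (y a)) (∫ s in a..b, α s)‖ ≤ M * (∫ s in a..b, ‖α s‖) ^ 2 := by
  have hi := h.control.intervalIntegrable hab
  have hc := (control_mulCol (y := fun _ => y a) hε continuousOn_const h.control).intervalIntegrable
    hab
  rw [h.eq b ⟨hab, le_rfl⟩, add_sub_cancel_left, ← mulCol_integral _ hi,
    ← intervalIntegral.integral_sub (h.intervalIntegrable hε hab) hc]
  calc _ ≤ ∫ s in a..b, (M * ∫ s in a..b, ‖α s‖) * ‖α s‖ := by
        refine (intervalIntegral.norm_integral_le_integral_norm hab).trans ?_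
        refine intervalIntegral.integral_mono_on hab ((h.intervalIntegrable hε hab).sub hc).norm
          (hi.norm.const_mul _) fun s hs => ?_
        refine (norm_mulCol_B_sub_le _ _ _ _).trans ?_
        gcongr
        exact h.norm_sub_init_le hε hab hM s hs
    _ = _ := by rw [intervalIntegral.integral_const_mul]; ring

end Traj

namespace Problem

variable {ε T C : ℝ} {f : E3 → ℝ → ℝ} {g : E3 → ℝ} {y α z β : ℝ → E3} {a b c t s : ℝ} {x : E3}

lemma abs_integral_along_sub_le (S : Problem ε T C f g) (ha : 0 ≤ a) (hab : a ≤ b) (hb : b ≤ T)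
    (h : Traj ε a b y α) {M : ℝ} (hM : ∀ s ∈ Icc a b, 1 + ‖y s‖ ≤ M) :
    |(∫ s in a..b, f (y s) s) - ∫ s in a..b, f (y a) s| ≤
      C * (M * ∫ s in a..b, ‖α s‖) * (b - a) := by
  have hC := S.hC
  rw [← intervalIntegral.integral_sub (S.intervalIntegrable_along ha hab hb h.cont)
    (S.intervalIntegrable_along (y := fun _ => y a) ha hab hb continuousOn_const)]
  have := intervalIntegral.norm_integral_le_of_norm_le_const (a := a) (b := b)
    (C := C * (M * ∫ s in a..b, ‖α s‖)) (f := fun s => f (y s) s - f (y a) s) fun s hs => by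
      rw [uIoc_of_le hab] at hs
      refine ((S.f_bound s ⟨ha.trans hs.1.le, hs.2.trans hb⟩).lip _ _).trans ?_
      gcongr
      exact h.norm_sub_init_le S.hε hab hM s (Ioc_subset_Icc_self hs)
  rwa [Real.norm_eq_abs, abs_of_nonneg (sub_nonneg.2 hab)] at this

/-- Staying at rest with zero control is admissible and costs at most C per unit time. -/
lemma value_le_add (S : Problem ε T C f g) (ha : 0 ≤ a) (hab : a ≤ b) (hb : b ≤ T) (x : E3) :
    value ε T f g x a ≤ C * (b - a) + value ε T f g x b := by
  have h := traj_const (ε := ε) (a := a) (b := b) x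
  refine (S.value_le_runCost_add ha hab hb h).trans ?_
  rw [S.runCost_eq ha hab hb h]
  have h1 := abs_le.1 (S.abs_integral_along_le (y := fun _ => x) ha hab hb)
  simp only [energy, norm_zero]
  norm_num
  linarith [h1.2]

/-- Short time expansion of the value function from below. -/
lemma exists_expansion_below (S : Problem ε T C f g) {R : ℝ} (hR : 0 ≤ R) :
    ∃ K, 0 ≤ K ∧ ∀ ξ : E3, ‖ξ‖ ≤ R → ∀ a b, 0 ≤ a → a < b → b ≤ T → ∃ v ζ : E3, ‖v‖ ≤ K ∧
      ‖ζ - ξ - (b - a) • mulCol (B ε ξ) v‖ ≤ K * (b - a) ^ 2 ∧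
      (b - a) * ‖v‖ ^ 2 / 2 + (∫ s in a..b, f ξ s) + value ε T f g ζ b ≤
        value ε T f g ξ a + K * (b - a) ^ 2 := by
  have hC := S.hC
  have hL := S.lipBound_nonneg
  have hT := S.hT
  set M := (1 + R) * Real.exp √(T * S.energyBound) with hMdef
  have hM0 : 0 ≤ M := by positivity
  set L := S.lipBound
  set K₁ := 4 * (2 * C + (L * M) ^ 2 + T) with hK₁
  have hK₁0 : 0 ≤ K₁ := by positivity
  set κ := √K₁
  have hκ0 : 0 ≤ κ := Real.sqrt_nonneg _
  refine ⟨κ + M * κ ^ 2 + (1 + C * M * κ), by positivity, fun ξ hξ a b ha hab hb => ?_⟩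
  set h := b - a with hh
  have hh0 : 0 < h := sub_pos.2 hab
  have hhT : h ≤ T := by linarith
  -- The error is below 1 so that the energy bound applies, and below h² so that it is absorbed in
  -- the remainder.
  obtain ⟨y, α, hy, hy0, hc1, hc2⟩ := S.exists_near_step ξ ha hab.le hb
    (lt_min one_pos (pow_pos hh0 2))
  set θ := min 1 (h ^ 2)
  have hθ1 : θ ≤ 1 := min_le_left _ _
  have hθ2 : θ ≤ h ^ 2 := min_le_right _ _
  have haT : a ≤ T := hab.le.trans hb
  have hE := S.energy_le ⟨ha, haT⟩ hy (by rw [hy0]; linarith)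
  have hI := S.integral_norm_le ha haT le_rfl hy.control hE
  have hyM : ∀ s ∈ Icc a b, 1 + ‖y s‖ ≤ M := fun s hs => by
    refine (hy.one_add_norm_le S.hε haT s ⟨hs.1, hs.2.trans hb⟩).trans ?_
    rw [hy0, hMdef]
    gcongr
  have hy' := hy.mono S.hε le_rfl hb
  set E := energy a b α
  set I := ∫ s in a..b, ‖α s‖ with hIdef
  have hI0 : 0 ≤ I := intervalIntegral.integral_nonneg hab.le fun _ _ => norm_nonneg _
  have hIE : I ^ 2 ≤ h * E := sq_integral_le hab.le (hy'.control.intervalIntegrable hab.le).norm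
    (hy'.control.intervalIntegrable_sq hab.le)
  have hdisp : ‖y b - ξ‖ ≤ M * I := by
    rw [← hy0]; exact hy'.norm_sub_init_le S.hε hab.le hyM b ⟨hab.le, le_rfl⟩
  have hrun := S.runCost_eq ha hab.le hb hy'
  -- The energy spent on a short interval is of order h. Comparison with staying at rest bounds E/2
  -- by terms of order h plus L M I, the possible gain from displacement; Young's inequality and I²
  -- ≤ hE absorb the latter into E/4.
  have hEK : E ≤ K₁ * h := by
    have h1 := S.value_le_add ha hab.le hb ξ
    have h2 := (abs_le.1 (S.abs_integral_along_le (y := y) ha hab.le hb)).1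
    have h3 := (abs_le.1 (S.abs_value_sub_le ⟨ha.trans hab.le, hb⟩ (y b) ξ)).1
    have h4 : L * ‖y b - ξ‖ ≤ L * (M * I) := by gcongr
    have h5 : θ ≤ T * h := hθ2.trans (by rw [sq]; gcongr)
    have h6 : L * (M * I) ≤ E / 4 + (L * M) ^ 2 * h := by
      have : h * (L * (M * I)) ≤ h * (E / 4 + (L * M) ^ 2 * h) := by
        nlinarith [sq_nonneg (I / 2 - L * M * h)]
      exact le_of_mul_le_mul_left this hh0
    rw [hK₁]
    linarith
  have hIκ : I ≤ κ * h := by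
    have h1 : I ^ 2 ≤ K₁ * h ^ 2 := hIE.trans (by nlinarith)
    calc I ≤ √(K₁ * h ^ 2) := Real.le_sqrt_of_sq_le h1
      _ = κ * h := by rw [Real.sqrt_mul hK₁0, Real.sqrt_sq hh0.le]
  have hint : ‖∫ s in a..b, α s‖ ≤ I := intervalIntegral.norm_integral_le_integral_norm hab.le
  have hv : ‖h⁻¹ • ∫ s in a..b, α s‖ ≤ I / h := by
    rw [norm_smul, norm_inv, Real.norm_of_nonneg hh0.le, inv_mul_eq_div]
    gcongr
  -- The constant velocity is the mean of the nearly optimal control: it produces the same first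
  -- order displacement and, by Cauchy-Schwarz, no larger energy.
  refine ⟨h⁻¹ • ∫ s in a..b, α s, y b, ?_, ?_, ?_⟩
  · refine hv.trans (((div_le_iff₀ hh0).2 hIκ).trans ?_)
    have : 0 ≤ M * κ ^ 2 + (1 + C * M * κ) := by positivity
    linarith
  · rw [mulCol_smul, smul_inv_smul₀ hh0.ne', ← hy0]
    refine (hy'.norm_sub_first_order_le S.hε hab.le hyM).trans ?_
    calc M * I ^ 2 ≤ M * (κ * h) ^ 2 := by gcongr
      _ = M * κ ^ 2 * h ^ 2 := by ring
      _ ≤ _ := by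
        gcongr
        have : 0 ≤ κ + (1 + C * M * κ) := by positivity
        linarith
  · have h1 : h * ‖h⁻¹ • ∫ s in a..b, α s‖ ^ 2 ≤ E := by
      calc _ ≤ h * (I / h) ^ 2 := by gcongr
        _ = I ^ 2 / h := by field_simp
        _ ≤ E := by rw [div_le_iff₀ hh0]; linarith
    have h2 := (abs_le.1 (S.abs_integral_along_sub_le ha hab.le hb hy' hyM)).1
    rw [hy0] at h2
    have h3 : C * (M * I) * h ≤ C * (M * (κ * h)) * h := by gcongr
    have h4 : 0 ≤ (κ + M * κ ^ 2) * h ^ 2 := by positivity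
    have h5 : (κ + M * κ ^ 2 + (1 + C * M * κ)) * h ^ 2 =
        (κ + M * κ ^ 2) * h ^ 2 + h ^ 2 + C * (M * (κ * h)) * h := by ring
    rw [h5]
    rw [hrun] at hc2
    linarith

/-- Short time expansion of the value function from above. -/
lemma exists_expansion_above (S : Problem ε T C f g) {R : ℝ} (hR : 0 ≤ R) :
    ∃ K, 0 ≤ K ∧ ∀ ξ v : E3, ‖ξ‖ ≤ R → ‖v‖ ≤ R → ∀ a b, 0 ≤ a → a < b → b ≤ T → ∃ ζ : E3,
      ‖ζ - ξ - (b - a) • mulCol (B ε ξ) v‖ ≤ K * (b - a) ^ 2 ∧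
      value ε T f g ξ a ≤ (b - a) * ‖v‖ ^ 2 / 2 + (∫ s in a..b, f ξ s) + value ε T f g ζ b +
        K * (b - a) ^ 2 := by
  have hC := S.hC
  have hT := S.hT
  set M := (1 + R) * Real.exp (T * R) with hMdef
  have hM0 : 0 ≤ M := by positivity
  refine ⟨M * R ^ 2 + C * M * R, by positivity, fun ξ v hξ hv a b ha hab hb => ?_⟩
  set h := b - a with hh
  have hh0 : 0 < h := sub_pos.2 hab
  have hhT : h ≤ T := by linarith
  obtain ⟨y, hy, hy0⟩ := exists_traj S.hε hab.le ξ (Control.const (a := a) (b := b) v)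
  have hI : ∫ _ in a..b, ‖v‖ = h * ‖v‖ := by simp [hh]
  have hI' : h * ‖v‖ ≤ h * R := by gcongr
  have hyM : ∀ s ∈ Icc a b, 1 + ‖y s‖ ≤ M := fun s hs => by
    refine (hy.one_add_norm_le S.hε hab.le s hs).trans ?_
    rw [hy0, hMdef, hI]
    gcongr
  refine ⟨y b, ?_, ?_⟩
  · have h1 := hy.norm_sub_first_order_le S.hε hab.le hyM
    rw [intervalIntegral.integral_const, mulCol_smul, hI, hy0] at h1
    refine h1.trans ?_
    calc M * (h * ‖v‖) ^ 2 ≤ M * (h * R) ^ 2 := by gcongr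
      _ = M * R ^ 2 * h ^ 2 := by ring
      _ ≤ _ := by
        gcongr
        have : 0 ≤ C * M * R := by positivity
        linarith
  · have h1 := S.value_le_runCost_add ha hab.le hb hy
    have h2 := (abs_le.1 (S.abs_integral_along_sub_le ha hab.le hb hy hyM)).2
    rw [S.runCost_eq ha hab.le hb hy, hy0, energy, intervalIntegral.integral_const,
      smul_eq_mul] at h1
    rw [hy0, hI] at h2
    have h3 : C * (M * (h * ‖v‖)) * h ≤ C * (M * (h * R)) * h := by gcongr
    have h4 : 0 ≤ M * R ^ 2 * h ^ 2 := by positivity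
    have h5 : (M * R ^ 2 + C * M * R) * h ^ 2 = M * R ^ 2 * h ^ 2 + C * (M * (h * R)) * h := by ring
    rw [h5]
    linarith

/-- The value function is Lipschitz in time, locally uniformly in space. -/
lemma exists_lip_time (S : Problem ε T C f g) {R : ℝ} (hR : 0 ≤ R) :
    ∃ K, 0 ≤ K ∧ ∀ ξ : E3, ‖ξ‖ ≤ R → ∀ a ∈ Icc 0 T, ∀ b ∈ Icc 0 T,
      |value ε T f g ξ a - value ε T f g ξ b| ≤ K * |a - b| := by
  obtain ⟨K, hK, H⟩ := S.exists_expansion_below hR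
  have hC := S.hC
  have hL := S.lipBound_nonneg
  have hT := S.hT
  set K' := C + K * T + S.lipBound * (K * T + (1 + R) * K)
  have hK' : 0 ≤ K' := by positivity
  refine ⟨K', hK', fun ξ hξ => ?_⟩
  have key : ∀ a b, 0 ≤ a → a < b → b ≤ T →
      |value ε T f g ξ a - value ε T f g ξ b| ≤ K' * (b - a) := by
    intro a b ha hab hb
    obtain ⟨v, ζ, h1, h2, h3⟩ := H ξ hξ a b ha hab hb
    have hh0 : 0 < b - a := sub_pos.2 hab
    have hhT : b - a ≤ T := by linarith
    have h4 := S.value_le_add ha hab.le hb ξ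
    have h5 := (abs_le.1 (S.abs_integral_along_le (y := fun _ => ξ) ha hab.le hb)).1
    have h6 := (abs_le.1 (S.abs_value_sub_le ⟨ha.trans hab.le, hb⟩ ζ ξ)).1
    have h7 : ‖ζ - ξ‖ ≤ (K * T + (1 + R) * K) * (b - a) := by
      have e : ζ - ξ = (ζ - ξ - (b - a) • mulCol (B ε ξ) v) + (b - a) • mulCol (B ε ξ) v := by abel
      rw [e]
      refine (norm_add_le _ _).trans ?_
      have e1 : ‖(b - a) • mulCol (B ε ξ) v‖ ≤ (b - a) * ((1 + R) * K) := by
        rw [norm_smul, Real.norm_of_nonneg hh0.le]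
        gcongr
        refine (norm_mulCol_B_le S.hε _ _).trans ?_
        gcongr
      have e2 : K * (b - a) ^ 2 ≤ K * (T * (b - a)) := by rw [sq]; gcongr
      linarith
    have h8 : S.lipBound * ‖ζ - ξ‖ ≤ S.lipBound * ((K * T + (1 + R) * K) * (b - a)) := by gcongr
    have h9 : 0 ≤ (b - a) * ‖v‖ ^ 2 / 2 := by positivity
    have h10 : K * (b - a) ^ 2 ≤ K * (T * (b - a)) := by rw [sq]; gcongr
    have h11 : 0 ≤ K * T * (b - a) := by positivity
    have h12 : 0 ≤ S.lipBound * ((K * T + (1 + R) * K) * (b - a)) := by positivity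
    have h13 : K' * (b - a) = C * (b - a) + K * (T * (b - a)) +
      S.lipBound * ((K * T + (1 + R) * K) * (b - a)) := by ring
    rw [abs_le]
    constructor <;> linarith
  intro a ha b hb
  rcases lt_trichotomy a b with hlt | rfl | hlt
  · rw [abs_sub_comm a b, abs_of_pos (sub_pos.2 hlt)]
    exact key a b ha.1 hlt hb.2
  · simp
  · rw [abs_sub_comm, abs_of_pos (sub_pos.2 hlt)]
    exact key b a hb.1 hlt ha.2

lemma continuousOn_value (S : Problem ε T C f g) :
    ContinuousOn (fun q : E3 × ℝ => value ε T f g q.1 q.2) (univ ×ˢ Icc 0 T) := by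
  rintro ⟨x₀, t₀⟩ ⟨-, ht₀⟩
  obtain ⟨K, hK, H⟩ := S.exists_lip_time (norm_nonneg x₀)
  rw [ContinuousWithinAt, tendsto_iff_dist_tendsto_zero]
  have hlim : Tendsto (fun q : E3 × ℝ => S.lipBound * ‖q.1 - x₀‖ + K * |q.2 - t₀|)
      (𝓝[univ ×ˢ Icc 0 T] (x₀, t₀)) (𝓝 0) := by
    have : Continuous (fun q : E3 × ℝ => S.lipBound * ‖q.1 - x₀‖ + K * |q.2 - t₀|) := by fun_prop
    have := this.tendsto (x₀, t₀)
    simp only [sub_self, norm_zero, mul_zero, abs_zero, add_zero] at this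
    exact this.mono_left nhdsWithin_le_nhds
  refine squeeze_zero' (Eventually.of_forall fun _ => dist_nonneg) ?_ hlim
  filter_upwards [self_mem_nhdsWithin] with q hq
  refine (dist_triangle _ (value ε T f g x₀ q.2) _).trans ?_
  rw [Real.dist_eq, Real.dist_eq]
  exact add_le_add (S.abs_value_sub_le hq.2 _ _) (H x₀ le_rfl _ hq.2 _ ht₀)

end Problem

/-! ### Viscosity inequalities for the value function -/

/-- `(P, τ)` is a first order superjet of `w` at `(x, t)`, relatively to times in `[0, T]`. -/
def IsSuperjet (T : ℝ) (w : E3 → ℝ → ℝ) (x : E3) (t : ℝ) (P : E3) (τ : ℝ) : Prop :=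
  ∀ e > 0, ∀ᶠ q : E3 × ℝ in 𝓝[univ ×ˢ Icc 0 T] (x, t),
    w q.1 q.2 ≤ w x t + inner ℝ P (q.1 - x) + τ * (q.2 - t) + e * (‖q.1 - x‖ + |q.2 - t|)

/-- Only forward times t + r are kept, with points within K r of x: this is the region reached by
short trajectories, and the error there is linear in r. -/
lemma IsSuperjet.exists_bound {T : ℝ} {w : E3 → ℝ → ℝ} {x : E3} {t : ℝ} {P : E3} {τ : ℝ}
    (h : IsSuperjet T w x t P τ) (ht : 0 ≤ t) {K e : ℝ} (hK : 0 ≤ K) (he : 0 < e) :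
    ∃ d > 0, ∀ r, 0 < r → r < d → t + r ≤ T → ∀ ζ : E3, ‖ζ - x‖ ≤ K * r →
      w ζ (t + r) ≤ w x t + inner ℝ P (ζ - x) + τ * r + e * (K + 1) * r := by
  obtain ⟨d, hd, H⟩ := Metric.mem_nhdsWithin_iff.1 (h e he)
  refine ⟨d / (K + 1), by positivity, fun r hr hrd hrT ζ hζ => ?_⟩
  have hr1 : (K + 1) * r < d := by rw [lt_div_iff₀ (by positivity)] at hrd; linarith
  have hball : (ζ, t + r) ∈ Metric.ball (x, t) d := by
    rw [Metric.mem_ball, Prod.dist_eq, max_lt_iff, dist_eq_norm, Real.dist_eq]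
    simp only [add_sub_cancel_left, abs_of_pos hr]
    constructor <;> nlinarith
  have := H ⟨hball, mem_univ _, by linarith, hrT⟩
  simp only [mem_ofPred_eq, add_sub_cancel_left, abs_of_pos hr] at this
  have h2 : e * (‖ζ - x‖ + r) ≤ e * (K * r + r) := by gcongr
  linarith

lemma isSuperjet_of_le_add {T : ℝ} {w : E3 → ℝ → ℝ} {x : E3} {t : ℝ} {P : E3} {τ : ℝ}
    {a : E3 → ℝ} {b : ℝ → ℝ} (ha : HasGradientAt a P x) (hb : HasDerivAt b τ t)
    (h : ∀ᶠ q : E3 × ℝ in 𝓝[univ ×ˢ Icc 0 T] (x, t),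
      w q.1 q.2 ≤ w x t + (a q.1 - a x) + (b q.2 - b t)) : IsSuperjet T w x t P τ := by
  intro e he
  have h1 := (hasGradientAt_iff_isLittleO.1 ha).def he
  have h2 := (hasDerivAt_iff_isLittleO.1 hb).def he
  have h3 : ∀ᶠ q : E3 × ℝ in 𝓝 (x, t), ‖a q.1 - a x - inner ℝ P (q.1 - x)‖ ≤ e * ‖q.1 - x‖ :=
    (continuous_fst.tendsto (x, t)).eventually h1
  have h4 : ∀ᶠ q : E3 × ℝ in 𝓝 (x, t), ‖b q.2 - b t - (q.2 - t) • τ‖ ≤ e * ‖q.2 - t‖ :=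
    (continuous_snd.tendsto (x, t)).eventually h2
  filter_upwards [h, nhdsWithin_le_nhds h3, nhdsWithin_le_nhds h4] with q g1 g2 g3
  rw [Real.norm_eq_abs] at g2 g3
  rw [Real.norm_eq_abs, smul_eq_mul] at g3
  have := (abs_le.1 g2).2
  have := (abs_le.1 g3).2
  linarith

lemma nonpos_of_forall_le_mul {X K : ℝ} (h : ∀ e, 0 < e → X ≤ e * K) : X ≤ 0 := by
  have h1 : Tendsto (fun e : ℝ => e * K) (𝓝[>] 0) (𝓝 (0 * K)) :=
    (Continuous.tendsto (by fun_prop) 0).mono_left nhdsWithin_le_nhds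
  rw [zero_mul] at h1
  exact ge_of_tendsto h1 (by filter_upwards [self_mem_nhdsWithin] with e he using h e he)

namespace Problem

variable {ε T C : ℝ} {f : E3 → ℝ → ℝ} {g : E3 → ℝ} {t : ℝ} {x : E3}

lemma exists_integral_le (S : Problem ε T C f g) (x : E3) (ht : t ∈ Icc 0 T) {e : ℝ}
    (he : 0 < e) : ∃ d > 0, ∀ a b, a ∈ Icc 0 T → b ∈ Icc 0 T → a ≤ b → |a - t| < d → |b - t| < d →
      |(∫ s in a..b, f x s) - (b - a) * f x t| ≤ e * (b - a) := by
  have hc := S.f_cont.comp (f := fun s : ℝ => (x, s)) (s := Icc 0 T) (by fun_prop)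
    (fun s hs => ⟨mem_univ _, hs⟩)
  obtain ⟨d, hd, H⟩ := Metric.continuousWithinAt_iff.1 (hc t ht) e he
  refine ⟨d, hd, fun a b ha hb hab had hbd => ?_⟩
  have hi := S.intervalIntegrable_along (y := fun _ => x) ha.1 hab hb.2 continuousOn_const
  have : (∫ s in a..b, f x s) - (b - a) * f x t = ∫ s in a..b, (f x s - f x t) := by
    rw [intervalIntegral.integral_sub hi (by simp), intervalIntegral.integral_const, smul_eq_mul]
  rw [this]
  have h2 := intervalIntegral.norm_integral_le_of_norm_le_const (a := a) (b := b) (C := e)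
    (f := fun s => f x s - f x t) fun s hs => by
      rw [uIoc_of_le hab] at hs
      refine (H ⟨ha.1.trans hs.1.le, hs.2.trans hb.2⟩ ?_).le
      rw [Real.dist_eq]
      rw [abs_lt] at had hbd ⊢
      constructor <;> linarith [hs.1, hs.2]
  rwa [Real.norm_eq_abs, abs_of_nonneg (sub_nonneg.2 hab)] at h2

lemma norm_sub_le_of_first_order (S : Problem ε T C f g) {K r : ℝ} {x ζ v : E3} (hK : 0 ≤ K)
    (hr : 0 < r) (hrT : r ≤ T) (h : ‖ζ - x - r • mulCol (B ε x) v‖ ≤ K * r ^ 2) :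
    ‖ζ - x‖ ≤ (K * T + (1 + ‖x‖) * ‖v‖) * r := by
  have e : ζ - x = (ζ - x - r • mulCol (B ε x) v) + r • mulCol (B ε x) v := by abel
  rw [e]
  refine (norm_add_le _ _).trans ?_
  have e1 : ‖r • mulCol (B ε x) v‖ ≤ r * ((1 + ‖x‖) * ‖v‖) := by
    rw [norm_smul, Real.norm_of_nonneg hr.le]
    gcongr
    exact norm_mulCol_B_le S.hε _ _
  have e2 : K * r ^ 2 ≤ K * (T * r) := by rw [sq]; gcongr
  linarith

lemma abs_inner_sub_le {K r : ℝ} {x ζ v P : E3}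
    (h : ‖ζ - x - r • mulCol (B ε x) v‖ ≤ K * r ^ 2) :
    |inner ℝ P (ζ - x) - r * inner ℝ (rowMul P (B ε x)) v| ≤ ‖P‖ * (K * r ^ 2) := by
  rw [← inner_mulCol, ← real_inner_smul_right, ← inner_sub_right]
  exact (abs_real_inner_le_norm _ _).trans (by gcongr)

/-- Use the constant control v = -PB, which minimizes |v|²/2 + ⟨PB, v⟩ with minimum -H. Inserting
the superjet into the upper expansion and dividing by r leaves the inequality, with an error that
vanishes with e. -/
lemma hamiltonian_le_of_superjet (S : Problem ε T C f g) (ht0 : 0 ≤ t) (htT : t < T) {P : E3}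
    {τ : ℝ} (h : IsSuperjet T (value ε T f g) x t P τ) :
    -τ + hamiltonian ε x P ≤ f x t := by
  set v := -rowMul P (B ε x) with hv
  have hR : 0 ≤ max ‖x‖ ‖v‖ := (norm_nonneg x).trans (le_max_left _ _)
  obtain ⟨K, hK, H⟩ := S.exists_expansion_above hR
  set K₂ := K * T + (1 + ‖x‖) * ‖v‖
  have hT := S.hT
  have hK₂ : 0 ≤ K₂ := by positivity
  suffices X : -τ + hamiltonian ε x P - f x t ≤ 0 by linarith
  refine nonpos_of_forall_le_mul (K := 1 + K + ‖P‖ * K + (K₂ + 1)) fun e he => ?_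
  obtain ⟨d₁, hd₁, H₁⟩ := h.exists_bound ht0 hK₂ he
  obtain ⟨d₂, hd₂, H₂⟩ := S.exists_integral_le x ⟨ht0, htT.le⟩ he
  -- Taking r < e turns every remainder of order r² into one of order e r.
  obtain ⟨r, hr0, hr⟩ := exists_between (lt_min (lt_min hd₁ hd₂) (lt_min he (sub_pos.2 htT)))
  simp only [lt_min_iff] at hr
  obtain ⟨⟨hr1, hr2⟩, hre, hrT⟩ := hr
  obtain ⟨ζ, g1, g2⟩ := H x v (le_max_left _ _) (le_max_right _ _) t (t + r) ht0 (by linarith)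
    (by linarith)
  rw [add_sub_cancel_left] at g1 g2
  have g3 := H₁ r hr0 hr1 (by linarith) ζ
    (S.norm_sub_le_of_first_order hK hr0 (by linarith) g1)
  have g4 := (abs_le.1 (H₂ t (t + r) ⟨ht0, htT.le⟩ ⟨by linarith, by linarith⟩ (by linarith)
    (by simpa) (by simpa [abs_of_pos hr0]))).2
  rw [add_sub_cancel_left] at g4
  have g5 := (abs_le.1 (abs_inner_sub_le (P := P) g1)).2
  have g6 : inner ℝ (rowMul P (B ε x)) v = -‖v‖ ^ 2 := by
    rw [hv, inner_neg_right, real_inner_self_eq_norm_sq, norm_neg]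
  have g7 : hamiltonian ε x P = ‖v‖ ^ 2 / 2 := by rw [hamiltonian, hv, norm_neg]
  have g8 : ‖P‖ * (K * r ^ 2) ≤ ‖P‖ * (K * (r * e)) := by rw [sq]; gcongr
  have g9 : K * r ^ 2 ≤ K * (r * e) := by rw [sq]; gcongr
  rw [g6] at g5
  rw [g7]
  have : r * (-τ + ‖v‖ ^ 2 / 2 - f x t) ≤ r * (e * (1 + K + ‖P‖ * K + (K₂ + 1))) := by linarith
  exact le_of_mul_le_mul_left this hr0

/-- A subjet is encoded as a superjet of the negated function. The velocity v from the lower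
expansion is unknown, but |v|²/2 + ⟨PB, v⟩ ≥ -H for every v, and its norm is bounded by K. -/
lemma le_hamiltonian_of_subjet (S : Problem ε T C f g) (ht0 : 0 ≤ t) (htT : t < T) {P : E3}
    {τ : ℝ} (h : IsSuperjet T (fun x t => -value ε T f g x t) x t (-P) (-τ)) :
    f x t ≤ -τ + hamiltonian ε x P := by
  obtain ⟨K, hK, H⟩ := S.exists_expansion_below (norm_nonneg x)
  set K₂ := K * T + (1 + ‖x‖) * K
  have hT := S.hT
  have hK₂ : 0 ≤ K₂ := by positivity
  suffices X : f x t + τ - hamiltonian ε x P ≤ 0 by linarith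
  refine nonpos_of_forall_le_mul (K := 1 + K + ‖P‖ * K + (K₂ + 1)) fun e he => ?_
  obtain ⟨d₁, hd₁, H₁⟩ := h.exists_bound ht0 hK₂ he
  obtain ⟨d₂, hd₂, H₂⟩ := S.exists_integral_le x ⟨ht0, htT.le⟩ he
  obtain ⟨r, hr0, hr⟩ := exists_between (lt_min (lt_min hd₁ hd₂) (lt_min he (sub_pos.2 htT)))
  simp only [lt_min_iff] at hr
  obtain ⟨⟨hr1, hr2⟩, hre, hrT⟩ := hr
  obtain ⟨v, ζ, g0, g1, g2⟩ := H x le_rfl t (t + r) ht0 (by linarith) (by linarith)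
  rw [add_sub_cancel_left] at g1 g2
  have g3 := H₁ r hr0 hr1 (by linarith) ζ
    ((S.norm_sub_le_of_first_order hK hr0 (by linarith) g1).trans
      (by show _ ≤ (K * T + (1 + ‖x‖) * K) * r; gcongr))
  have g4 := (abs_le.1 (H₂ t (t + r) ⟨ht0, htT.le⟩ ⟨by linarith, by linarith⟩ (by linarith)
    (by simpa) (by simpa [abs_of_pos hr0]))).1
  rw [add_sub_cancel_left] at g4
  have g5 := (abs_le.1 (abs_inner_sub_le (P := P) g1)).1
  have g6 : -(‖rowMul P (B ε x)‖ ^ 2 / 2) ≤ ‖v‖ ^ 2 / 2 + inner ℝ (rowMul P (B ε x)) v := by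
    have := norm_add_sq_real (rowMul P (B ε x)) v
    nlinarith [sq_nonneg ‖rowMul P (B ε x) + v‖]
  have g8 : ‖P‖ * (K * r ^ 2) ≤ ‖P‖ * (K * (r * e)) := by rw [sq]; gcongr
  have g9 : K * r ^ 2 ≤ K * (r * e) := by rw [sq]; gcongr
  have g10 := mul_le_mul_of_nonneg_left g6 hr0.le
  rw [inner_neg_left] at g3
  rw [hamiltonian]
  have : r * (f x t + τ - ‖rowMul P (B ε x)‖ ^ 2 / 2) ≤
      r * (e * (1 + K + ‖P‖ * K + (K₂ + 1))) := by linarith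
  exact le_of_mul_le_mul_left this hr0

lemma hamiltonian_neg (ε : ℝ) (x P : E3) : hamiltonian ε x (-P) = hamiltonian ε x P := by
  rw [hamiltonian, hamiltonian, rowMul_neg, norm_neg]

/-- Both viscosity inequalities for the value function, with a sign `σ = ±1`. -/
lemma superjet_sign (S : Problem ε T C f g) {σ : ℝ} (hσ : σ = 1 ∨ σ = -1) (ht0 : 0 ≤ t)
    (htT : t < T) {P : E3} {τ : ℝ}
    (h : IsSuperjet T (fun x t => σ * value ε T f g x t) x t P τ) :
    -τ + σ * (hamiltonian ε x P - f x t) ≤ 0 := by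
  rcases hσ with rfl | rfl
  · simp only [one_mul] at h ⊢
    linarith [S.hamiltonian_le_of_superjet ht0 htT h]
  · simp only [neg_one_mul] at h ⊢
    have := S.le_hamiltonian_of_subjet ht0 htT (P := -P) (τ := -τ) (by simpa using h)
    rw [hamiltonian_neg] at this
    linarith

end Problem

/-! ### Comparison with the value function -/

/-- The fourth power of a homogeneous gauge, plus one. -/
def gauge (x : E3) : ℝ := 1 + (x 0 ^ 2 + x 1 ^ 2) ^ 2 + x 2 ^ 2

lemma one_le_gauge (x : E3) : 1 ≤ gauge x := by
  unfold gauge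
  nlinarith [sq_nonneg (x 2), sq_nonneg (x 0 ^ 2 + x 1 ^ 2)]

lemma gauge_pos (x : E3) : 0 < gauge x := one_pos.trans_le (one_le_gauge x)

lemma norm_sq_le_gauge (x : E3) : ‖x‖ ^ 2 ≤ gauge x := by
  rw [norm_sq_E3, gauge]
  nlinarith [sq_nonneg (x 0 ^ 2 + x 1 ^ 2 - 1)]

/-- A penalization whose derivative along the control fields decays fast enough. -/
def penalty (x : E3) : ℝ := Real.log (gauge x)

lemma penalty_nonneg (x : E3) : 0 ≤ penalty x := Real.log_nonneg (one_le_gauge x)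

lemma contDiff_penalty : ContDiff ℝ 1 penalty := by
  have h : ∀ i : Fin 3, ContDiff ℝ 1 fun x : E3 => x i := fun i =>
    (EuclideanSpace.proj i : E3 →L[ℝ] ℝ).contDiff
  refine ContDiff.log ?_ fun x => (gauge_pos x).ne'
  exact (contDiff_const.add (((h 0).pow 2).add ((h 1).pow 2) |>.pow 2)).add ((h 2).pow 2)

/-- The gradient of the penalization. -/
def penaltyGrad (x : E3) : E3 :=
  (gauge x)⁻¹ • !₂[4 * (x 0 ^ 2 + x 1 ^ 2) * x 0, 4 * (x 0 ^ 2 + x 1 ^ 2) * x 1, 2 * x 2]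

lemma hasGradientAt_penalty (x : E3) : HasGradientAt penalty (penaltyGrad x) x := by
  rw [hasGradientAt_iff_hasFDerivAt]
  have h : ∀ i : Fin 3, HasFDerivAt (fun x : E3 => x i) (EuclideanSpace.proj i : E3 →L[ℝ] ℝ) x :=
    fun i => (EuclideanSpace.proj i : E3 →L[ℝ] ℝ).hasFDerivAt
  have hg : HasFDerivAt gauge _ x :=
    ((((h 0).pow 2).add ((h 1).pow 2) |>.pow 2).const_add 1).add ((h 2).pow 2)
  have := hg.log (gauge_pos x).ne'
  refine this.congr_fderiv ?_
  ext v
  simp only [penaltyGrad, InnerProductSpace.toDual_apply_apply, PiLp.inner_apply,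
    Fin.sum_univ_three, RCLike.inner_apply, conj_trivial]
  simp
  ring

lemma rowMul_penaltyGrad (ε : ℝ) (x : E3) : rowMul (penaltyGrad x) (B ε x) =
    (gauge x)⁻¹ • !₂[4 * (x 0 ^ 2 + x 1 ^ 2) * x 0 - 2 * x 1 * x 2,
      4 * (x 0 ^ 2 + x 1 ^ 2) * x 1 + 2 * x 0 * x 2, 2 * ε * x 2] := by
  rw [penaltyGrad, rowMul_smul, rowMul_B]
  congr 1
  ext i
  fin_cases i <;> simp <;> ring

/-- With q = x₁² + x₂², the numerator is 16q³ + 4q c² + 4ε²c² and must be beaten by (1 + q² + c²)²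
after multiplication by 1 + q. This is where the homogeneity of the gauge, quartic in the horizontal
variables and quadratic in the vertical one, is used. -/
lemma gauge_growth {ε : ℝ} (hε : ε ∈ Icc (0 : ℝ) 1) (x : E3) :
    2 * (1 + (x 0 ^ 2 + x 1 ^ 2)) * ‖rowMul (penaltyGrad x) (B ε x)‖ ^ 2 ≤ 8 ^ 2 := by
  have hG := gauge_pos x
  rw [rowMul_penaltyGrad, norm_smul, mul_pow, norm_inv, Real.norm_of_nonneg hG.le, norm_sq_E3,
    inv_pow, mul_left_comm, inv_mul_le_iff₀ (by positivity)]
  simp only [Matrix.cons_val]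
  have hε2 : ε ^ 2 ≤ 1 := pow_le_one₀ hε.1 hε.2
  set q := x 0 ^ 2 + x 1 ^ 2 with hq
  have hq0 : 0 ≤ q := by positivity
  set c := x 2
  have e : (4 * q * x 0 - 2 * x 1 * c) ^ 2 + (4 * q * x 1 + 2 * x 0 * c) ^ 2 + (2 * ε * c) ^ 2 =
      16 * q ^ 3 + 4 * q * c ^ 2 + 4 * (ε ^ 2 * c ^ 2) := by
    rw [hq]; ring
  have e2 : ε ^ 2 * c ^ 2 ≤ c ^ 2 := mul_le_of_le_one_left (sq_nonneg c) hε2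
  have e3 : 2 * q ^ 3 ≤ q ^ 2 + q ^ 4 := by nlinarith [sq_nonneg (q * (q - 1))]
  have e4 : 2 * q ≤ 1 + q ^ 2 := by nlinarith [sq_nonneg (q - 1)]
  have hc := sq_nonneg c
  have e5 := mul_le_mul_of_nonneg_right e4 hc
  rw [e, gauge, ← hq]
  calc 2 * (1 + q) * (16 * q ^ 3 + 4 * q * c ^ 2 + 4 * (ε ^ 2 * c ^ 2))
      ≤ 2 * (1 + q) * (16 * q ^ 3 + 4 * q * c ^ 2 + 4 * c ^ 2) := by gcongr
    _ ≤ (1 + q ^ 2 + c ^ 2) ^ 2 * 8 ^ 2 := by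
      have h4 : 0 ≤ c ^ 4 := by positivity
      have h5 : 0 ≤ q ^ 2 * c ^ 2 := by positivity
      have h6 : 0 ≤ q ^ 4 := by positivity
      have h7 : 0 ≤ q ^ 2 := by positivity
      nlinarith

lemma norm_penaltyGrad_le {ε : ℝ} (hε : ε ∈ Icc (0 : ℝ) 1) (x : E3) :
    ‖rowMul (penaltyGrad x) (B ε x)‖ ≤ 8 := by
  refine abs_le_of_sq_le_sq' ?_ (by norm_num) |>.2
  refine le_trans ?_ (gauge_growth hε x)
  have : 0 ≤ x 0 ^ 2 + x 1 ^ 2 := by positivity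
  nlinarith [sq_nonneg ‖rowMul (penaltyGrad x) (B ε x)‖]

/-- |pB|² grows at most like 1 + x₁² + x₂², exactly the weight that `gauge_growth` compensates. The
bound is therefore uniform in x. -/
lemma abs_inner_penaltyGrad_le {ε : ℝ} (hε : ε ∈ Icc (0 : ℝ) 1) (x p : E3) :
    |inner ℝ (rowMul p (B ε x)) (rowMul (penaltyGrad x) (B ε x))| ≤ 8 * ‖p‖ := by
  have hp : ‖rowMul p (B ε x)‖ ^ 2 ≤ 2 * (1 + (x 0 ^ 2 + x 1 ^ 2)) * ‖p‖ ^ 2 := by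
    rw [norm_sq_E3, norm_sq_E3, rowMul_B]
    simp only [Matrix.cons_val]
    have hε2 : ε ^ 2 ≤ 1 := pow_le_one₀ hε.1 hε.2
    have e2 : ε ^ 2 * p 2 ^ 2 ≤ p 2 ^ 2 := mul_le_of_le_one_left (sq_nonneg _) hε2
    nlinarith [sq_nonneg (p 0 + x 1 * p 2), sq_nonneg (p 1 - x 0 * p 2),
      mul_nonneg (add_nonneg (sq_nonneg (x 0)) (sq_nonneg (x 1)))
        (add_nonneg (sq_nonneg (p 0)) (sq_nonneg (p 1)))]
  refine (abs_real_inner_le_norm _ _).trans ?_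
  refine abs_le_of_sq_le_sq' ?_ (by positivity) |>.2
  rw [mul_pow, mul_pow]
  calc _ ≤ 2 * (1 + (x 0 ^ 2 + x 1 ^ 2)) * ‖p‖ ^ 2 * ‖rowMul (penaltyGrad x) (B ε x)‖ ^ 2 := by
        gcongr
    _ = 2 * (1 + (x 0 ^ 2 + x 1 ^ 2)) * ‖rowMul (penaltyGrad x) (B ε x)‖ ^ 2 * ‖p‖ ^ 2 := by ring
    _ ≤ _ := by gcongr; exact gauge_growth hε x

/-- For bounded p, penalizing at infinity perturbs the Hamiltonian by O(β) uniformly in x, although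
the Hamiltonian itself is unbounded in x. -/
lemma hamiltonian_add_penalty_sub_le {ε β : ℝ} (hε : ε ∈ Icc (0 : ℝ) 1) (hβ : 0 ≤ β)
    (x p : E3) :
    |hamiltonian ε x (p + β • penaltyGrad x) - hamiltonian ε x p| ≤ β * (8 * ‖p‖) + 32 * β ^ 2 := by
  rw [hamiltonian, hamiltonian, rowMul_add, rowMul_smul, norm_add_sq_real, real_inner_smul_right,
    norm_smul, Real.norm_of_nonneg hβ]
  have h1 := abs_inner_penaltyGrad_le hε x p
  have h2 := norm_penaltyGrad_le hε x
  have h3 : ‖rowMul (penaltyGrad x) (B ε x)‖ ^ 2 ≤ 8 ^ 2 := by gcongr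
  have e : (‖rowMul p (B ε x)‖ ^ 2 +
      2 * (β * inner ℝ (rowMul p (B ε x)) (rowMul (penaltyGrad x) (B ε x))) +
      (β * ‖rowMul (penaltyGrad x) (B ε x)‖) ^ 2) / 2 - ‖rowMul p (B ε x)‖ ^ 2 / 2 =
      β * inner ℝ (rowMul p (B ε x)) (rowMul (penaltyGrad x) (B ε x)) +
      ‖rowMul (penaltyGrad x) (B ε x)‖ ^ 2 / 2 * β ^ 2 := by ring
  rw [e]
  refine (abs_add_le _ _).trans (add_le_add ?_ ?_)
  · rw [abs_mul, abs_of_nonneg hβ]; gcongr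
  · rw [abs_of_nonneg (by positivity)]
    gcongr
    linarith

lemma abs_hamiltonian_sub_le {ε R : ℝ} (hε : ε ∈ Icc (0 : ℝ) 1) {x y : E3} (hx : ‖x‖ ≤ R)
    (hy : ‖y‖ ≤ R) (p : E3) :
    |hamiltonian ε x p - hamiltonian ε y p| ≤ ‖x - y‖ * (1 + R) * ‖p‖ ^ 2 := by
  have h1 := norm_rowMul_B_sub_le ε x y p
  have h2 := (norm_rowMul_B_le hε x p).trans
    (mul_le_mul_of_nonneg_right (add_le_add_right hx 1) (norm_nonneg p))
  have h3 := (norm_rowMul_B_le hε y p).trans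
    (mul_le_mul_of_nonneg_right (add_le_add_right hy 1) (norm_nonneg p))
  have h4 := (abs_norm_sub_norm_le (rowMul p (B ε x)) (rowMul p (B ε y))).trans h1
  have e : hamiltonian ε x p - hamiltonian ε y p =
      (‖rowMul p (B ε x)‖ - ‖rowMul p (B ε y)‖) *
        ((‖rowMul p (B ε x)‖ + ‖rowMul p (B ε y)‖) / 2) := by
    rw [hamiltonian, hamiltonian]; ring
  rw [e, abs_mul, abs_of_nonneg (a := (_ + _) / 2) (by positivity)]
  calc _ ≤ (‖x - y‖ * ‖p‖) * (((1 + R) * ‖p‖ + (1 + R) * ‖p‖) / 2) := by gcongr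
    _ = _ := by ring

lemma hasGradientAt_norm_sub_sq (y x : E3) (δ : ℝ) :
    HasGradientAt (fun z : E3 => ‖z - y‖ ^ 2 / (2 * δ)) (δ⁻¹ • (x - y)) x := by
  rw [hasGradientAt_iff_hasFDerivAt]
  have h := ((hasStrictFDerivAt_norm_sq (x - y)).hasFDerivAt.comp x
    ((hasFDerivAt_id x).sub_const y)).mul_const (2 * δ)⁻¹
  refine (h.congr_fderiv ?_).congr_of_eventuallyEq (Eventually.of_forall fun z => ?_)
  · ext v
    simp [InnerProductSpace.toDual_apply_apply]
    ring
  · simp [div_eq_mul_inv]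

lemma HasGradientAt.const_mul' {a : E3 → ℝ} {P x : E3} (h : HasGradientAt a P x) (c : ℝ) :
    HasGradientAt (fun z => c * a z) (c • P) x := by
  rw [hasGradientAt_iff_hasFDerivAt] at *
  rw [map_smul]
  exact h.const_mul c

lemma HasGradientAt.add' {a b : E3 → ℝ} {P Q x : E3} (h : HasGradientAt a P x)
    (h' : HasGradientAt b Q x) : HasGradientAt (fun z => a z + b z) (P + Q) x := by
  rw [hasGradientAt_iff_hasFDerivAt] at *
  rw [map_add]
  exact h.add h'

/-! ### Doubling of variables. -/

/-- The functional of the doubling of variables. -/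
def doubling (u v : E3 → ℝ → ℝ) (δ β μ : ℝ) (x : E3) (t : ℝ) (y : E3) (s : ℝ) : ℝ :=
  u x t - v y s + (‖x - y‖ ^ 2 / (2 * δ) + (t - s) ^ 2 / (2 * δ)) + β * penalty x + (μ / t + μ / s)

/-- The radius is fixed before δ, so that δ can later be chosen from a modulus of continuity on that
ball. Values below 1 force each penalty below N = 2M + 1: the logarithm confines x, the quadratic
term confines y, and μ/t, μ/s keep the times at least μ/N. Minimization thus takes place on a
compact set. -/
lemma exists_doubling_min {u v : E3 → ℝ → ℝ} {T M β μ : ℝ} (hM : 0 ≤ M)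
    (hu : ContinuousOn (fun q : E3 × ℝ => u q.1 q.2) (univ ×ˢ Icc 0 T))
    (hv : ContinuousOn (fun q : E3 × ℝ => v q.1 q.2) (univ ×ˢ Icc 0 T))
    (hub : ∀ x, ∀ t ∈ Icc 0 T, |u x t| ≤ M) (hvb : ∀ x, ∀ t ∈ Icc 0 T, |v x t| ≤ M)
    (hβ : 0 < β) (hμ : 0 < μ) :
    ∃ R, 0 ≤ R ∧ ∀ δ, 0 < δ → δ ≤ 1 → ∀ x₀, ∀ t₀ ∈ Ioc 0 T, doubling u v δ β μ x₀ t₀ x₀ t₀ < 1 →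
      ∃ x t y s, ‖x‖ ≤ R ∧ ‖y‖ ≤ R ∧ t ∈ Ioc 0 T ∧ s ∈ Ioc 0 T ∧
        ∀ x' y', ∀ t' ∈ Ioc 0 T, ∀ s' ∈ Ioc 0 T,
          doubling u v δ β μ x t y s ≤ doubling u v δ β μ x' t' y' s' := by
  set N := 2 * M + 1 with hN
  have hN1 : 1 ≤ N := by linarith
  set R₁ := 1 + Real.exp (N / β) with hR₁
  set R := R₁ + 2 * N
  have hR₁0 : 1 ≤ R₁ := by have := Real.exp_pos (N / β); linarith
  have hR0 : 0 ≤ R := by positivity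
  refine ⟨R, hR0, fun δ hδ hδ1 x₀ t₀ ht₀ h0 => ?_⟩
  have hbase : ∀ x y, ∀ t ∈ Ioc 0 T, ∀ s ∈ Ioc 0 T, doubling u v δ β μ x t y s < 1 →
      ‖x‖ ≤ R ∧ ‖y‖ ≤ R ∧ t ∈ Icc (μ / N) T ∧ s ∈ Icc (μ / N) T := by
    intro x y t ht s hs hlt
    have h1 := (abs_le.1 (hub x t ⟨ht.1.le, ht.2⟩)).1
    have h2 := (abs_le.1 (hvb y s ⟨hs.1.le, hs.2⟩)).2
    have h3 : 0 ≤ ‖x - y‖ ^ 2 / (2 * δ) := by positivity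
    have h4 : 0 ≤ (t - s) ^ 2 / (2 * δ) := by positivity
    have h5 : 0 ≤ β * penalty x := mul_nonneg hβ.le (penalty_nonneg x)
    have h6 : 0 < μ / t := div_pos hμ ht.1
    have h7 : 0 < μ / s := div_pos hμ hs.1
    unfold doubling at hlt
    have hx : ‖x‖ ≤ R₁ := by
      by_contra! hx
      have e1 : Real.exp (N / β) ≤ gauge x := by
        refine le_trans ?_ (norm_sq_le_gauge x)
        nlinarith
      have e2 : N / β ≤ penalty x := (Real.le_log_iff_exp_le (gauge_pos x)).2 e1
      rw [div_le_iff₀ hβ] at e2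
      linarith
    have hxy : ‖x - y‖ ≤ 2 * N := by
      by_contra! hxy
      have : N ≤ ‖x - y‖ ^ 2 / (2 * δ) := by
        rw [le_div_iff₀ (by positivity)]
        nlinarith
      linarith
    refine ⟨by linarith, ?_, ⟨?_, ht.2⟩, ⟨?_, hs.2⟩⟩
    · have := norm_sub_norm_le y x
      rw [norm_sub_rev] at this
      linarith
    · rw [div_le_iff₀ (by linarith), ← div_le_iff₀' ht.1]; linarith
    · rw [div_le_iff₀ (by linarith), ← div_le_iff₀' hs.1]; linarith
  have hτ : 0 < μ / N := by positivity
  set K : Set ((E3 × ℝ) × (E3 × ℝ)) := (Metric.closedBall 0 R ×ˢ Icc (μ / N) T) ×ˢ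
    (Metric.closedBall 0 R ×ˢ Icc (μ / N) T) with hK
  have hKc : IsCompact K :=
    ((isCompact_closedBall _ _).prod isCompact_Icc).prod
      ((isCompact_closedBall _ _).prod isCompact_Icc)
  have memK : ∀ x y, ∀ t ∈ Ioc 0 T, ∀ s ∈ Ioc 0 T, doubling u v δ β μ x t y s < 1 →
      ((x, t), (y, s)) ∈ K := fun x y t ht s hs hlt => by
    obtain ⟨a1, a2, a3, a4⟩ := hbase x y t ht s hs hlt
    exact ⟨⟨by simpa using a1, a3⟩, ⟨by simpa using a2, a4⟩⟩
  have hcont : ContinuousOn (fun q : (E3 × ℝ) × (E3 × ℝ) =>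
      doubling u v δ β μ q.1.1 q.1.2 q.2.1 q.2.2) K := by
    have c1 : ContinuousOn (fun q : (E3 × ℝ) × (E3 × ℝ) => u q.1.1 q.1.2) K :=
      hu.comp continuousOn_fst fun q hq => ⟨mem_univ _, hτ.le.trans hq.1.2.1, hq.1.2.2⟩
    have c2 : ContinuousOn (fun q : (E3 × ℝ) × (E3 × ℝ) => v q.2.1 q.2.2) K :=
      hv.comp continuousOn_snd fun q hq => ⟨mem_univ _, hτ.le.trans hq.2.2.1, hq.2.2.2⟩
    have c3 : Continuous (fun q : (E3 × ℝ) × (E3 × ℝ) =>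
        ‖q.1.1 - q.2.1‖ ^ 2 / (2 * δ) + (q.1.2 - q.2.2) ^ 2 / (2 * δ)) := by fun_prop
    have c4 : Continuous (fun q : (E3 × ℝ) × (E3 × ℝ) => β * penalty q.1.1) :=
      continuous_const.mul (contDiff_penalty.continuous.comp (by fun_prop))
    have c5 : ContinuousOn (fun q : (E3 × ℝ) × (E3 × ℝ) => μ / q.1.2 + μ / q.2.2) K :=
      (continuousOn_const.div (by fun_prop) fun q hq => (hτ.trans_le hq.1.2.1).ne').add
        (continuousOn_const.div (by fun_prop) fun q hq => (hτ.trans_le hq.2.2.1).ne')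
    exact (((c1.sub c2).add c3.continuousOn).add c4.continuousOn).add c5
  obtain ⟨⟨⟨x, t⟩, ⟨y, s⟩⟩, hq, hmin⟩ := hKc.exists_isMinOn ⟨_, memK x₀ x₀ t₀ ht₀ t₀ ht₀ h0⟩ hcont
  refine ⟨x, t, y, s, by simpa using hq.1.1, by simpa using hq.2.1,
    ⟨hτ.trans_le hq.1.2.1, hq.1.2.2⟩, ⟨hτ.trans_le hq.2.2.1, hq.2.2.2⟩, fun x' y' t' ht' s' hs' => ?_⟩
  by_cases hlt : doubling u v δ β μ x' t' y' s' < 1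
  · exact hmin (memK x' y' t' ht' s' hs' hlt)
  · exact (hmin (memK x₀ x₀ t₀ ht₀ t₀ ht₀ h0)).trans (h0.le.trans (not_lt.1 hlt))

lemma eventually_mul_lt (a : ℝ) {c : ℝ} (hc : 0 < c) : ∀ᶠ δ : ℝ in 𝓝[>] 0, a * δ < c := by
  have h1 : Tendsto (fun δ : ℝ => a * δ) (𝓝[>] 0) (𝓝 (a * 0)) :=
    (Continuous.tendsto (by fun_prop) 0).mono_left nhdsWithin_le_nhds
  rw [mul_zero] at h1
  exact h1.eventually (gt_mem_nhds hc)

namespace Problem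

variable {ε T C : ℝ} {f : E3 → ℝ → ℝ} {g : E3 → ℝ}

/-- The two viscosity inequalities at a minimum point of the doubling functional. -/
lemma doubling_min_ineq (S : Problem ε T C f g) {σ : ℝ} (hσ : σ = 1 ∨ σ = -1) {u : E3 → ℝ → ℝ}
    (hvisc : ∀ φ : E3 × ℝ → ℝ, ContDiffOn ℝ 1 φ (univ ×ˢ Ioo 0 T) → ∀ x, ∀ t ∈ Ioo 0 T,
      IsLocalMin (fun q : E3 × ℝ => σ * u q.1 q.2 - φ q) (x, t) →
        0 ≤ -deriv (fun s => φ (x, s)) t +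
          σ * (hamiltonian ε x (gradient (fun y => φ (y, t)) x) - f x t))
    {δ β μ : ℝ} {x y : E3} {t s : ℝ} (ht : t ∈ Ioo 0 T) (hs : s ∈ Ioo 0 T)
    (hmin : ∀ x' y', ∀ t' ∈ Ioc 0 T, ∀ s' ∈ Ioc 0 T,
      doubling (fun x t => σ * u x t) (fun x t => σ * value ε T f g x t) δ β μ x t y s ≤
      doubling (fun x t => σ * u x t) (fun x t => σ * value ε T f g x t) δ β μ x' t' y' s') :
    0 ≤ -(μ / t ^ 2) - μ / s ^ 2 +
      σ * (hamiltonian ε x (δ⁻¹ • (x - y) + β • penaltyGrad x) -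
        hamiltonian ε y (δ⁻¹ • (x - y)) - (f x t - f y s)) := by
  have hdt : HasDerivAt (fun r : ℝ => (r - s) ^ 2 / (2 * δ) + μ / r) (δ⁻¹ * (t - s) - μ / t ^ 2) t := by
    have h1 := (((hasDerivAt_id t).sub_const s).pow 2).div_const (2 * δ)
    have h2 := (hasDerivAt_inv ht.1.ne').const_mul μ
    refine ((h1.add h2).congr_deriv ?_).congr_of_eventuallyEq (Eventually.of_forall fun r => ?_)
    · simp only [id]; ring
    · simp [div_eq_mul_inv]
  have hds : HasDerivAt (fun r : ℝ => (t - r) ^ 2 / (2 * δ) + μ / r)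
      (-(δ⁻¹ * (t - s)) - μ / s ^ 2) s := by
    have h1 := (((hasDerivAt_id s).const_sub t).pow 2).div_const (2 * δ)
    have h2 := (hasDerivAt_inv hs.1.ne').const_mul μ
    refine ((h1.add h2).congr_deriv ?_).congr_of_eventuallyEq (Eventually.of_forall fun r => ?_)
    · simp only [id]; ring
    · simp [div_eq_mul_inv]
  have ev : ∀ (z : E3) (r : ℝ), r ∈ Ioo 0 T → ∀ᶠ q : E3 × ℝ in 𝓝 (z, r), q.2 ∈ Ioo 0 T :=
    fun z r hr => (continuous_snd.tendsto (z, r)).eventually (Ioo_mem_nhds hr.1 hr.2)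
  -- the inequality for `u`
  set ψ : E3 × ℝ → ℝ := fun q => ‖q.1 - y‖ ^ 2 / (2 * δ) + β * penalty q.1 +
    ((q.2 - s) ^ 2 / (2 * δ) + μ / q.2) with hψ
  have hψC : ContDiffOn ℝ 1 (fun q => -ψ q) (univ ×ˢ Ioo 0 T) := by
    refine ContDiffOn.neg (ContDiffOn.add (ContDiffOn.add ?_ ?_) (ContDiffOn.add ?_ ?_))
    · exact (((contDiff_fst.sub contDiff_const).norm_sq ℝ).div_const _).contDiffOn
    · exact (contDiff_const.mul (contDiff_penalty.comp contDiff_fst)).contDiffOn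
    · exact (((contDiff_snd.sub contDiff_const).pow 2).div_const _).contDiffOn
    · exact contDiffOn_const.div contDiff_snd.contDiffOn fun q hq => hq.2.1.ne'
  have h1 := hvisc _ hψC x t ht (by
    filter_upwards [ev x t ht] with q hq
    have := hmin q.1 y q.2 ⟨hq.1, hq.2.le⟩ s ⟨hs.1, hs.2.le⟩
    simp only [doubling] at this
    simp only [hψ]
    linarith)
  have e1 : deriv (fun r => -ψ (x, r)) t = -(δ⁻¹ * (t - s) - μ / t ^ 2) :=
    (hdt.const_add (‖x - y‖ ^ 2 / (2 * δ) + β * penalty x)).fun_neg.deriv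
  have e2 : gradient (fun z => -ψ (z, t)) x = -(δ⁻¹ • (x - y) + β • penaltyGrad x) := by
    have h2 := HasGradientAt.add' (HasGradientAt.add' (hasGradientAt_norm_sub_sq y x δ)
      (HasGradientAt.const_mul' (hasGradientAt_penalty x) β))
      (hasGradientAt_const x ((t - s) ^ 2 / (2 * δ) + μ / t))
    have h3 := HasGradientAt.const_mul' h2 (-1)
    simp only [neg_one_mul, neg_one_smul, add_zero] at h3
    exact h3.gradient
  rw [e1, e2, hamiltonian_neg] at h1
  -- the inequality for the value function
  have hjet : IsSuperjet T (fun x t => σ * value ε T f g x t) y s (δ⁻¹ • (y - x))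
      (-(δ⁻¹ * (t - s)) - μ / s ^ 2) := by
    refine isSuperjet_of_le_add (hasGradientAt_norm_sub_sq x y δ) hds ?_
    filter_upwards [nhdsWithin_le_nhds (ev y s hs)] with q hq
    have := hmin x q.1 t ⟨ht.1, ht.2.le⟩ q.2 ⟨hq.1, hq.2.le⟩
    simp only [doubling] at this
    rw [norm_sub_rev x y, norm_sub_rev x q.1] at this
    linarith
  have h2 := S.superjet_sign hσ hs.1.le hs.2 hjet
  have e3 : δ⁻¹ • (y - x) = -(δ⁻¹ • (x - y)) := by rw [← smul_neg, neg_sub]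
  rw [e3, hamiltonian_neg] at h2
  linarith

/-- Comparison of a viscosity super- (`σ = 1`) or subsolution (`σ = -1`) with the value
function. -/
theorem sign_mul_value_sub_le (S : Problem ε T C f g) {σ : ℝ} (hσ : σ = 1 ∨ σ = -1)
    {u : E3 → ℝ → ℝ} {M₀ : ℝ} (hub : ∀ x, ∀ t ∈ Icc 0 T, |u x t| ≤ M₀)
    (huc : ContinuousOn (fun q : E3 × ℝ => u q.1 q.2) (univ ×ˢ Icc 0 T))
    (huT : ∀ x, u x T = g x)
    (hvisc : ∀ φ : E3 × ℝ → ℝ, ContDiffOn ℝ 1 φ (univ ×ˢ Ioo 0 T) → ∀ x, ∀ t ∈ Ioo 0 T,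
      IsLocalMin (fun q : E3 × ℝ => σ * u q.1 q.2 - φ q) (x, t) →
        0 ≤ -deriv (fun s => φ (x, s)) t +
          σ * (hamiltonian ε x (gradient (fun y => φ (y, t)) x) - f x t))
    (x : E3) {t : ℝ} (ht : t ∈ Icc 0 T) : σ * (value ε T f g x t - u x t) ≤ 0 := by
  have hT := S.hT
  have hσ1 : |σ| = 1 := by rcases hσ with rfl | rfl <;> simp
  have hVc := S.continuousOn_value
  have slice : ∀ (w : E3 → ℝ → ℝ) (x : E3),
      ContinuousOn (fun q : E3 × ℝ => w q.1 q.2) (univ ×ˢ Icc 0 T) →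
      ContinuousOn (fun t => w x t) (Icc 0 T) := fun w x hw =>
    hw.comp (f := fun s : ℝ => (x, s)) (by fun_prop) fun s hs => ⟨mem_univ _, hs⟩
  -- Both functions are continuous up to the endpoints, so interior times suffice; positive t₀ is
  -- needed for the singular terms in time.
  suffices H : ∀ x₀, ∀ t₀ ∈ Ioo 0 T, σ * (value ε T f g x₀ t₀ - u x₀ t₀) ≤ 0 by
    have hcl : closure (Ioo 0 T) = Icc 0 T := closure_Ioo hT.ne
    refine le_on_closure (s := Ioo 0 T) (f := fun t => σ * (value ε T f g x t - u x t))
      (g := fun _ => 0) (H x) ?_ continuousOn_const (hcl ▸ ht)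
    rw [hcl]
    exact continuousOn_const.mul ((slice _ x hVc).sub (slice _ x huc))
  clear x t ht
  intro x₀ t₀ ht₀
  by_contra! hpos
  obtain ⟨κ, hκ⟩ : ∃ κ, σ * (value ε T f g x₀ t₀ - u x₀ t₀) = 2 * κ :=
    ⟨σ * (value ε T f g x₀ t₀ - u x₀ t₀) / 2, by ring⟩
  have hκ0 : 0 < κ := by linarith
  set M := max M₀ (C * (T + 1))
  have hM0 : 0 ≤ M := (mul_nonneg S.hC (by linarith)).trans (le_max_right _ _)
  have hub' : ∀ x, ∀ t ∈ Icc 0 T, |σ * u x t| ≤ M := fun x t ht => by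
    rw [abs_mul, hσ1, one_mul]; exact (hub x t ht).trans (le_max_left _ _)
  have hvb' : ∀ x, ∀ t ∈ Icc 0 T, |σ * value ε T f g x t| ≤ M := fun x t ht => by
    rw [abs_mul, hσ1, one_mul]; exact (S.abs_value_le ht x).trans (le_max_right _ _)
  set L := S.lipBound
  have hL : 0 ≤ L := S.lipBound_nonneg
  -- The two singular terms then cost κ/2 at t₀, and β is chosen so that the penalty at x₀ costs
  -- less than κ/2. Out of the gap 2κ, at least κ survives.
  set μ := κ * t₀ / 4 with hμdef
  have hμ : 0 < μ := by have := ht₀.1; positivity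
  -- A lower bound for μ/t² and μ/s², the strict terms that produce the contradiction: the total
  -- gain is at least 2m, while all errors sum to less than 3m/2.
  set m := μ / T ^ 2 with hm
  have hm0 : 0 < m := by positivity
  have hp0 := penalty_nonneg x₀
  obtain ⟨β, hβ1, hβ2, hβ3, hβ0⟩ : ∃ β : ℝ, 1 * β < 1 ∧ penalty x₀ * β < κ / 2 ∧
      (16 * L + 32) * β < m ∧ 0 < β :=
    ((eventually_mul_lt 1 one_pos).and ((eventually_mul_lt (penalty x₀) (half_pos hκ0)).and
      ((eventually_mul_lt (16 * L + 32) hm0).and self_mem_nhdsWithin))).exists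
  obtain ⟨R, hR, HR⟩ := exists_doubling_min (u := fun x t => σ * u x t)
    (v := fun x t => σ * value ε T f g x t) hM0 (continuousOn_const.mul huc)
    (continuousOn_const.mul hVc) hub' hvb' hβ0 hμ
  have hcomp : IsCompact (Metric.closedBall (0 : E3) R ×ˢ Icc 0 T) :=
    (isCompact_closedBall _ _).prod isCompact_Icc
  have hunif := hcomp.uniformContinuousOn_of_continuous
    ((huc.prodMk (hVc.prodMk S.f_cont)).mono (prod_mono (subset_univ _) le_rfl))
  obtain ⟨d, hd, Hd⟩ := Metric.uniformContinuousOn_iff.1 hunif (min κ (m / 4))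
    (lt_min hκ0 (by positivity))
  obtain ⟨δ, hδ1, hδ2, hδ3, hδ4, hδ0⟩ : ∃ δ : ℝ, 1 * δ < 1 ∧ 2 * L * δ < d ∧ 4 * M * δ < d ^ 2 ∧
      2 * L * (1 + R) * (2 * L) ^ 2 * δ < m / 4 ∧ 0 < δ :=
    ((eventually_mul_lt 1 one_pos).and ((eventually_mul_lt _ hd).and
      ((eventually_mul_lt _ (pow_pos hd 2)).and ((eventually_mul_lt _ (by positivity)).and
      self_mem_nhdsWithin)))).exists
  have hbase : doubling (fun x t => σ * u x t) (fun x t => σ * value ε T f g x t) δ β μ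
      x₀ t₀ x₀ t₀ < -κ := by
    have : μ / t₀ = κ / 4 := by rw [hμdef]; field_simp [ht₀.1.ne']
    simp only [doubling, sub_self, norm_zero, this]
    norm_num
    linarith
  obtain ⟨x, t, y, s, hx, hy, ht, hs, hmin⟩ := HR δ hδ0 (by linarith) x₀ t₀ ⟨ht₀.1, ht₀.2.le⟩
    (by linarith)
  have hval := (hmin x₀ x₀ t₀ ⟨ht₀.1, ht₀.2.le⟩ t₀ ⟨ht₀.1, ht₀.2.le⟩).trans_lt hbase
  have ht' : t ∈ Icc 0 T := ⟨ht.1.le, ht.2⟩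
  have hs' : s ∈ Icc 0 T := ⟨hs.1.le, hs.2⟩
  -- Moving y onto x in the minimum inequality, with both times fixed, affects only the value
  -- function and the quadratic term. The Lipschitz bound for V then keeps the doubled gradient
  -- within 2L, whatever δ is.
  have hxy : ‖x - y‖ ≤ 2 * L * δ := by
    have h1 := hmin x x t ht s hs
    simp only [doubling, sub_self, norm_zero] at h1
    have h2 : σ * (value ε T f g y s - value ε T f g x s) ≤ L * ‖x - y‖ := by
      refine (le_abs_self _).trans ?_
      rw [abs_mul, hσ1, one_mul, norm_sub_rev]
      exact S.abs_value_sub_le hs' y x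
    have h3 : ‖x - y‖ ^ 2 / (2 * δ) ≤ L * ‖x - y‖ := by
      norm_num at h1
      linarith
    rw [div_le_iff₀ (by positivity)] at h3
    by_contra! hlt
    nlinarith [norm_nonneg (x - y), mul_nonneg hL hδ0.le]
  have g1 : 0 ≤ ‖x - y‖ ^ 2 / (2 * δ) := by positivity
  have g2 : 0 ≤ (t - s) ^ 2 / (2 * δ) := by positivity
  have g3 : 0 ≤ β * penalty x := mul_nonneg hβ0.le (penalty_nonneg x)
  have g4 : 0 < μ / t := div_pos hμ ht.1
  have g5 : 0 < μ / s := div_pos hμ hs.1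
  simp only [doubling] at hval
  have hts : |t - s| < d := by
    have h1 := (abs_le.1 (hub' x t ht')).1
    have h2 := (abs_le.1 (hvb' y s hs')).2
    have h3 : (t - s) ^ 2 / (2 * δ) ≤ 2 * M := by linarith
    rw [div_le_iff₀ (by positivity)] at h3
    refine abs_lt_of_sq_lt_sq ?_ hd.le
    linarith
  have hdist : dist (x, t) (y, s) < d := by
    rw [Prod.dist_eq, max_lt_iff, dist_eq_norm, Real.dist_eq]
    exact ⟨hxy.trans_lt hδ2, hts⟩
  have hclose := Hd (x, t) ⟨by simpa using hx, ht'⟩ (y, s) ⟨by simpa using hy, hs'⟩ hdist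
  simp only [Prod.dist_eq, max_lt_iff, lt_min_iff, Real.dist_eq] at hclose
  obtain ⟨⟨cu, cv, -⟩, -, -, cf⟩ := hclose
  -- At t = T the two functions agree, and V(x, T) is within κ of V(y, s), so the functional could
  -- not be below -κ. The next step excludes s = T in the same way, using the continuity of u.
  have htT : t < T := by
    refine lt_of_le_of_ne ht.2 fun h => ?_
    have : σ * u x t = σ * value ε T f g x t := by rw [h, huT, S.value_terminal]
    have h2 : -κ < σ * (value ε T f g x t - value ε T f g y s) := by
      refine (abs_lt.1 ?_).1
      rwa [abs_mul, hσ1, one_mul]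
    linarith
  have hsT : s < T := by
    refine lt_of_le_of_ne hs.2 fun h => ?_
    have : σ * u y s = σ * value ε T f g y s := by rw [h, huT, S.value_terminal]
    have h2 : -κ < σ * (u x t - u y s) := by
      refine (abs_lt.1 ?_).1
      rwa [abs_mul, hσ1, one_mul]
    linarith
  have key := S.doubling_min_ineq hσ hvisc ⟨ht.1, htT⟩ ⟨hs.1, hsT⟩ hmin
  set p := δ⁻¹ • (x - y) with hp
  have hpL : ‖p‖ ≤ 2 * L := by
    rw [hp, norm_smul, norm_inv, Real.norm_of_nonneg hδ0.le, inv_mul_le_iff₀ hδ0]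
    linarith
  have k1 : m ≤ μ / t ^ 2 := by
    have := ht.1
    rw [hm]; gcongr
  have k2 : m ≤ μ / s ^ 2 := by
    have := hs.1
    rw [hm]; gcongr
  have k3 := hamiltonian_add_penalty_sub_le S.hε hβ0.le x p
  have k4 := abs_hamiltonian_sub_le S.hε hx hy p
  have k5 : |σ * (hamiltonian ε x (p + β • penaltyGrad x) - hamiltonian ε y p - (f x t - f y s))| ≤
      (β * (8 * ‖p‖) + 32 * β ^ 2) + ‖x - y‖ * (1 + R) * ‖p‖ ^ 2 + |f x t - f y s| := by
    rw [abs_mul, hσ1, one_mul]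
    have e : hamiltonian ε x (p + β • penaltyGrad x) - hamiltonian ε y p - (f x t - f y s) =
      (hamiltonian ε x (p + β • penaltyGrad x) - hamiltonian ε x p) +
      (hamiltonian ε x p - hamiltonian ε y p) + -(f x t - f y s) := by ring
    rw [e]
    refine (abs_add_le _ _).trans (add_le_add ((abs_add_le _ _).trans (add_le_add k3 k4)) ?_)
    rw [abs_neg]
  have k6 : β * (8 * ‖p‖) ≤ β * (8 * (2 * L)) := by gcongr
  have k7 : β ^ 2 ≤ β := pow_le_of_le_one hβ0.le (by linarith only [hβ1]) two_ne_zero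
  have k8 : ‖x - y‖ * (1 + R) * ‖p‖ ^ 2 ≤ 2 * L * δ * (1 + R) * (2 * L) ^ 2 := by gcongr
  have k9 : β * (8 * (2 * L)) + 32 * β = (16 * L + 32) * β := by ring
  have k10 : 2 * L * δ * (1 + R) * (2 * L) ^ 2 = 2 * L * (1 + R) * (2 * L) ^ 2 * δ := by ring
  rw [k10] at k8
  linarith only [(abs_le.1 k5).2, key, k1, k2, k6, k7, k8, k9, hβ3, hδ4, cf, hm0]

end Problem

/-- Uniqueness: a bounded viscosity solution is the value function. -/
theorem IsBoundedViscositySolution.eq_value {ε T C : ℝ} {f : E3 → ℝ → ℝ} {g : E3 → ℝ}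
    (S : Problem ε T C f g) {u : E3 → ℝ → ℝ} (hu : IsBoundedViscositySolution ε T f g u) (x : E3)
    {t : ℝ} (ht : t ∈ Icc 0 T) : u x t = value ε T f g x t := by
  obtain ⟨M₀, hM₀⟩ := hu.bounded
  have h1 := S.sign_mul_value_sub_le (Or.inl rfl) hM₀ hu.continuousOn hu.terminal
    (fun φ hφ x t ht hmin => by
      simp only [one_mul] at hmin ⊢
      linarith [hu.supersolution φ hφ x t ht hmin]) x ht
  have h2 := S.sign_mul_value_sub_le (Or.inr rfl) hM₀ hu.continuousOn hu.terminal
    (fun φ hφ x t ht hmin => by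
      -- For σ = -1, a minimum of -u - φ is a maximum of u - (-φ); negating the test function turns
      -- the subsolution property into the form required by the comparison.
      have h3 := hu.subsolution (fun q => -φ q) hφ.neg x t ht (by
        filter_upwards [hmin] with q hq
        linarith)
      have e1 : deriv (fun s => -φ (x, s)) t = -deriv (fun s => φ (x, s)) t := deriv.fun_neg
      have e2 : gradient (fun y => -φ (y, t)) x = -gradient (fun y => φ (y, t)) x := by
        simp only [gradient, fderiv_fun_neg, map_neg]
      rw [e1, e2, Problem.hamiltonian_neg] at h3
      linarith) x ht
  linarith

/-! ### Optimality of the feedback trajectories -/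

lemma nonpos_of_forall_lt_one_le_mul {X K : ℝ} (h : ∀ e, 0 < e → e < 1 → X ≤ e * K) : X ≤ 0 := by
  have h1 : Tendsto (fun e : ℝ => e * K) (𝓝[>] 0) (𝓝 (0 * K)) :=
    (Continuous.tendsto (by fun_prop) 0).mono_left nhdsWithin_le_nhds
  rw [zero_mul] at h1
  exact ge_of_tendsto h1 (by
    filter_upwards [Ioo_mem_nhdsGT one_pos] with e he using h e he.1 he.2)

lemma HasDerivAt.exists_norm_sub_le {F : Type*} [NormedAddCommGroup F] [NormedSpace ℝ F]
    {φ : ℝ → F} {φ' : F} {s e : ℝ} (h : HasDerivAt φ φ' s) (he : 0 < e) :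
    ∃ d > 0, ∀ r, 0 < r → r < d → ‖φ (s - r) - φ s + r • φ'‖ ≤ e * r := by
  obtain ⟨d, hd, H⟩ := Metric.eventually_nhds_iff.1 ((hasDerivAt_iff_isLittleO.1 h).def he)
  refine ⟨d, hd, fun r hr hrd => ?_⟩
  have := H (y := s - r) (by simpa [Real.dist_eq, abs_of_pos hr] using hrd)
  simpa [abs_of_pos hr] using this

namespace Problem

variable {ε T C : ℝ} {f : E3 → ℝ → ℝ} {g : E3 → ℝ} {t s : ℝ} {x : E3}

/-- Minimality among admissible pairs is restated as attaining the infimum; only one inequality is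
kept since the other always holds. -/
lemma isOptimalPair_iff (S : Problem ε T C f g) (ht : t ∈ Icc 0 T) {y α : ℝ → E3} :
    IsOptimalPair ε T f g x t y α ↔
      Traj ε t T y α ∧ y t = x ∧ runCost f t T y α + g (y T) ≤ value ε T f g x t := by
  rw [IsOptimalPair, admissible_iff_traj S.hε ht.2, and_assoc]
  refine and_congr_right fun h => and_congr_right fun h0 => ⟨fun H => ?_, fun H z β hz => ?_⟩
  · refine le_csInf ⟨_, _, _, h, h0, rfl⟩ ?_
    rintro _ ⟨z, β, hz, hz0, rfl⟩
    exact H z β ((admissible_iff_traj S.hε ht.2).2 ⟨hz, hz0⟩)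
  · obtain ⟨hz, hz0⟩ := (admissible_iff_traj S.hε ht.2).1 hz
    have := S.value_le ht hz
    rw [hz0] at this
    exact H.trans this

lemma norm_spaceGradient_value_le (S : Problem ε T C f g) (ht : t ∈ Icc 0 T) (x : E3) :
    ‖spaceGradient (value ε T f g) x t‖ ≤ S.lipBound := by
  rw [spaceGradient, norm_gradient]
  exact norm_fderiv_le_of_lip' ℝ S.lipBound_nonneg
    (Eventually.of_forall fun y => S.abs_value_sub_le ht y x)

/-- Decrease of the value function along a feedback trajectory. -/
lemma deriv_value_le_of_feedback (S : Problem ε T C f g) {γ : ℝ → E3} {d M : ℝ} {a : E3}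
    (ht : 0 ≤ t) (hs : s ∈ Ioo t T) (hM : ∀ r ∈ Icc t T, ‖γ r‖ ≤ M)
    (hdiff : DifferentiableAt ℝ (fun y => value ε T f g y s) (γ s))
    (ha : a = -rowMul (spaceGradient (value ε T f g) (γ s) s) (B ε (γ s)))
    (hγ : HasDerivAt γ (mulCol (B ε (γ s)) a) s)
    (hd : HasDerivAt (fun r => value ε T f g (γ r) r) d s) :
    d ≤ -(‖a‖ ^ 2 / 2 + f (γ s) s) := by
  have hM0 : 0 ≤ M := (norm_nonneg _).trans (hM s ⟨hs.1.le, hs.2.le⟩)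
  obtain ⟨K, hK, H⟩ := S.exists_expansion_below hM0
  have hC := S.hC
  set x := γ s with hx
  set P := spaceGradient (value ε T f g) x s with hP
  set V₀ := ‖mulCol (B ε x) a‖ + 1 with hV₀
  set K₁ := 1 + K + K * V₀
  set K₂ := K₁ + (1 + ‖x‖) * (K + ‖a‖)
  have hs0 : 0 ≤ s := ht.trans hs.1.le
  have hsT : s ∈ Icc 0 T := ⟨hs0, hs.2.le⟩
  have hV₀0 : 0 ≤ V₀ := by positivity
  have hK₁ : 0 ≤ K₁ := by positivity
  have hK₂ : 0 ≤ K₂ := by positivity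
  suffices X : d + (‖a‖ ^ 2 / 2 + f x s) ≤ 0 by linarith
  refine nonpos_of_forall_lt_one_le_mul
    (K := 2 + K + C * V₀ + ‖P‖ * K₁ + K₂) fun e he he1 => ?_
  obtain ⟨d₁, hd₁, H₁⟩ := HasDerivAt.exists_norm_sub_le hγ he
  obtain ⟨d₂, hd₂, H₂⟩ := HasDerivAt.exists_norm_sub_le hd he
  obtain ⟨d₃, hd₃, H₃⟩ := Metric.eventually_nhds_iff.1
    ((hasGradientAt_iff_isLittleO.1 hdiff.hasGradientAt).def he)
  obtain ⟨d₄, hd₄, H₄⟩ := S.exists_integral_le x hsT he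
  have hd₃' : 0 < d₃ / (K₂ + 1) := by positivity
  obtain ⟨r, hr0, hr⟩ := exists_between
    (lt_min (lt_min (lt_min hd₁ hd₂) (lt_min hd₃' hd₄)) (lt_min he (sub_pos.2 hs.1)))
  simp only [lt_min_iff] at hr
  obtain ⟨⟨⟨hr1, hr2⟩, hr3, hr4⟩, hre, hrt⟩ := hr
  have g1 := H₁ r hr0 hr1
  have g2 := H₂ r hr0 hr2
  set ξ := γ (s - r) with hξ
  have hξM : ‖ξ‖ ≤ M := hM _ ⟨by linarith, by linarith [hs.2]⟩
  -- The expansion starts at the earlier point γ(s - r) and ends at time s, the time at which V is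
  -- known to be differentiable at γ(s).
  obtain ⟨v, ζ, b1, b2, b3⟩ := H ξ hξM (s - r) s (by linarith) (by linarith) hs.2.le
  rw [sub_sub_cancel] at b2 b3
  have hξx : ‖ξ - x‖ ≤ V₀ * r := by
    have e1 : ξ - x = (ξ - x + r • mulCol (B ε x) a) - r • mulCol (B ε x) a := by abel
    rw [e1]
    refine (norm_sub_le _ _).trans ?_
    rw [norm_smul, Real.norm_of_nonneg hr0.le]
    have : e * r ≤ 1 * r := by gcongr
    rw [hV₀]
    linarith
  -- Going back along γ subtracts r B a and going forward with v adds r B v, so ζ - x equals r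
  -- B(x)(v - a) up to an error of order e r.
  set ρ := ζ - x - r • mulCol (B ε x) (v - a) with hρ
  have hρn : ‖ρ‖ ≤ K₁ * (e * r) := by
    have e1 : ρ = (ζ - ξ - r • mulCol (B ε ξ) v) + (ξ - x + r • mulCol (B ε x) a) +
        r • (mulCol (B ε ξ) v - mulCol (B ε x) v) := by
      rw [hρ, mulCol_sub]; simp only [smul_sub]; abel
    rw [e1]
    refine (norm_add_le _ _).trans ?_
    have n1 := norm_add_le (ζ - ξ - r • mulCol (B ε ξ) v) (ξ - x + r • mulCol (B ε x) a)
    have n2 : ‖r • (mulCol (B ε ξ) v - mulCol (B ε x) v)‖ ≤ r * ((V₀ * e) * K) := by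
      rw [norm_smul, Real.norm_of_nonneg hr0.le]
      gcongr
      refine (norm_mulCol_B_sub_le _ _ _ _).trans ?_
      have : ‖ξ - x‖ ≤ V₀ * e := hξx.trans (by gcongr)
      gcongr
    have n3 : K * r ^ 2 ≤ K * (e * r) := by rw [sq]; gcongr
    have : K₁ * (e * r) = K * (e * r) + e * r + r * ((V₀ * e) * K) := by ring
    linarith
  have hζx : ‖ζ - x‖ ≤ K₂ * r := by
    have e1 : ζ - x = ρ + r • mulCol (B ε x) (v - a) := by rw [hρ]; abel
    rw [e1]
    refine (norm_add_le _ _).trans ?_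
    have n1 : ‖r • mulCol (B ε x) (v - a)‖ ≤ r * ((1 + ‖x‖) * (K + ‖a‖)) := by
      rw [norm_smul, Real.norm_of_nonneg hr0.le]
      gcongr
      refine (norm_mulCol_B_le S.hε _ _).trans ?_
      gcongr
      exact (norm_sub_le _ _).trans (by gcongr)
    have n2 : K₁ * (e * r) ≤ K₁ * (1 * r) := by gcongr
    have : K₂ * r = K₁ * (1 * r) + r * ((1 + ‖x‖) * (K + ‖a‖)) := by ring
    linarith
  have g3 : -(e * (K₂ * r)) ≤ value ε T f g ζ s - value ε T f g x s - inner ℝ P (ζ - x) := by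
    have := H₃ (y := ζ) (by
      rw [dist_eq_norm]
      rw [lt_div_iff₀ (by positivity)] at hr3
      refine hζx.trans_lt ?_
      linarith)
    rw [Real.norm_eq_abs] at this
    have h2 : e * ‖ζ - x‖ ≤ e * (K₂ * r) := by gcongr
    exact (neg_le_neg h2).trans (abs_le.1 this).1
  have g4 : r * inner ℝ (-a) (v - a) - ‖P‖ * (K₁ * (e * r)) ≤ inner ℝ P (ζ - x) := by
    have e1 : ζ - x = ρ + r • mulCol (B ε x) (v - a) := by rw [hρ]; abel
    have e2 : rowMul P (B ε x) = -a := by rw [ha, neg_neg]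
    rw [e1, inner_add_right, real_inner_smul_right, inner_mulCol, e2]
    have := (abs_le.1 (abs_real_inner_le_norm P ρ)).1
    have h2 : ‖P‖ * ‖ρ‖ ≤ ‖P‖ * (K₁ * (e * r)) := by gcongr
    linarith
  -- The difference of the two sides is |v - a|²/2: the feedback control is optimal for the
  -- linearized problem, so the unknown v can be discarded.
  have g5 : ‖a‖ ^ 2 / 2 ≤ ‖v‖ ^ 2 / 2 + inner ℝ (-a) (v - a) := by
    rw [inner_neg_left, inner_sub_right, real_inner_self_eq_norm_sq]
    have := norm_sub_sq_real a v
    nlinarith [sq_nonneg ‖a - v‖]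
  have g6 : r * f x s - e * r - C * (V₀ * e) * r ≤ ∫ q in (s - r)..s, f ξ q := by
    have h1 := (abs_le.1 (H₄ (s - r) s ⟨by linarith, by linarith [hs.2]⟩ hsT (by linarith)
      (by simpa [abs_of_pos hr0] using hr4) (by simpa using hd₄))).1
    rw [sub_sub_cancel] at h1
    have hab : s - r ≤ s := by linarith
    have i1 := S.intervalIntegrable_along (y := fun _ => x) (by linarith : 0 ≤ s - r) hab hs.2.le
      continuousOn_const
    have i2 := S.intervalIntegrable_along (y := fun _ => ξ) (by linarith : 0 ≤ s - r) hab hs.2.le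
      continuousOn_const
    have h2 := intervalIntegral.integral_mono_on hab i1
      (i2.add (intervalIntegrable_const (c := C * (V₀ * e)))) fun q hq => by
        have h3 := (abs_le.1 ((S.f_bound q ⟨by linarith [hq.1], hq.2.trans hs.2.le⟩).lip x ξ)).2
        have h4 : ‖x - ξ‖ ≤ V₀ * e := by
          rw [norm_sub_rev]; exact hξx.trans (by gcongr)
        have h5 := mul_le_mul_of_nonneg_left h4 hC
        show f x q ≤ f ξ q + C * (V₀ * e)
        linarith
    rw [intervalIntegral.integral_add i2 (by simp), intervalIntegral.integral_const,
      smul_eq_mul, sub_sub_cancel] at h2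
    linarith
  have g7 := (abs_le.1 (by rwa [Real.norm_eq_abs, smul_eq_mul] at g2)).2
  have g8 : K * r ^ 2 ≤ K * (e * r) := by rw [sq]; gcongr
  have g9 := mul_le_mul_of_nonneg_left g5 hr0.le
  have : r * (d + (‖a‖ ^ 2 / 2 + f x s)) ≤ r * (e * (2 + K + C * V₀ + ‖P‖ * K₁ + K₂)) := by
    linarith only [b3, g3, g4, g6, g7, g8, g9]
  exact le_of_mul_le_mul_left this hr0

/-- Feedback trajectories are optimal. -/
theorem isOptimalPair_of_feedback (S : Problem ε T C f g) {u : E3 → ℝ → ℝ}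
    (hu : ∀ x, ∀ t ∈ Icc 0 T, u x t = value ε T f g x t) (ht : t ∈ Icc 0 T) {γ : ℝ → E3}
    (hγ : IsFeedbackSolution ε T u x t γ) :
    IsOptimalPair ε T f g x t γ (feedback ε u γ) := by
  set α := feedback ε u γ with hα
  have hslice : ∀ s ∈ Icc 0 T, (fun y => u y s) = fun y => value ε T f g y s := fun s hs => by
    ext y; exact hu y s hs
  have hgrad : ∀ s ∈ Icc 0 T, ∀ y, spaceGradient u y s = spaceGradient (value ε T f g) y s :=
    fun s hs y => by rw [spaceGradient, hslice s hs, spaceGradient]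
  have hsub : ∀ s ∈ Icc t T, s ∈ Icc 0 T := fun s hs => ⟨ht.1.trans hs.1, hs.2⟩
  have hcont : ContinuousOn γ (Icc t T) := by
    have := hγ.ac.continuousOn
    rwa [uIcc_of_le ht.2] at this
  obtain ⟨M, hM⟩ := isCompact_Icc.exists_bound_of_continuousOn hcont
  have hM0 : 0 ≤ M := (norm_nonneg _).trans (hM t ⟨le_rfl, ht.2⟩)
  set A := (1 + M) * S.lipBound
  have hL := S.lipBound_nonneg
  have hA : 0 ≤ A := by positivity
  have hαb : ∀ s ∈ Icc t T, ‖α s‖ ≤ A := fun s hs => by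
    rw [hα, feedback, norm_neg, hgrad s (hsub s hs)]
    refine (norm_rowMul_B_le S.hε _ _).trans ?_
    have := hM s hs
    have := S.norm_spaceGradient_value_le (hsub s hs) (γ s)
    show _ ≤ (1 + M) * S.lipBound
    gcongr
  have hode : ∀ᵐ s ∂(volume.restrict (Ioo t T)), HasDerivAt γ (mulCol (B ε (γ s)) (α s)) s := by
    filter_upwards [hγ.ode] with s hs
    rwa [rowMul_transpose, ← mulCol_neg] at hs
  -- measurability of the feedback control
  have hmeas : AEStronglyMeasurable α (volume.restrict (Ioc t T)) := by
    -- Measurability is not sought through the gradient of u: the control is recovered from the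
    -- velocity of γ, which is measurable, by solving γ' = B(γ)α. For ε = 0 the third component of
    -- the feedback is zero, consistent with the convention that the inverse of 0 is 0.
    set Ψ : E3 × E3 → E3 := fun q =>
      !₂[q.2 0, q.2 1, ε⁻¹ * (q.2 2 + q.1 1 * q.2 0 - q.1 0 * q.2 1)]
    have hΨ : Continuous Ψ := by
      refine (PiLp.continuous_toLp 2 _).comp (continuous_pi fun i => ?_)
      fin_cases i <;> simp <;> fun_prop
    have h1 : AEStronglyMeasurable (fun s => Ψ (γ s, deriv γ s)) (volume.restrict (Ioc t T)) :=
      hΨ.comp_aestronglyMeasurable ((aestronglyMeasurable_of_continuousOn hcont).prodMk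
        (stronglyMeasurable_deriv γ).aestronglyMeasurable)
    refine h1.congr ?_
    rw [← Measure.restrict_congr_set (Ioo_ae_eq_Ioc (a := t) (b := T))]
    filter_upwards [hode] with s hs
    have h2 : α s 2 = -(ε * spaceGradient u (γ s) s 2) := by
      rw [hα, feedback, rowMul_B]; simp
    rw [hs.deriv, mulCol_B]
    ext i
    fin_cases i
    · simp [Ψ]
    · simp [Ψ]
    · simp only [Ψ, Fin.reduceFinMk, Matrix.cons_val]
      rcases eq_or_ne ε 0 with h0 | h0
      · rw [h2, h0]; simp
      · field_simp; ring
  have hctrl : Control t T α := Control.of_bound hmeas A (by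
    rw [ae_restrict_iff' measurableSet_Ioc]
    exact ae_of_all _ fun s hs => hαb s (Ioc_subset_Icc_self hs))
  have hadm : Admissible ε T x t γ α :=
    ⟨hγ.ac, by rw [← Measure.restrict_congr_set Ioc_ae_eq_Icc]; exact hctrl, hγ.init, hode⟩
  obtain ⟨hT, h0⟩ := (admissible_iff_traj S.hε ht.2).1 hadm
  rw [S.isOptimalPair_iff ht]
  refine ⟨hT, h0, ?_⟩
  -- the value along the trajectory is Lipschitz
  obtain ⟨K, hK, HK⟩ := S.exists_lip_time hM0
  have hγlip : ∀ r ∈ Icc t T, ∀ s ∈ Icc t T, r ≤ s → ‖γ s - γ r‖ ≤ (1 + M) * A * (s - r) := by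
    intro r hr s hs hrs
    rw [hT.eq_from S.hε hr.1 hrs hs.2, add_sub_cancel_left]
    have := intervalIntegral.norm_integral_le_of_norm_le_const (a := r) (b := s)
      (C := (1 + M) * A) (f := fun q => mulCol (B ε (γ q)) (α q)) fun q hq => by
        rw [uIoc_of_le hrs] at hq
        have hq' : q ∈ Icc t T := ⟨hr.1.trans hq.1.le, hq.2.trans hs.2⟩
        refine (norm_mulCol_B_le S.hε _ _).trans ?_
        have := hM q hq'
        have := hαb q hq'
        gcongr
    rwa [abs_of_nonneg (sub_nonneg.2 hrs)] at this
  have hac : AbsolutelyContinuousOnInterval (fun s => value ε T f g (γ s) s) t T := by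
    refine absolutelyContinuous_of_dist_le (f := fun s => s)
      (K := S.lipBound * ((1 + M) * A) + K) (by positivity)
      (LipschitzOnWith.absolutelyContinuousOnInterval (K := 1)
        (LipschitzWith.id.lipschitzOnWith)) ?_
    intro s hs r hr
    rw [uIcc_of_le ht.2] at hs hr
    rw [Real.dist_eq, Real.dist_eq]
    have h1 := S.abs_value_sub_le (hsub s hs) (γ s) (γ r)
    have h2 := HK (γ r) (hM r hr) s (hsub s hs) r (hsub r hr)
    have h3 : ‖γ s - γ r‖ ≤ (1 + M) * A * |s - r| := by
      rcases le_total r s with h | h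
      · rw [abs_of_nonneg (sub_nonneg.2 h)]; exact hγlip r hr s hs h
      · rw [norm_sub_rev, abs_sub_comm, abs_of_nonneg (sub_nonneg.2 h)]; exact hγlip s hs r hr h
    have h4 : S.lipBound * ‖γ s - γ r‖ ≤ S.lipBound * ((1 + M) * A * |s - r|) := by gcongr
    have h5 := abs_sub_le (value ε T f g (γ s) s) (value ε T f g (γ r) s)
      (value ε T f g (γ r) r)
    linarith
  -- Integrating the derivative bound from t to T and using the terminal condition shows that the
  -- cost of γ is at most V(x, t).
  have key := le_of_absolutelyContinuous_of_deriv_le ht.2 hac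
    (S.intervalIntegrable_run ht.1 ht.2 le_rfl hT).neg (by
      have hd := hγ.differentiable
      rw [ae_restrict_iff' measurableSet_Ioo] at hd hode ⊢
      filter_upwards [hd, hode] with s h1 h2 hs d hd
      have hs' := hsub s (Ioo_subset_Icc_self hs)
      have h3 := h1 hs
      rw [hslice s hs'] at h3
      exact S.deriv_value_le_of_feedback ht.1 hs hM h3
        (by rw [hα, feedback, hgrad s hs']) (h2 hs) hd)
  rw [S.value_terminal, h0] at key
  simp only [Pi.neg_apply, intervalIntegral.integral_neg] at key
  rw [runCost]
  linarith

end Problem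

/-! ### The adjoint curve and the second order expansion of the cost -/

/-- Horizontal rotation. -/
def rot (a : E3) : E3 := !₂[a 1, -a 0, 0]

lemma norm_rot_le (a : E3) : ‖rot a‖ ≤ ‖a‖ := by
  refine abs_le_of_sq_le_sq' ?_ (norm_nonneg _) |>.2
  rw [norm_sq_E3, norm_sq_E3, rot]
  simp only [Matrix.cons_val]
  nlinarith [sq_nonneg (a 2)]

lemma rot_sub (a b : E3) : rot (a - b) = rot a - rot b := by
  ext i
  fin_cases i <;> simp [rot]
  ring

/-- Identifies the transpose of the state derivative of y ↦ B(y)a, and hence the term `p 2 • rot α`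
in the adjoint equation. -/
lemma inner_vert (p w a : E3) : inner ℝ p (vert w a) = p 2 * inner ℝ (rot a) w := by
  simp [vert, rot, PiLp.inner_apply, Fin.sum_univ_three]
  ring

lemma vert_sub_right (w a b : E3) : vert w (a - b) = vert w a - vert w b := by
  ext i
  fin_cases i <;> simp [vert]
  ring

lemma abs_coord_le (p : E3) (i : Fin 3) : |p i| ≤ ‖p‖ := PiLp.norm_apply_le p i

lemma continuous_smul_rot : Continuous fun q : E3 × E3 => q.1 2 • rot q.2 := by
  simp only [rot]
  refine Continuous.smul ((EuclideanSpace.proj (𝕜 := ℝ) 2).continuous.comp continuous_fst) ((PiLp.continuous_toLp 2 _).comp (continuous_pi fun i => ?_))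
  fin_cases i <;> simp <;> fun_prop

lemma norm_smul_rot_le (p a : E3) : ‖p 2 • rot a‖ ≤ ‖p‖ * ‖a‖ := by
  rw [norm_smul]
  exact mul_le_mul (abs_coord_le p 2) (norm_rot_le a) (norm_nonneg _) (norm_nonneg _)

namespace Control

variable {a b : ℝ} {α β y : ℝ → E3}

lemma of_continuousOn (h : ContinuousOn y (Icc a b)) : Control a b y := by
  obtain ⟨M, hM⟩ := isCompact_Icc.exists_bound_of_continuousOn h
  refine of_bound (aestronglyMeasurable_of_continuousOn h) M ?_
  rw [ae_restrict_iff' measurableSet_Ioc]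
  exact ae_of_all _ fun s hs => hM s (Ioc_subset_Icc_self hs)

lemma smul_rot (hy : ContinuousOn y (Icc a b)) (hα : Control a b α) :
    Control a b (fun r => y r 2 • rot (α r)) :=
  control_comp continuous_smul_rot
    (fun p q => (norm_smul_rot_le p q).trans (by nlinarith [norm_nonneg p, norm_nonneg q])) hy hα

lemma energy_add_le (h : Control a b α) (h' : Control a b β) (hab : a ≤ b) :
    energy a b (fun s => α s + β s) ≤ 2 * energy a b α + 2 * energy a b β := by
  have i1 := (h.intervalIntegrable_sq hab).const_mul 2
  have i2 := (h'.intervalIntegrable_sq hab).const_mul 2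
  rw [energy, energy, energy, ← intervalIntegral.integral_const_mul,
    ← intervalIntegral.integral_const_mul, ← intervalIntegral.integral_add i1 i2]
  refine intervalIntegral.integral_mono_on hab ((h.add h').intervalIntegrable_sq hab) (i1.add i2)
    fun s _ => ?_
  have := norm_add_le (α s) (β s)
  nlinarith [sq_nonneg (‖α s‖ - ‖β s‖), norm_nonneg (α s + β s)]

lemma energy_sub_le (h : Control a b α) (h' : Control a b β) (hab : a ≤ b) :
    energy a b (fun s => α s - β s) ≤ 2 * energy a b α + 2 * energy a b β := by
  have := h.energy_add_le (h'.neg) hab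
  simpa [energy, sub_eq_add_neg] using this

lemma energy_le_of_bound {M : ℝ} (h : Control a b α) (hab : a ≤ b)
    (hM : ∀ s ∈ Icc a b, ‖α s‖ ≤ M) : energy a b α ≤ M ^ 2 * (b - a) := by
  have := intervalIntegral.integral_mono_on hab (h.intervalIntegrable_sq hab)
    (intervalIntegrable_const (c := M ^ 2)) fun s hs => by
      have := hM s hs
      show ‖α s‖ ^ 2 ≤ M ^ 2
      gcongr
  rw [intervalIntegral.integral_const, smul_eq_mul] at this
  rw [energy]; linarith

end Control

/-- `p` is the adjoint curve of the trajectory `y` with control `α` on `[t, T]`. -/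
structure Adjoint (T : ℝ) (f : E3 → ℝ → ℝ) (g : E3 → ℝ) (t : ℝ) (y α p : ℝ → E3) : Prop where
  terminal : p T = gradient g (y T)
  cont : ContinuousOn p (Icc t T)
  eq : ∀ s ∈ Icc t T,
    p s = p t + ∫ r in t..s, -(spaceGradient f (y r) r + p r 2 • rot (α r))

namespace Problem

variable {ε T C : ℝ} {f : E3 → ℝ → ℝ} {g : E3 → ℝ} {y α z β p q : ℝ → E3} {a b c t s : ℝ} {x : E3}

lemma control_adjoint (S : Problem ε T C f g) (ht : 0 ≤ t) (hy : ContinuousOn y (Icc t T))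
    (hα : Control t T α) (hp : ContinuousOn p (Icc t T)) :
    Control t T (fun r => -(spaceGradient f (y r) r + p r 2 • rot (α r))) :=
  ((Control.of_continuousOn (S.continuousOn_grad_along ht le_rfl hy)).add
    (Control.smul_rot hp hα)).neg

/-- `rot` has no third component, so the third adjoint coordinate is found by integrating the
gradient of f alone; once it is known, the other two are primitives. The linear backward equation is
thus solved explicitly. -/
lemma exists_adjoint (S : Problem ε T C f g) (ht : t ∈ Icc 0 T) (h : Traj ε t T y α) :
    ∃ p, Adjoint T f g t y α p := by
  have i0 := (Control.of_continuousOn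
    (S.continuousOn_grad_along ht.1 le_rfl h.cont)).intervalIntegrable ht.2
  set h₀ : ℝ → E3 := fun s => gradient g (y T) - ∫ r in T..s, spaceGradient f (y r) r with hh₀
  have acT : ∀ {φ : ℝ → E3}, IntervalIntegrable φ volume t T →
      ContinuousOn (fun s => ∫ r in T..s, φ r) (Icc t T) := fun {φ} hφ => by
    have := (absolutelyContinuous_integral hφ.symm).continuousOn
    rwa [uIcc_comm, uIcc_of_le ht.2] at this
  have hc : ContinuousOn h₀ (Icc t T) := continuousOn_const.sub (acT i0)
  have i1 := (Control.smul_rot hc h.control).intervalIntegrable ht.2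
  set p : ℝ → E3 := fun s => h₀ s - ∫ r in T..s, h₀ r 2 • rot (α r) with hp
  have hp2 : ∀ s ∈ Icc t T, p s 2 = h₀ s 2 := fun s hs => by
    have his : IntervalIntegrable (fun r => h₀ r 2 • rot (α r)) volume T s :=
      i1.symm.mono_set (by
        rw [uIcc_comm T s, uIcc_comm T t, uIcc_of_le hs.2, uIcc_of_le ht.2]
        exact Icc_subset_Icc_left hs.1)
    have : (∫ r in T..s, h₀ r 2 • rot (α r)) 2 = ∫ r in T..s, (h₀ r 2 • rot (α r)) 2 :=
      ((EuclideanSpace.proj 2 : E3 →L[ℝ] ℝ).intervalIntegral_comp_comm his).symm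
    have h0 : (∫ r in T..s, h₀ r 2 • rot (α r)) 2 = 0 := by rw [this]; simp [rot]
    rw [hp]
    show (h₀ s) 2 - (∫ r in T..s, h₀ r 2 • rot (α r)) 2 = h₀ s 2
    rw [h0, sub_zero]
  refine ⟨p, by simp [hp, hh₀], hc.sub (acT i1), fun s hs => ?_⟩
  have hsub : uIcc t s ⊆ uIcc t T := by
    rw [uIcc_of_le hs.1, uIcc_of_le ht.2]; exact Icc_subset_Icc_right hs.2
  have e1 : ∫ r in t..s, -(spaceGradient f (y r) r + p r 2 • rot (α r)) =
      -((∫ r in t..s, spaceGradient f (y r) r) + ∫ r in t..s, h₀ r 2 • rot (α r)) := by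
    rw [← intervalIntegral.integral_add (i0.mono_set hsub) (i1.mono_set hsub),
      ← intervalIntegral.integral_neg]
    refine intervalIntegral.integral_congr fun r hr => ?_
    rw [uIcc_of_le hs.1] at hr
    simp only [hp2 r ⟨hr.1, hr.2.trans hs.2⟩]
  have e2 := intervalIntegral.integral_add_adjacent_intervals i0.symm (i0.mono_set hsub)
  have e3 := intervalIntegral.integral_add_adjacent_intervals i1.symm (i1.mono_set hsub)
  rw [e1]
  simp only [hp, hh₀] at e3 ⊢
  rw [← e2, ← e3]
  abel

lemma _root_.HeisenbergControl.Adjoint.mono (S : Problem ε T C f g) (ht : 0 ≤ t)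
    (h : Traj ε t T y α) (hp : Adjoint T f g t y α p) (hs : s ∈ Icc t T) :
    Adjoint T f g s y α p where
  terminal := hp.terminal
  cont := hp.cont.mono (Icc_subset_Icc_left hs.1)
  eq r hr := by
    have hi := (S.control_adjoint ht h.cont h.control hp.cont).intervalIntegrable (hs.1.trans hs.2)
    have htT := hs.1.trans hs.2
    rw [hp.eq r ⟨hs.1.trans hr.1, hr.2⟩, hp.eq s hs, add_assoc,
      intervalIntegral.integral_add_adjacent_intervals]
    · exact hi.mono_set (by
        rw [uIcc_of_le hs.1, uIcc_of_le htT]; exact Icc_subset_Icc_right hs.2)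
    · exact hi.mono_set (by rw [uIcc_of_le hr.1, uIcc_of_le htT]; exact Icc_subset_Icc hs.1 hr.2)

/-- A bound for adjoint curves. -/
lemma norm_adjoint_le (S : Problem ε T C f g) (ht : t ∈ Icc 0 T) (h : Traj ε t T y α)
    (hp : Adjoint T f g t y α p) {Λ : ℝ} (hΛ : ∫ s in t..T, ‖α s‖ ≤ Λ) :
    ∀ s ∈ Icc t T, ‖p s‖ ≤ C * (1 + T) * (1 + Λ) := by
  have hC := S.hC
  have hT := S.hT
  have back : ∀ s ∈ Icc t T,
      p s = gradient g (y T) + ∫ r in s..T, (spaceGradient f (y r) r + p r 2 • rot (α r)) := by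
    intro s hs
    have := (Adjoint.mono S ht.1 h hp hs).eq T ⟨hs.2, le_rfl⟩
    rw [hp.terminal, intervalIntegral.integral_neg] at this
    rw [this]; abel
  have hgf : ∀ s ∈ Icc t T, ‖spaceGradient f (y s) s‖ ≤ C := fun s hs =>
    (S.f_bound s ⟨ht.1.trans hs.1, hs.2⟩).grad_le _
  have hcg := Control.of_continuousOn (S.continuousOn_grad_along ht.1 le_rfl h.cont)
  have hcr := Control.smul_rot hp.cont h.control
  -- The third coordinate does not see the control and is bounded first. The rotation term is then
  -- at most this bound times |α|, so no Gronwall argument is needed.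
  have h2 : ∀ s ∈ Icc t T, |p s 2| ≤ C * (1 + T) := by
    intro s hs
    have hi := ((hcg.add hcr).mono hs.1 le_rfl).intervalIntegrable hs.2
    have e : (∫ r in s..T, (spaceGradient f (y r) r + p r 2 • rot (α r))) 2 =
        ∫ r in s..T, (spaceGradient f (y r) r + p r 2 • rot (α r)) 2 :=
      ((EuclideanSpace.proj 2 : E3 →L[ℝ] ℝ).intervalIntegral_comp_comm hi).symm
    have e1 : p s 2 = gradient g (y T) 2 + ∫ r in s..T, (spaceGradient f (y r) r) 2 := by
      rw [back s hs, PiLp.add_apply, e]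
      simp [rot]
    rw [e1]
    have b1 := (abs_coord_le (gradient g (y T)) 2).trans (S.g_bound.grad_le _)
    have b2 := intervalIntegral.norm_integral_le_of_norm_le_const (a := s) (b := T) (C := C)
      (f := fun r => (spaceGradient f (y r) r) 2) fun r hr => by
        rw [uIoc_of_le hs.2] at hr
        exact (abs_coord_le _ 2).trans (hgf r ⟨hs.1.trans hr.1.le, hr.2⟩)
    rw [Real.norm_eq_abs, abs_of_nonneg (sub_nonneg.2 hs.2)] at b2
    have b3 : C * (T - s) ≤ C * T := by gcongr; linarith [ht.1, hs.1]
    refine (abs_add_le _ _).trans ?_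
    linarith
  intro s hs
  rw [back s hs]
  have hi := ((hcg.add hcr).mono hs.1 le_rfl).intervalIntegrable hs.2
  have hα := (h.control.mono hs.1 le_rfl).intervalIntegrable hs.2
  have b1 : ‖∫ r in s..T, (spaceGradient f (y r) r + p r 2 • rot (α r))‖ ≤
      C * T + C * (1 + T) * Λ := by
    refine (intervalIntegral.norm_integral_le_integral_norm hs.2).trans ?_
    have := intervalIntegral.integral_mono_on hs.2 hi.norm
      ((intervalIntegrable_const (c := C)).add (hα.norm.const_mul (C * (1 + T)))) fun r hr => by
        refine (norm_add_le _ _).trans (add_le_add (hgf r ⟨hs.1.trans hr.1, hr.2⟩) ?_)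
        rw [norm_smul]
        exact mul_le_mul (h2 r ⟨hs.1.trans hr.1, hr.2⟩) (norm_rot_le _) (norm_nonneg _)
          (by positivity)
    rw [intervalIntegral.integral_add (by simp) (hα.norm.const_mul _),
      intervalIntegral.integral_const, intervalIntegral.integral_const_mul, smul_eq_mul] at this
    refine this.trans ?_
    have b3 : (T - s) * C ≤ T * C := by gcongr; linarith [ht.1, hs.1]
    have b4 : ∫ r in s..T, ‖α r‖ ≤ Λ :=
      (integral_mono_interval_of_nonneg hs.1 hs.2 le_rfl (h.control.intervalIntegrable ht.2).norm
        fun _ => norm_nonneg _).trans hΛ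
    have b5 : C * (1 + T) * ∫ r in s..T, ‖α r‖ ≤ C * (1 + T) * Λ := by gcongr
    linarith
  refine (norm_add_le _ _).trans ?_
  have := S.g_bound.grad_le (y T)
  linarith

/-- Bounds valid along trajectories starting in a ball with controls of bounded energy. -/
lemma exists_traj_bounds (S : Problem ε T C f g) {X E : ℝ} (hX : 0 ≤ X) :
    ∃ N, 1 ≤ N ∧ ∀ t ∈ Icc 0 T, ∀ y α, Traj ε t T y α → ‖y t‖ ≤ X → energy t T α ≤ E →
      (∀ s ∈ Icc t T, 1 + ‖y s‖ ≤ N) ∧ ∫ s in t..T, ‖α s‖ ≤ N ∧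
      ∀ p, Adjoint T f g t y α p → ∀ s ∈ Icc t T, ‖p s‖ ≤ N := by
  have hC := S.hC
  have hT := S.hT
  set Λ := √(T * E)
  have hΛ : 0 ≤ Λ := Real.sqrt_nonneg _
  have hexp := Real.exp_pos Λ
  have n1 : 0 ≤ (1 + X) * Real.exp Λ := by positivity
  have n2 : 0 ≤ C * (1 + T) * (1 + Λ) := by positivity
  refine ⟨1 + (1 + X) * Real.exp Λ + Λ + C * (1 + T) * (1 + Λ), by linarith,
    fun t ht y α h hy hE => ?_⟩
  have hI := S.integral_norm_le ht.1 ht.2 le_rfl h.control hE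
  refine ⟨fun s hs => ?_, by linarith, fun p hp s hs => ?_⟩
  · have h1 := h.one_add_norm_le S.hε ht.2 s hs
    have h2 : (1 + ‖y t‖) * Real.exp (∫ r in t..T, ‖α r‖) ≤ (1 + X) * Real.exp Λ := by gcongr
    linarith
  · linarith [S.norm_adjoint_le ht h hp hI s hs]

lemma sq_integral_norm_le (_ : Problem ε T C f g) (ht : t ∈ Icc 0 T) (h : Control t T α) :
    (∫ s in t..T, ‖α s‖) ^ 2 ≤ T * energy t T α := by
  refine (sq_integral_le ht.2 (h.intervalIntegrable ht.2).norm
    (h.intervalIntegrable_sq ht.2)).trans ?_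
  have := energy_nonneg ht.2 α
  rw [← energy]
  gcongr
  linarith [ht.1]

/-- Second order expansion of the cost with respect to the initial point and the control. -/
lemma exists_cost_expansion (S : Problem ε T C f g) {X E : ℝ} (hX : 0 ≤ X) :
    ∃ K, 0 ≤ K ∧ ∀ t ∈ Icc 0 T, ∀ y α z β p, Traj ε t T y α → Traj ε t T z β →
      Adjoint T f g t y α p → ‖y t‖ ≤ X → ‖z t‖ ≤ X → energy t T α ≤ E → energy t T β ≤ E →
      runCost f t T z β + g (z T) ≤ runCost f t T y α + g (y T) + inner ℝ (p t) (z t - y t) +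
        (∫ s in t..T, inner ℝ (α s + rowMul (p s) (B ε (y s))) (β s - α s)) +
        K * (‖z t - y t‖ ^ 2 + energy t T (fun s => β s - α s)) := by
  obtain ⟨N, hN, HN⟩ := S.exists_traj_bounds (E := E) hX
  have hC := S.hC
  have hT := S.hT
  set K₁ := 2 * (1 + N ^ 2 * T) * Real.exp N ^ 2 with hK₁
  have hK₁0 : 0 ≤ K₁ := by positivity
  refine ⟨1 + C * (T + 1) * K₁ + N * (K₁ + T), by positivity,
    fun t ht y α z β p hy hz hp hyX hzX hα hβ => ?_⟩
  obtain ⟨by1, by2, by3⟩ := HN t ht y α hy hyX hα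
  obtain ⟨bz1, bz2, -⟩ := HN t ht z β hz hzX hβ
  have bp := by3 p hp
  set η : ℝ → E3 := fun s => β s - α s with hη
  have hηc : Control t T η := hz.control.sub hy.control
  set Eη := energy t T η
  have hEη : 0 ≤ Eη := energy_nonneg ht.2 η
  set Iη := ∫ s in t..T, ‖η s‖ with hIη
  have hIη0 : 0 ≤ Iη := intervalIntegral.integral_nonneg ht.2 fun _ _ => norm_nonneg _
  have hIE : Iη ^ 2 ≤ T * Eη := S.sq_integral_norm_le ht hηc
  set w : ℝ → E3 := fun s => z s - y s with hw
  set D := (‖z t - y t‖ + N * Iη) * Real.exp N with hD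
  have hD0 : 0 ≤ D := by positivity
  have hwD : ∀ s ∈ Icc t T, ‖w s‖ ≤ D := fun s hs => by
    refine (hy.norm_sub_le hz S.hε ht.2 by1 s hs).trans ?_
    rw [hD]
    gcongr
  have hD2 : D ^ 2 ≤ K₁ * (‖z t - y t‖ ^ 2 + Eη) := by
    have h1 : (‖z t - y t‖ + N * Iη) ^ 2 ≤
        2 * (1 + N ^ 2 * T) * (‖z t - y t‖ ^ 2 + Eη) := by
      have h2 := mul_le_mul_of_nonneg_left hIE (sq_nonneg N)
      have h3 : 0 ≤ N ^ 2 * T * ‖z t - y t‖ ^ 2 := by positivity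
      nlinarith [sq_nonneg (‖z t - y t‖ - N * Iη)]
    calc D ^ 2 = (‖z t - y t‖ + N * Iη) ^ 2 * Real.exp N ^ 2 := by rw [hD, mul_pow]
      _ ≤ 2 * (1 + N ^ 2 * T) * (‖z t - y t‖ ^ 2 + Eη) * Real.exp N ^ 2 := by gcongr
      _ = _ := by rw [hK₁]; ring
  -- integration by parts
  have cφ := S.control_adjoint ht.1 hy.cont hy.control hp.cont
  have cw : ContinuousOn w (Icc t T) := hz.cont.sub hy.cont
  have cψ : Control t T (fun r => vert (w r) (β r) + mulCol (B ε (y r)) (η r)) :=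
    (control_vert cw hz.control).add (control_mulCol S.hε hy.cont hηc)
  have ibp := inner_sub_inner_eq_integral ht.2 (cφ.intervalIntegrable ht.2)
    (cψ.intervalIntegrable ht.2) hp.eq (hy.sub_eq hz S.hε)
  have i4 := (cφ.intervalIntegrable_inner (Control.of_continuousOn cw) ht.2).add
    ((Control.of_continuousOn hp.cont).intervalIntegrable_inner cψ ht.2)
  have crow : Control t T (fun s => α s + rowMul (p s) (B ε (y s))) := by
    refine hy.control.add (Control.of_continuousOn ?_)
    exact (continuous_rowMul_B ε).comp_continuousOn (hy.cont.prodMk hp.cont)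
  have i2 := crow.intervalIntegrable_inner hηc ht.2
  have i1 := S.intervalIntegrable_run ht.1 ht.2 le_rfl hy
  have i0 := S.intervalIntegrable_run ht.1 ht.2 le_rfl hz
  have i3 : IntervalIntegrable (fun s => (‖η s‖ ^ 2 + C * D ^ 2) + N * D * ‖η s‖) volume t T :=
    ((hηc.intervalIntegrable_sq ht.2).add intervalIntegrable_const).add
      ((hηc.intervalIntegrable ht.2).norm.const_mul _)
  -- The subtracted integrand is the derivative of ⟨p, z - y⟩. By the adjoint equation it cancels
  -- the terms linear in the state variation, leaving ⟨α + pB, η⟩ and second order terms; the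
  -- bilinear remainder ⟨p, vert w η⟩ is at most N D |η|.
  have hmono := intervalIntegral.integral_mono_on ht.2 i0 (((i1.add i2).add i3).sub i4)
    fun s hs => by
      have hs' : s ∈ Icc 0 T := ⟨ht.1.trans hs.1, hs.2⟩
      have f1 := (abs_le.1 ((S.f_bound s hs').taylor (y s) (z s))).2
      have f2 : ‖w s‖ ^ 2 ≤ D ^ 2 := by have := hwD s hs; gcongr
      have f3 : inner ℝ (p s) (vert (w s) (η s)) ≤ N * D * ‖η s‖ := by
        refine (real_inner_le_norm _ _).trans ?_
        calc _ ≤ N * (D * ‖η s‖) := by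
              gcongr
              · exact bp s hs
              · exact (norm_vert_le _ _).trans (by gcongr; exact hwD s hs)
          _ = _ := by ring
      have f4 : ‖β s‖ ^ 2 = ‖α s‖ ^ 2 + 2 * inner ℝ (α s) (η s) + ‖η s‖ ^ 2 := by
        have : β s = α s + η s := by simp [hη]
        rw [this, norm_add_sq_real]
      have f5 : C * ‖w s‖ ^ 2 ≤ C * D ^ 2 := by gcongr
      have f6 : vert (w s) (β s) = vert (w s) (α s) + vert (w s) (η s) := by
        rw [hη, vert_sub_right]; abel
      have f7 : 0 ≤ ‖η s‖ ^ 2 := sq_nonneg _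
      simp only [inner_neg_left, inner_add_left, inner_add_right, f6, inner_vert,
        real_inner_smul_left, ← inner_mulCol]
      rw [inner_vert] at f3
      rw [f4]
      change f (z s) s - f (y s) s - inner ℝ (spaceGradient f (y s) s) (w s) ≤ _ at f1
      change _ ≤ C * ‖w s‖ ^ 2 at f1
      change _ ≤ ‖α s‖ ^ 2 / 2 + f (y s) s + (inner ℝ (α s) (η s) +
        inner ℝ (p s) (mulCol (B ε (y s)) (η s))) + (‖η s‖ ^ 2 + C * D ^ 2 + N * D * ‖η s‖) - _
      linarith
  rw [intervalIntegral.integral_sub ((i1.add i2).add i3) i4,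
    intervalIntegral.integral_add (i1.add i2) i3, intervalIntegral.integral_add i1 i2,
    ← ibp, intervalIntegral.integral_add ((hηc.intervalIntegrable_sq ht.2).add
      intervalIntegrable_const) ((hηc.intervalIntegrable ht.2).norm.const_mul _),
    intervalIntegral.integral_add (hηc.intervalIntegrable_sq ht.2) intervalIntegrable_const,
    intervalIntegral.integral_const, intervalIntegral.integral_const_mul, smul_eq_mul,
    hp.terminal] at hmono
  have g1 := (abs_le.1 (S.g_bound.taylor (y T) (z T))).2
  have g2 : ‖z T - y T‖ ^ 2 ≤ D ^ 2 := by
    have : ‖z T - y T‖ ≤ D := hwD T ⟨ht.2, le_rfl⟩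
    gcongr
  have g3 : C * ‖z T - y T‖ ^ 2 ≤ C * D ^ 2 := by gcongr
  have g4 : (T - t) * (C * D ^ 2) ≤ T * (C * D ^ 2) := by gcongr; linarith [ht.1]
  -- The mixed term is split into squares, both of which are controlled by the initial displacement
  -- and the energy of η.
  have g5 : N * D * Iη ≤ N * (D ^ 2 + T * Eη) := by
    have : D * Iη ≤ D ^ 2 + T * Eη := by nlinarith [sq_nonneg (D - Iη)]
    calc N * D * Iη = N * (D * Iη) := by ring
      _ ≤ _ := by gcongr
  have g6 : (C * (T + 1) + N) * D ^ 2 ≤ (C * (T + 1) + N) * (K₁ * (‖z t - y t‖ ^ 2 + Eη)) := by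
    gcongr
  have g7 : 0 ≤ (1 + N * T) * ‖z t - y t‖ ^ 2 := by positivity
  change runCost f t T z β ≤ runCost f t T y α + (∫ s in t..T,
    inner ℝ (α s + rowMul (p s) (B ε (y s))) (η s)) + (Eη + (T - t) * (C * D ^ 2) + N * D * Iη) -
    (inner ℝ (gradient g (y T)) (z T - y T) - inner ℝ (p t) (z t - y t)) at hmono
  linarith only [hmono, g1, g3, g4, g5, g6, g7]

end Problem

/-! ### Nearly optimal trajectories -/

namespace Problem

variable {ε T C : ℝ} {f : E3 → ℝ → ℝ} {g : E3 → ℝ} {y α z β p q : ℝ → E3} {a b c t s : ℝ} {x : E3}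

lemma _root_.HeisenbergControl.Traj.control_residual (h : Traj ε t T y α)
    (hp : ContinuousOn p (Icc t T)) :
    Control t T (fun s => α s + rowMul (p s) (B ε (y s))) :=
  h.control.add (Control.of_continuousOn
    ((continuous_rowMul_B ε).comp_continuousOn (h.cont.prodMk hp)))

/-- Along nearly optimal pairs the control nearly maximizes the Hamiltonian. -/
lemma exists_energy_residual_le (S : Problem ε T C f g) {X : ℝ} (hX : 0 ≤ X) :
    ∃ K, 0 ≤ K ∧ ∀ t ∈ Icc 0 T, ∀ y α p δ, Traj ε t T y α → Adjoint T f g t y α p → ‖y t‖ ≤ X →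
      δ ≤ 1 → runCost f t T y α + g (y T) ≤ value ε T f g (y t) t + δ →
      energy t T (fun s => α s + rowMul (p s) (B ε (y s))) ≤ K * δ := by
  have hT := S.hT
  have hb0 := S.energyBound_nonneg
  obtain ⟨N, hN, HN⟩ := S.exists_traj_bounds (E := S.energyBound) hX
  set M := 2 * S.energyBound + 2 * ((N * N) ^ 2 * T) with hM
  have hM0 : 0 ≤ M := by positivity
  obtain ⟨K, hK, HK⟩ := S.exists_cost_expansion (E := 2 * S.energyBound + 2 * M) hX
  -- Step length of a descent along the residual e: replacing α by α - l e gains l times the energy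
  -- of e and loses at most K l² times it. As K l ≤ 1/2, half of the gain remains, and near
  -- optimality bounds it by δ.
  set l := 1 / (2 * K + 1) with hl
  have hl0 : 0 < l := by positivity
  have hl1 : l ≤ 1 := by rw [hl, div_le_one (by positivity)]; linarith
  have hKl : K * l ≤ 1 / 2 := by
    rw [hl, mul_one_div, div_le_div_iff₀ (by positivity) (by positivity)]; linarith
  refine ⟨2 / l, by positivity, fun t ht y α p δ h hp hy hδ hc => ?_⟩
  have hE := S.energy_le ht h (hc.trans (by linarith))
  obtain ⟨b1, -, b3⟩ := HN t ht y α h hy hE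
  set e : ℝ → E3 := fun s => α s + rowMul (p s) (B ε (y s)) with he
  have hec : Control t T e := h.control_residual hp.cont
  have hrow : Control t T (fun s => rowMul (p s) (B ε (y s))) := Control.of_continuousOn
    ((continuous_rowMul_B ε).comp_continuousOn (h.cont.prodMk hp.cont))
  have heM : energy t T e ≤ M := by
    refine (h.control.energy_add_le hrow ht.2).trans ?_
    have := hrow.energy_le_of_bound ht.2 (M := N * N) fun s hs => by
      refine (norm_rowMul_B_le S.hε _ _).trans ?_
      have h1 := b1 s hs
      have h2 := b3 p hp s hs
      gcongr
    have h3 : (N * N) ^ 2 * (T - t) ≤ (N * N) ^ 2 * T := by gcongr; linarith [ht.1]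
    linarith
  have he0 := energy_nonneg ht.2 e
  have hlc : Control t T (fun s => l • e s) := hec.const_smul l
  have hle : energy t T (fun s => l • e s) = l ^ 2 * energy t T e := by
    simp only [energy, norm_smul, mul_pow, Real.norm_eq_abs, sq_abs]
    rw [intervalIntegral.integral_const_mul]
  have hl2 : l ^ 2 ≤ 1 := by nlinarith
  have hβc : Control t T (fun s => α s - l • e s) := h.control.sub hlc
  obtain ⟨z, hz, hz0⟩ := exists_traj S.hε ht.2 (y t) hβc
  have h1 := HK t ht y α z _ p h hz hp hy (by rw [hz0]; exact hy) (by linarith) (by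
    refine (h.control.energy_sub_le hlc ht.2).trans ?_
    rw [hle]
    nlinarith)
  have h2 := S.value_le ht hz
  have h3 : ∫ s in t..T, inner ℝ (α s + rowMul (p s) (B ε (y s))) (α s - l • e s - α s) =
      -l * energy t T e := by
    rw [energy, ← intervalIntegral.integral_const_mul]
    refine intervalIntegral.integral_congr fun s _ => ?_
    simp only [sub_sub_cancel_left, inner_neg_right, real_inner_smul_right]
    rw [real_inner_self_eq_norm_sq]
    ring
  have h4 : energy t T (fun s => α s - l • e s - α s) = l ^ 2 * energy t T e := by
    rw [← hle]
    simp [energy]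
  rw [h3, h4, hz0, sub_self, inner_zero_right, norm_zero] at h1
  rw [hz0] at h2
  rw [div_mul_eq_mul_div, le_div_iff₀ hl0]
  have h5 : K * l * (l * energy t T e) ≤ 1 / 2 * (l * energy t T e) := by gcongr
  linarith

/-- At a point of differentiability of the value function, the adjoint curves of nearly optimal
trajectories nearly start from its gradient. -/
lemma exists_norm_adjoint_sub_le (S : Problem ε T C f g) (ht : t ∈ Icc 0 T) {v : E3}
    (hv : HasGradientAt (fun y => value ε T f g y t) v x) {e : ℝ} (he : 0 < e) :
    ∃ δ, 0 < δ ∧ δ ≤ 1 ∧ ∀ y α p, Traj ε t T y α → Adjoint T f g t y α p → y t = x →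
      runCost f t T y α + g (y T) ≤ value ε T f g x t + δ → ‖p t - v‖ ≤ e := by
  have hb0 := S.energyBound_nonneg
  obtain ⟨K, hK, HK⟩ := S.exists_cost_expansion (E := S.energyBound)
    (X := ‖x‖ + 1) (by positivity)
  have h0 := hasGradientAt_iff_isLittleO.1 hv
  obtain ⟨r₀, hr₀, H⟩ := Metric.eventually_nhds_iff.1 (h0.def (c := e / 4) (by positivity))
  set r := min (r₀ / 2) (min 1 (e / (4 * (K + 1)))) with hr
  have hrp : 0 < r := by positivity
  have hr1 : r ≤ 1 := (min_le_right _ _).trans (min_le_left _ _)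
  have hr2 : K * r ≤ e / 4 := by
    have : r ≤ e / (4 * (K + 1)) := (min_le_right _ _).trans (min_le_right _ _)
    rw [le_div_iff₀ (by positivity)] at this
    linarith
  have hr3 : r < r₀ := by have := min_le_left (r₀ / 2) (min 1 (e / (4 * (K + 1)))); linarith
  refine ⟨min 1 (e * r / 4), by positivity, min_le_left _ _, fun y α p h hp hy hc => ?_⟩
  by_contra! hlt
  have hpos : 0 < ‖p t - v‖ := he.trans hlt
  have hcδ := min_le_right 1 (e * r / 4)
  have hE := S.energy_le ht h (by rw [hy]; linarith [min_le_left 1 (e * r / 4)])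
  -- Displace the initial point by length r against p(t) - v, keeping the control. The cost
  -- expansion bounds V(x + w) from above with slope p(t), differentiability from below with slope
  -- v; hence r‖p(t) - v‖ is at most 3er/4, a contradiction.
  set w : E3 := -(r / ‖p t - v‖) • (p t - v) with hw
  have hwn : ‖w‖ = r := by
    rw [hw, norm_smul, norm_neg, Real.norm_eq_abs, abs_of_pos (by positivity)]
    field_simp
  obtain ⟨z, hz, hz0⟩ := exists_traj S.hε ht.2 (x + w) h.control
  have hzw : z t - y t = w := by rw [hz0, hy]; abel
  have h1 := HK t ht y α z α p h hz hp (by rw [hy]; linarith) (by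
    rw [hz0]; exact (norm_add_le _ _).trans (by linarith)) hE hE
  have h2 := S.value_le ht hz
  have h3 := H (y := x + w) (by rw [dist_eq_norm]; simp [hwn, hr3])
  rw [Real.norm_eq_abs, add_sub_cancel_left, hwn] at h3
  have h4 := (abs_le.1 h3).1
  rw [hzw, hwn] at h1
  simp only [sub_self, inner_zero_right, intervalIntegral.integral_zero, energy, norm_zero] at h1
  norm_num at h1
  rw [hz0] at h2
  have h5 : inner ℝ (p t) w - inner ℝ v w = -(r * ‖p t - v‖) := by
    rw [← inner_sub_left, hw, real_inner_smul_right, real_inner_self_eq_norm_sq]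
    field_simp
  have h6 : K * r * r ≤ e / 4 * r := by gcongr
  have h7 : r * e < r * ‖p t - v‖ := by gcongr
  nlinarith

/-- Stability of the coupled system for the trajectory and its adjoint curve. -/
lemma exists_stability (S : Problem ε T C f g) {X E : ℝ} (hX : 0 ≤ X) :
    ∃ K, 0 ≤ K ∧ ∀ t ∈ Icc 0 T, ∀ y α p z β q, Traj ε t T y α → Traj ε t T z β →
      Adjoint T f g t y α p → Adjoint T f g t z β q → ‖y t‖ ≤ X → z t = y t →
      energy t T α ≤ E → energy t T β ≤ E → ∀ R, ‖q t - p t‖ ^ 2 +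
        energy t T (fun s => α s + rowMul (p s) (B ε (y s))) +
        energy t T (fun s => β s + rowMul (q s) (B ε (z s))) ≤ R →
      (∀ s ∈ Icc t T, ‖z s - y s‖ ^ 2 ≤ K * R) ∧ energy t T (fun s => β s - α s) ≤ K * R := by
  obtain ⟨N, hN, HN⟩ := S.exists_traj_bounds (E := E) hX
  have hC := S.hC
  have hT := S.hT
  set L := N + (C + 2 * N ^ 2) * T with hL
  set K₁ := 2 * (1 + 8 * N ^ 2 * T) * Real.exp L ^ 2 with hK₁
  have hK₁0 : 0 ≤ K₁ := by positivity
  refine ⟨K₁ + 4 + 2 * N ^ 2 * T * K₁, by positivity,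
    fun t ht y α p z β q hy hz hp hq hyX hzy hα hβ R hR => ?_⟩
  obtain ⟨by1, -, by3⟩ := HN t ht y α hy hyX hα
  obtain ⟨-, bz2, bz3⟩ := HN t ht z β hz (hzy ▸ hyX) hβ
  have bp := by3 p hp
  have bq := bz3 q hq
  have ce := hy.control_residual hp.cont
  have cf := hz.control_residual hq.cont
  have hηE := cf.energy_sub_le ce ht.2
  have hηc := cf.sub ce
  set η : ℝ → E3 := fun s => (β s + rowMul (q s) (B ε (z s))) -
    (α s + rowMul (p s) (B ε (y s))) with hη
  have hE1 := energy_nonneg ht.2 (fun s => α s + rowMul (p s) (B ε (y s)))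
  have hE2 := energy_nonneg ht.2 (fun s => β s + rowMul (q s) (B ε (z s)))
  have hR0 : 0 ≤ R := le_trans (by positivity) hR
  -- Since each control equals its residual minus pB, the difference of controls is bounded by η,
  -- the difference of residuals, plus N D. This closes the system for D.
  set D : ℝ → ℝ := fun s => ‖z s - y s‖ + ‖q s - p s‖ with hD
  have hDc : ContinuousOn D (Icc t T) :=
    (hz.cont.sub hy.cont).norm.add (hq.cont.sub hp.cont).norm
  have hD0 : ∀ s, 0 ≤ D s := fun s => by positivity
  have hctrl : ∀ s ∈ Icc t T, ‖β s - α s‖ ≤ ‖η s‖ + N * D s := by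
    intro s hs
    have e1 : β s - α s = η s - ((rowMul (q s) (B ε (z s)) - rowMul (q s) (B ε (y s))) +
        rowMul (q s - p s) (B ε (y s))) := by
      rw [rowMul_sub]; simp only [hη]; abel
    have e2 : ‖rowMul (q s) (B ε (z s)) - rowMul (q s) (B ε (y s))‖ ≤ N * ‖z s - y s‖ := by
      refine (norm_rowMul_B_sub_le _ _ _ _).trans ?_
      rw [mul_comm]
      gcongr
      exact bq s hs
    have e3 : ‖rowMul (q s - p s) (B ε (y s))‖ ≤ N * ‖q s - p s‖ := by
      refine (norm_rowMul_B_le S.hε _ _).trans ?_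
      gcongr
      exact by1 s hs
    rw [e1]
    refine (norm_sub_le _ _).trans ?_
    have := norm_add_le (rowMul (q s) (B ε (z s)) - rowMul (q s) (B ε (y s)))
      (rowMul (q s - p s) (B ε (y s)))
    simp only [hD]
    linarith
  -- The Gronwall coefficient is merely integrable, because β enters both equations
  -- multiplicatively; each of them contributes one N² through the difference of controls.
  set k : ℝ → ℝ := fun s => ‖β s‖ + (C + 2 * N ^ 2) with hk
  have ik : IntervalIntegrable k volume t T :=
    (hz.control.intervalIntegrable ht.2).norm.add intervalIntegrable_const
  have iη := (hηc.intervalIntegrable ht.2).norm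
  set A := ‖q t - p t‖ + 2 * N * ∫ s in t..T, ‖η s‖ with hA
  have hint : ∀ s ∈ Icc t T, D s ≤ A + ∫ r in t..s, k r * D r := by
    intro s hs
    have hsub : uIcc t s ⊆ uIcc t T := by
      rw [uIcc_of_le hs.1, uIcc_of_le ht.2]; exact Icc_subset_Icc_right hs.2
    have cD : ContinuousOn D (uIcc t s) := by
      rw [uIcc_of_le hs.1]; exact hDc.mono (Icc_subset_Icc_right hs.2)
    have ikD : IntervalIntegrable (fun r => k r * D r) volume t s :=
      (ik.mono_set hsub).mul_continuousOn cD
    have iβD : IntervalIntegrable (fun r => ‖β r‖ * D r) volume t s :=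
      ((hz.control.intervalIntegrable ht.2).norm.mono_set hsub).mul_continuousOn cD
    have e1 := hy.sub_eq hz S.hε s hs
    have e2 : q s - p s = (q t - p t) + ∫ r in t..s, (-(spaceGradient f (z r) r + q r 2 • rot (β r))
        - -(spaceGradient f (y r) r + p r 2 • rot (α r))) := by
      rw [hq.eq s hs, hp.eq s hs, intervalIntegral.integral_sub]
      · abel
      · exact ((S.control_adjoint ht.1 hz.cont hz.control hq.cont).intervalIntegrable
          ht.2).mono_set hsub
      · exact ((S.control_adjoint ht.1 hy.cont hy.control hp.cont).intervalIntegrable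
          ht.2).mono_set hsub
    have i1 := (hy.intervalIntegrable_sub hz S.hε ht.2).mono_set hsub
    have i2 := (((S.control_adjoint ht.1 hz.cont hz.control hq.cont).intervalIntegrable
          ht.2).sub ((S.control_adjoint ht.1 hy.cont hy.control hp.cont).intervalIntegrable
          ht.2)).mono_set hsub
    have n1 : ‖z s - y s‖ ≤ ∫ r in t..s,
        ‖vert (z r - y r) (β r) + mulCol (B ε (y r)) (β r - α r)‖ := by
      rw [e1, hzy, sub_self, zero_add]
      exact intervalIntegral.norm_integral_le_integral_norm hs.1
    have n2 : ‖q s - p s‖ ≤ ‖q t - p t‖ + ∫ r in t..s,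
        ‖-(spaceGradient f (z r) r + q r 2 • rot (β r))
        - -(spaceGradient f (y r) r + p r 2 • rot (α r))‖ := by
      rw [e2]
      exact (norm_add_le _ _).trans (add_le_add le_rfl
        (intervalIntegral.norm_integral_le_integral_norm hs.1))
    have hmono := intervalIntegral.integral_mono_on hs.1 (i1.norm.add i2.norm)
      (ikD.add ((iη.mono_set hsub).const_mul (2 * N))) fun r hr => by
        have hr' : r ∈ Icc t T := ⟨hr.1, hr.2.trans hs.2⟩
        have c0 := hctrl r hr'
        have c1 : ‖vert (z r - y r) (β r) + mulCol (B ε (y r)) (β r - α r)‖ ≤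
            ‖z r - y r‖ * ‖β r‖ + N * ‖β r - α r‖ := by
          refine (norm_add_le _ _).trans (add_le_add (norm_vert_le _ _) ?_)
          refine (norm_mulCol_B_le S.hε _ _).trans ?_
          gcongr
          exact by1 r hr'
        have c2 : ‖-(spaceGradient f (z r) r + q r 2 • rot (β r))
            - -(spaceGradient f (y r) r + p r 2 • rot (α r))‖ ≤
            C * ‖z r - y r‖ + (‖q r - p r‖ * ‖β r‖ + N * ‖β r - α r‖) := by
          have d1 : -(spaceGradient f (z r) r + q r 2 • rot (β r))
            - -(spaceGradient f (y r) r + p r 2 • rot (α r)) =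
              -((spaceGradient f (z r) r - spaceGradient f (y r) r) +
                ((q r - p r) 2 • rot (β r) + p r 2 • rot (β r - α r))) := by
            rw [rot_sub, smul_sub, PiLp.sub_apply, sub_smul]; abel
          rw [d1, norm_neg]
          refine (norm_add_le _ _).trans (add_le_add ?_ ((norm_add_le _ _).trans
            (add_le_add (norm_smul_rot_le _ _) ?_)))
          · exact (S.f_bound r ⟨ht.1.trans hr'.1, hr'.2⟩).grad_lip _ _
          · refine (norm_smul_rot_le _ _).trans ?_
            gcongr
            exact bp r hr'
        have c3 : N * ‖β r - α r‖ ≤ N * (‖η r‖ + N * D r) := by gcongr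
        have c4 : 0 ≤ C * ‖q r - p r‖ := by positivity
        show _ + _ ≤ (‖β r‖ + (C + 2 * N ^ 2)) * D r + 2 * N * ‖η r‖
        have c5 : (‖β r‖ + C) * D r = ‖z r - y r‖ * ‖β r‖ + ‖q r - p r‖ * ‖β r‖ +
          C * ‖z r - y r‖ + C * ‖q r - p r‖ := by simp only [hD]; ring
        linarith
    rw [intervalIntegral.integral_add i1.norm i2.norm, intervalIntegral.integral_add ikD
      ((iη.mono_set hsub).const_mul (2 * N)), intervalIntegral.integral_const_mul] at hmono
    have m1 : ∫ r in t..s, ‖η r‖ ≤ ∫ r in t..T, ‖η r‖ :=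
      integral_mono_interval_of_nonneg le_rfl hs.1 hs.2 iη fun _ => norm_nonneg _
    have m2 : 2 * N * ∫ r in t..s, ‖η r‖ ≤ 2 * N * ∫ r in t..T, ‖η r‖ := by gcongr
    rw [hA]
    simp only [hD] at hmono ⊢
    linarith
  have hkL : ∀ s ∈ Icc t T, ∫ r in t..s, k r ≤ L := by
    intro s hs
    have h1 : ∫ r in t..s, k r ≤ ∫ r in t..T, k r :=
      integral_mono_interval_of_nonneg le_rfl hs.1 hs.2 ik fun _ => by positivity
    refine h1.trans ?_
    rw [hk, intervalIntegral.integral_add (hz.control.intervalIntegrable ht.2).norm (by simp),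
      intervalIntegral.integral_const, smul_eq_mul, hL]
    have : (T - t) * (C + 2 * N ^ 2) ≤ T * (C + 2 * N ^ 2) := by gcongr; linarith [ht.1]
    linarith
  have hI0 : 0 ≤ ∫ s in t..T, ‖η s‖ :=
    intervalIntegral.integral_nonneg ht.2 fun _ _ => norm_nonneg _
  have hA0 : 0 ≤ A := by positivity
  have hA2 : A ^ 2 ≤ 2 * (1 + 8 * N ^ 2 * T) * R := by
    have h1 := S.sq_integral_norm_le ht hηc
    have h2 : A ^ 2 ≤ 2 * ‖q t - p t‖ ^ 2 + 8 * N ^ 2 * (∫ s in t..T, ‖η s‖) ^ 2 := by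
      rw [hA]
      nlinarith [sq_nonneg (‖q t - p t‖ - 2 * N * ∫ s in t..T, ‖η s‖)]
    have h3 : T * energy t T η ≤ T * (2 * R) := by
      gcongr
      have := sq_nonneg ‖q t - p t‖
      linarith
    have h4 : 8 * N ^ 2 * (∫ s in t..T, ‖η s‖) ^ 2 ≤ 8 * N ^ 2 * (T * (2 * R)) := by
      gcongr; exact h1.trans h3
    linarith
  have hDR : ∀ s ∈ Icc t T, D s ^ 2 ≤ K₁ * R := by
    intro s hs
    have h1 := gronwall_integral ht.2 hDc ik (fun _ => by positivity) hint s hs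
    have h2 : D s ≤ A * Real.exp L := h1.trans (by gcongr; exact hkL s hs)
    calc D s ^ 2 ≤ (A * Real.exp L) ^ 2 := by have := hD0 s; gcongr
      _ = A ^ 2 * Real.exp L ^ 2 := mul_pow _ _ _
      _ ≤ 2 * (1 + 8 * N ^ 2 * T) * R * Real.exp L ^ 2 := by gcongr
      _ = _ := by rw [hK₁]; ring
  have hr1 : 0 ≤ N ^ 2 * T * K₁ * R := by positivity
  have hr2 : 0 ≤ K₁ * R := by positivity
  refine ⟨fun s hs => ?_, ?_⟩
  · have h1 : ‖z s - y s‖ ^ 2 ≤ D s ^ 2 := by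
      have : ‖z s - y s‖ ≤ D s := by simp only [hD]; linarith [norm_nonneg (q s - p s)]
      gcongr
    linarith [hDR s hs]
  · have i1 := (hηc.intervalIntegrable_sq ht.2).const_mul 2
    have := intervalIntegral.integral_mono_on ht.2
      ((hz.control.sub hy.control).intervalIntegrable_sq ht.2)
      (i1.add (intervalIntegrable_const (c := 2 * N ^ 2 * (K₁ * R)))) fun s hs => by
        have h1 := hctrl s hs
        have h2 := hDR s hs
        show ‖β s - α s‖ ^ 2 ≤ 2 * ‖η s‖ ^ 2 + 2 * N ^ 2 * (K₁ * R)
        have h3 : N ^ 2 * D s ^ 2 ≤ N ^ 2 * (K₁ * R) := by gcongr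
        have h4 : ‖β s - α s‖ ^ 2 ≤ (‖η s‖ + N * D s) ^ 2 := by gcongr
        nlinarith [sq_nonneg (‖η s‖ - N * D s)]
    rw [intervalIntegral.integral_add i1 (by simp), intervalIntegral.integral_const,
      intervalIntegral.integral_const_mul, smul_eq_mul] at this
    change energy t T (fun s => β s - α s) ≤ 2 * energy t T η + _ at this
    have h4 : (T - t) * (2 * N ^ 2 * (K₁ * R)) ≤ T * (2 * N ^ 2 * (K₁ * R)) := by
      gcongr; linarith [ht.1]
    have := sq_nonneg ‖q t - p t‖
    linarith

end Problem

/-! ### Existence and uniqueness of optimal pairs at points of differentiability -/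

namespace Control

variable {a b : ℝ}

lemma energy_eq_norm_sq (hab : a ≤ b) (F : Lp E3 2 (volume.restrict (Ioc a b))) :
    energy a b F = ‖F‖ ^ 2 := by
  rw [← real_inner_self_eq_norm_sq, L2.inner_def, energy, intervalIntegral.integral_of_le hab]
  simp only [real_inner_self_eq_norm_sq]

lemma energy_congr {α β : ℝ → E3} (hab : a ≤ b) (h : α =ᵐ[volume.restrict (Ioc a b)] β) :
    energy a b α = energy a b β := by
  rw [energy, energy, intervalIntegral.integral_of_le hab, intervalIntegral.integral_of_le hab]
  refine integral_congr_ae ?_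
  filter_upwards [h] with s hs
  simp only [hs]

/-- Completeness of the space of controls. -/
lemma exists_limit (hab : a ≤ b) {φ : ℕ → ℝ → E3} (hφ : ∀ n, Control a b (φ n))
    (h : ∀ e > 0, ∃ n₀, ∀ m ≥ n₀, ∀ n ≥ n₀, energy a b (fun s => φ n s - φ m s) ≤ e) :
    ∃ α, Control a b α ∧ ∀ e > 0, ∃ n₀, ∀ n ≥ n₀, energy a b (fun s => α s - φ n s) ≤ e := by
  have key : ∀ (n : ℕ) (F : Lp E3 2 (volume.restrict (Ioc a b))),
      energy a b (fun s => F s - φ n s) = ‖F - (hφ n).toLp‖ ^ 2 := fun n F => by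
    rw [← energy_eq_norm_sq hab]
    refine energy_congr hab ?_
    filter_upwards [Lp.coeFn_sub F (hφ n).toLp, (hφ n).coeFn_toLp] with s h1 h2
    rw [h1, Pi.sub_apply, h2]
  have hc : CauchySeq fun n => (hφ n).toLp := by
    rw [Metric.cauchySeq_iff]
    intro e he
    obtain ⟨n₀, H⟩ := h (e ^ 2 / 4) (by positivity)
    refine ⟨n₀, fun m hm n hn => ?_⟩
    rw [dist_eq_norm]
    have h1 : ‖(hφ m).toLp - (hφ n).toLp‖ ^ 2 ≤ (e / 2) ^ 2 := by
      rw [← key]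
      refine (energy_congr hab ?_).trans_le ((H n hn m hm).trans (by ring_nf; rfl))
      filter_upwards [(hφ m).coeFn_toLp] with s hs
      rw [hs]
    have := abs_le_of_sq_le_sq h1 (by positivity)
    rw [abs_of_nonneg (norm_nonneg _)] at this
    linarith
  obtain ⟨F, hF⟩ := cauchySeq_tendsto_of_complete hc
  refine ⟨F, Lp.memLp F, fun e he => ?_⟩
  obtain ⟨n₀, H⟩ := Metric.tendsto_atTop.1 hF (√e) (by positivity)
  refine ⟨n₀, fun n hn => ?_⟩
  rw [key, ← Real.sq_sqrt he.le, norm_sub_rev, ← dist_eq_norm]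
  have := (H n hn).le
  gcongr

end Control

namespace Problem

variable {ε T C : ℝ} {f : E3 → ℝ → ℝ} {g : E3 → ℝ} {y α z β p q : ℝ → E3} {a b c t s : ℝ} {x : E3}

/-- At a point of differentiability of the value function, nearly optimal pairs are close. -/
lemma exists_near_stability (S : Problem ε T C f g) (ht : t ∈ Icc 0 T)
    (hd : DifferentiableAt ℝ (fun y => value ε T f g y t) x) {e : ℝ} (he : 0 < e) :
    ∃ δ, 0 < δ ∧ δ ≤ 1 ∧ ∀ y α z β, Traj ε t T y α → Traj ε t T z β → y t = x → z t = x →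
      runCost f t T y α + g (y T) ≤ value ε T f g x t + δ →
      runCost f t T z β + g (z T) ≤ value ε T f g x t + δ →
      (∀ s ∈ Icc t T, ‖z s - y s‖ ^ 2 ≤ e) ∧ energy t T (fun s => β s - α s) ≤ e := by
  have hv := hd.hasGradientAt
  set v := gradient (fun y => value ε T f g y t) x
  obtain ⟨K, hK, HK⟩ := S.exists_energy_residual_le (X := ‖x‖) (norm_nonneg _)
  obtain ⟨L, hL, HL⟩ := S.exists_stability (X := ‖x‖) (E := S.energyBound) (norm_nonneg _)
  set e₁ := min 1 (e / (8 * (L + 1))) with he₁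
  have he₁0 : 0 < e₁ := by positivity
  have he₁1 : e₁ ≤ 1 := min_le_left _ _
  have he₁2 : L * e₁ ≤ e / 8 := by
    have : e₁ ≤ e / (8 * (L + 1)) := min_le_right _ _
    rw [le_div_iff₀ (by positivity)] at this
    linarith
  obtain ⟨δ, hδ, hδ1, Hδ⟩ := S.exists_norm_adjoint_sub_le ht hv he₁0
  refine ⟨min δ (e₁ / (K + 1)), by positivity, (min_le_left _ _).trans hδ1,
    fun y α z β hy hz hy0 hz0 hcy hcz => ?_⟩
  have hδ' := min_le_left δ (e₁ / (K + 1))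
  have hδ'' : K * min δ (e₁ / (K + 1)) ≤ e₁ := by
    have h1 := min_le_right δ (e₁ / (K + 1))
    have h2 : 0 < min δ (e₁ / (K + 1)) := by positivity
    rw [le_div_iff₀ (by positivity)] at h1
    linarith
  obtain ⟨p, hp⟩ := S.exists_adjoint ht hy
  obtain ⟨q, hq⟩ := S.exists_adjoint ht hz
  have a1 := Hδ y α p hy hp hy0 (by linarith)
  have a2 := Hδ z β q hz hq hz0 (by linarith)
  have b1 := HK t ht y α p _ hy hp (by rw [hy0]) (hδ'.trans hδ1) (by rw [hy0]; exact hcy)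
  have b2 := HK t ht z β q _ hz hq (by rw [hz0]) (hδ'.trans hδ1) (by rw [hz0]; exact hcz)
  have c1 : ‖q t - p t‖ ≤ 2 * e₁ := by
    have := norm_sub_le (q t - v) (p t - v)
    rw [sub_sub_sub_cancel_right] at this
    linarith
  have c2 : ‖q t - p t‖ ^ 2 ≤ 4 * e₁ := by
    calc _ ≤ (2 * e₁) ^ 2 := by gcongr
      _ ≤ _ := by nlinarith
  -- The total 6e₁ is 4e₁ from the initial adjoint values, both close to v, plus e₁ from each
  -- residual.
  obtain ⟨d1, d2⟩ := HL t ht y α p z β q hy hz hp hq (by rw [hy0]) (by rw [hz0, hy0])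
    (S.energy_le ht hy (by rw [hy0]; linarith)) (S.energy_le ht hz (by rw [hz0]; linarith))
    (6 * e₁) (by linarith)
  have h6 : L * (6 * e₁) ≤ e := by linarith
  exact ⟨fun s hs => (d1 s hs).trans h6, d2.trans h6⟩

/-- Uniqueness of the optimal trajectory at a point of differentiability. -/
lemma eqOn_of_isOptimalPair (S : Problem ε T C f g) (ht : t ∈ Icc 0 T)
    (hd : DifferentiableAt ℝ (fun y => value ε T f g y t) x)
    (h : IsOptimalPair ε T f g x t y α) (h' : IsOptimalPair ε T f g x t z β) :
    EqOn z y (Icc t T) := by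
  obtain ⟨hy, hy0, hyc⟩ := (S.isOptimalPair_iff ht).1 h
  obtain ⟨hz, hz0, hzc⟩ := (S.isOptimalPair_iff ht).1 h'
  intro s hs
  have : ‖z s - y s‖ ^ 2 ≤ 0 := le_of_forall_pos_le_add fun e he => by
    obtain ⟨δ, hδ, -, H⟩ := S.exists_near_stability ht hd he
    rw [zero_add]
    exact (H y α z β hy hz hy0 hz0 (by linarith) (by linarith)).1 s hs
  have h0 : ‖z s - y s‖ = 0 := by
    have := sq_nonneg ‖z s - y s‖
    exact pow_eq_zero_iff two_ne_zero |>.1 (by linarith)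
  exact sub_eq_zero.1 (norm_eq_zero.1 h0)

/-- Existence of an optimal pair at a point of differentiability. -/
lemma exists_isOptimalPair (S : Problem ε T C f g) (ht : t ∈ Icc 0 T)
    (hd : DifferentiableAt ℝ (fun y => value ε T f g y t) x) :
    ∃ y α, IsOptimalPair ε T f g x t y α := by
  have hpos : ∀ n : ℕ, (0 : ℝ) < 1 / ((n : ℝ) + 1) := fun n => by positivity
  choose Y φ hY hY0 hYc using fun n : ℕ => S.exists_near x t (hpos n)
  have hsmall : ∀ δ > (0 : ℝ), ∃ n₀ : ℕ, ∀ n ≥ n₀, 1 / ((n : ℝ) + 1) ≤ δ := fun δ hδ => by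
    obtain ⟨n₀, hn₀⟩ := exists_nat_one_div_lt hδ
    refine ⟨n₀, fun n hn => le_trans ?_ hn₀.le⟩
    exact one_div_le_one_div_of_le (by positivity) (by gcongr)
  -- Stability makes the minimizing sequence of controls Cauchy in L². The limit is strong, so
  -- neither weak compactness nor lower semicontinuity is used.
  obtain ⟨α, hα, hlim⟩ := Control.exists_limit ht.2 (fun n => (hY n).control) fun e he => by
    obtain ⟨δ, hδ, -, H⟩ := S.exists_near_stability ht hd he
    obtain ⟨n₀, hn₀⟩ := hsmall δ hδ
    exact ⟨n₀, fun m hm n hn => (H _ _ _ _ (hY m) (hY n) (hY0 m) (hY0 n)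
      ((hYc m).le.trans (by linarith [hn₀ m hm])) ((hYc n).le.trans (by linarith [hn₀ n hn]))).2⟩
  obtain ⟨y, hy, hy0⟩ := exists_traj S.hε ht.2 x hα
  refine ⟨y, α, (S.isOptimalPair_iff ht).2 ⟨hy, hy0, ?_⟩⟩
  have hb0 := S.energyBound_nonneg
  obtain ⟨K, hK, HK⟩ := S.exists_energy_residual_le (X := ‖x‖) (norm_nonneg _)
  obtain ⟨L, hL, HL⟩ := S.exists_cost_expansion (X := ‖x‖) (E := 2 * S.energyBound + 2)
    (norm_nonneg _)
  rw [← sub_nonpos]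
  refine nonpos_of_forall_lt_one_le_mul (K := 1 + (K + 1) / 2 + L) fun e he he1 => ?_
  obtain ⟨n₁, hn₁⟩ := hsmall e he
  obtain ⟨n₂, hn₂⟩ := hlim e he
  set n := max n₁ n₂
  have hn1 := hn₁ n (le_max_left _ _)
  have hn2 := hn₂ n (le_max_right _ _)
  have hcn : runCost f t T (Y n) (φ n) + g (Y n T) ≤ value ε T f g x t + e :=
    (hYc n).le.trans (by linarith)
  have hEn := S.energy_le ht (hY n) (by rw [hY0]; linarith)
  obtain ⟨p, hp⟩ := S.exists_adjoint ht (hY n)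
  have hres := HK t ht _ _ p e (hY n) hp (by rw [hY0]) he1.le (by rw [hY0]; exact hcn)
  have hηc := hα.sub (hY n).control
  have hEα : energy t T α ≤ 2 * S.energyBound + 2 := by
    have := (hY n).control.energy_add_le hηc ht.2
    simp only [add_sub_cancel] at this
    change energy t T α ≤ _ at this
    linarith
  -- The cost of the limit is expanded around the n-th pair. The linear term pairs the small
  -- residual with the small control difference, so the limit costs at most V(x, t) + O(e).
  have hexp := HL t ht _ _ y α p (hY n) hy hp (by rw [hY0]) (by rw [hy0]) (by linarith) hEα
  rw [hy0, hY0, sub_self, inner_zero_right, norm_zero] at hexp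
  have hrc := (hY n).control_residual hp.cont
  have hin : (∫ s in t..T, inner ℝ (φ n s + rowMul (p s) (B ε (Y n s))) (α s - φ n s)) ≤
      (K * e + e) / 2 := by
    have i1 := (hrc.intervalIntegrable_sq ht.2).div_const 2
    have i2 := (hηc.intervalIntegrable_sq ht.2).div_const 2
    have := intervalIntegral.integral_mono_on ht.2 (hrc.intervalIntegrable_inner hηc ht.2)
      (i1.add i2) fun s _ => by
        refine (real_inner_le_norm _ _).trans ?_
        show _ ≤ ‖φ n s + rowMul (p s) (B ε (Y n s))‖ ^ 2 / 2 + ‖α s - φ n s‖ ^ 2 / 2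
        nlinarith [sq_nonneg (‖φ n s + rowMul (p s) (B ε (Y n s))‖ - ‖α s - φ n s‖)]
    rw [intervalIntegral.integral_add i1 i2, intervalIntegral.integral_div,
      intervalIntegral.integral_div] at this
    change _ ≤ energy t T (fun s => φ n s + rowMul (p s) (B ε (Y n s))) / 2 +
      energy t T (fun s => α s - φ n s) / 2 at this
    linarith
  have hLe : L * energy t T (fun s => α s - φ n s) ≤ L * e := by gcongr
  linarith

/-- Pontryagin's principle: an optimal control is given by the adjoint curve. -/
lemma ae_eq_neg_rowMul_adjoint (S : Problem ε T C f g) (ht : t ∈ Icc 0 T)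
    (h : IsOptimalPair ε T f g x t y α) (hp : Adjoint T f g t y α p) :
    ∀ᵐ s ∂(volume.restrict (Ioo t T)), α s = -rowMul (p s) (B ε (y s)) := by
  obtain ⟨hy, hy0, hyc⟩ := (S.isOptimalPair_iff ht).1 h
  obtain ⟨K, hK, HK⟩ := S.exists_energy_residual_le (X := ‖x‖) (norm_nonneg _)
  -- The residual estimate with zero error: an optimal pair has residual of zero energy.
  have h0 := HK t ht y α p 0 hy hp (by rw [hy0]) zero_le_one (by rw [hy0]; linarith)
  rw [mul_zero] at h0
  have h1 := le_antisymm h0 (energy_nonneg ht.2 _)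
  have hc := hy.control_residual hp.cont
  rw [energy, intervalIntegral.integral_of_le ht.2, integral_eq_zero_iff_of_nonneg
    (fun _ => sq_nonneg _) ((memLp_two_iff_integrable_sq_norm hc.1).1 hc)] at h1
  rw [Measure.restrict_congr_set Ioo_ae_eq_Ioc]
  filter_upwards [h1] with s hs
  have : ‖α s + rowMul (p s) (B ε (y s))‖ = 0 := pow_eq_zero_iff two_ne_zero |>.1 hs
  exact eq_neg_of_add_eq_zero_left (norm_eq_zero.1 this)

end Problem

/-! ### Differentiability of the value function along optimal trajectories -/

/-- A function with a quadratic upper bound of linear leading part, and a quadratic lower bound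
whose leading part is odd, is differentiable. -/
lemma hasGradientAt_of_quadratic_bounds {φ c : E3 → ℝ} {x p : E3} {K : ℝ}
    (hc : ∀ v, c (-v) = -c v) (hl : ∀ v, ‖v‖ ≤ 1 → φ x + c v - K * ‖v‖ ^ 2 ≤ φ (x + v))
    (hu : ∀ v, ‖v‖ ≤ 1 → φ (x + v) ≤ φ x + inner ℝ p v + K * ‖v‖ ^ 2) :
    HasGradientAt φ p x := by
  rw [hasGradientAt_iff_isLittleO]
  -- Comparing the two bounds at -v and using oddness gives c(v) ≥ ⟨p, v⟩ - 2K|v|²; inserting this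
  -- in the lower bound at v gives the constant 3.
  have hb : ∀ v, ‖v‖ ≤ 1 → |φ (x + v) - φ x - inner ℝ p v| ≤ 3 * |K| * ‖v‖ ^ 2 := by
    intro v hv
    have h1 := hl v hv
    have h2 := hu v hv
    have h3 := hl (-v) (by rwa [norm_neg])
    have h4 := hu (-v) (by rwa [norm_neg])
    rw [hc, norm_neg] at h3
    rw [inner_neg_right, norm_neg] at h4
    have h5 : K * ‖v‖ ^ 2 ≤ |K| * ‖v‖ ^ 2 := by gcongr; exact le_abs_self K
    have h6 : 0 ≤ |K| * ‖v‖ ^ 2 := by positivity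
    rw [abs_le]
    constructor <;> linarith
  rw [Asymptotics.isLittleO_iff]
  intro e he
  have hr : 0 < min 1 (e / (3 * |K| + 1)) := by positivity
  filter_upwards [Metric.ball_mem_nhds x hr] with y hy
  rw [Metric.mem_ball, dist_eq_norm] at hy
  have h1 := hb (y - x) (hy.le.trans (min_le_left _ _))
  rw [add_sub_cancel] at h1
  rw [Real.norm_eq_abs]
  refine h1.trans ?_
  have h2 := hy.le.trans (min_le_right _ _)
  rw [le_div_iff₀ (by positivity)] at h2
  nlinarith [norm_nonneg (y - x)]

/-! ### Steering trajectories when ε is nonzero. -/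

/-- The control perturbation which adds `((r - t) / h) v` to the trajectory `γ` with
control `α`. -/
def steering (ε t h : ℝ) (γ α : ℝ → E3) (v : E3) (r : ℝ) : E3 :=
  h⁻¹ • (!₂[v 0, v 1, ε⁻¹ * v 2] - ε⁻¹ • vert (γ r) v) - ε⁻¹ • vert (((r - t) / h) • v) (α r)

lemma steering_neg (ε t h : ℝ) (γ α : ℝ → E3) (v : E3) (r : ℝ) :
    steering ε t h γ α (-v) r = -steering ε t h γ α v r := by
  ext i
  fin_cases i <;> simp [steering, vert]
  ring

/-- For nonzero ε the third control can correct any vertical mismatch. The displacement and the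
added horizontal velocity are both multiples of v, so their `vert` interaction vanishes; the
correction is therefore exactly linear in v, with no quadratic term. -/
lemma mulCol_steering {ε h : ℝ} (hε : ε ≠ 0) (hh : h ≠ 0) (t : ℝ) (γ α : ℝ → E3) (v : E3) (r : ℝ) :
    mulCol (B ε (γ r + ((r - t) / h) • v)) (α r + steering ε t h γ α v r) =
      mulCol (B ε (γ r)) (α r) + h⁻¹ • v := by
  ext i
  fin_cases i
  · simp [mulCol_B, steering, vert]
  · simp [mulCol_B, steering, vert]
  · simp [mulCol_B, steering, vert]
    field_simp
    ring

namespace Traj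

variable {ε t s : ℝ} {γ α : ℝ → E3}

lemma control_steering (h : Traj ε t s γ α) (v : E3) :
    Control t s (steering ε t (s - t) γ α v) := by
  have c1 : Control t s (fun r => !₂[v 0, v 1, ε⁻¹ * v 2] - ε⁻¹ • vert (γ r) v) :=
    Control.of_continuousOn (continuousOn_const.sub (ContinuousOn.fun_const_smul
      (continuous_vert.comp_continuousOn (h.cont.prodMk continuousOn_const)) _))
  have c2 : Control t s (fun r => vert (((r - t) / (s - t)) • v) (α r)) :=
    control_vert (y := fun r => ((r - t) / (s - t)) • v)
      (Continuous.continuousOn (by fun_prop)) h.control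
  exact (MemLp.const_smul c1 (s - t)⁻¹).sub (MemLp.const_smul c2 ε⁻¹)

/-- The steered trajectory. -/
lemma steer (h : Traj ε t s γ α) (hε : ε ∈ Icc (0 : ℝ) 1) (hε0 : ε ≠ 0) (hts : t < s) (v : E3) :
    Traj ε t s (fun r => γ r + ((r - t) / (s - t)) • v)
      (fun r => α r + steering ε t (s - t) γ α v r) where
  control := h.control.add (h.control_steering v)
  cont := h.cont.add (Continuous.continuousOn (by fun_prop))
  eq r hr := by
    have hst : s - t ≠ 0 := (sub_pos.2 hts).ne'
    simp only [mulCol_steering hε0 hst]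
    rw [intervalIntegral.integral_add ((h.mono hε le_rfl hr.2).intervalIntegrable hε hr.1)
      (by simp), intervalIntegral.integral_const, h.eq r hr, smul_smul, div_eq_mul_inv]
    simp [add_assoc]

lemma exists_norm_steering_le (h : Traj ε t s γ α) (hε : ε ∈ Icc (0 : ℝ) 1) (hts : t < s) :
    ∃ c, 0 ≤ c ∧ ∀ r ∈ Icc t s, ∀ v, ‖steering ε t (s - t) γ α v r‖ ≤ c * ‖v‖ * (1 + ‖α r‖) := by
  obtain ⟨M, hM⟩ := isCompact_Icc.exists_bound_of_continuousOn h.cont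
  have hM0 : 0 ≤ M := (norm_nonneg _).trans (hM t ⟨le_rfl, hts.le⟩)
  have hst := sub_pos.2 hts
  have hi : 0 ≤ ε⁻¹ := inv_nonneg.2 hε.1
  refine ⟨(s - t)⁻¹ * (1 + ε⁻¹ + ε⁻¹ * M) + ε⁻¹, by positivity, fun r hr v => ?_⟩
  have h1 : ‖(!₂[v 0, v 1, ε⁻¹ * v 2] : E3)‖ ≤ (1 + ε⁻¹) * ‖v‖ := by
    refine (abs_le_of_sq_le_sq' ?_ (by positivity)).2
    rw [mul_pow, norm_sq_E3, norm_sq_E3]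
    simp only [Matrix.cons_val]
    have a1 : 0 ≤ 2 * ε⁻¹ + ε⁻¹ ^ 2 := by positivity
    have a2 : 0 ≤ 1 + 2 * ε⁻¹ := by positivity
    nlinarith [mul_nonneg a1 (add_nonneg (sq_nonneg (v 0)) (sq_nonneg (v 1))),
      mul_nonneg a2 (sq_nonneg (v 2))]
  have h2 : ‖ε⁻¹ • vert (γ r) v‖ ≤ ε⁻¹ * M * ‖v‖ := by
    rw [norm_smul, Real.norm_of_nonneg hi, mul_assoc]
    gcongr
    refine (norm_vert_le _ _).trans ?_
    gcongr
    exact hM r hr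
  have h3 : ‖ε⁻¹ • vert (((r - t) / (s - t)) • v) (α r)‖ ≤ ε⁻¹ * ‖v‖ * ‖α r‖ := by
    rw [norm_smul, Real.norm_of_nonneg hi, mul_assoc]
    gcongr
    refine (norm_vert_le _ _).trans ?_
    gcongr
    rw [norm_smul, Real.norm_of_nonneg (div_nonneg (sub_nonneg.2 hr.1) hst.le)]
    have : (r - t) / (s - t) ≤ 1 := by rw [div_le_one hst]; linarith [hr.2]
    exact mul_le_of_le_one_left (norm_nonneg _) this
  rw [steering]
  refine (_root_.norm_sub_le _ _).trans ?_
  rw [norm_smul, Real.norm_of_nonneg (by positivity : 0 ≤ (s - t)⁻¹)]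
  have h4 := _root_.norm_sub_le (!₂[v 0, v 1, ε⁻¹ * v 2] : E3) (ε⁻¹ • vert (γ r) v)
  have h5 : (s - t)⁻¹ * ‖(!₂[v 0, v 1, ε⁻¹ * v 2] : E3) - ε⁻¹ • vert (γ r) v‖ ≤
      (s - t)⁻¹ * ((1 + ε⁻¹ + ε⁻¹ * M) * ‖v‖) := by
    gcongr
    linarith
  have h6 : 0 ≤ (s - t)⁻¹ * (1 + ε⁻¹ + ε⁻¹ * M) * ‖v‖ * ‖α r‖ := by positivity
  have h7 : 0 ≤ ε⁻¹ * ‖v‖ := by positivity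
  nlinarith

lemma exists_energy_steering_le (h : Traj ε t s γ α) (hε : ε ∈ Icc (0 : ℝ) 1) (hts : t < s) :
    ∃ K, 0 ≤ K ∧ ∀ v, energy t s (steering ε t (s - t) γ α v) ≤ K * ‖v‖ ^ 2 := by
  obtain ⟨c, hc, H⟩ := h.exists_norm_steering_le hε hts
  have hst := sub_pos.2 hts
  have hE := energy_nonneg hts.le α
  refine ⟨c ^ 2 * (2 * (s - t) + 2 * energy t s α), by positivity, fun v => ?_⟩
  have i1 := ((h.control.intervalIntegrable_sq hts.le).const_mul 2)
  have := intervalIntegral.integral_mono_on hts.le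
    ((h.control_steering v).intervalIntegrable_sq hts.le)
    (((intervalIntegrable_const (c := 2)).add i1).const_mul ((c * ‖v‖) ^ 2)) fun r hr => by
      have h1 := H r hr v
      show ‖steering ε t (s - t) γ α v r‖ ^ 2 ≤ (c * ‖v‖) ^ 2 * (2 + 2 * ‖α r‖ ^ 2)
      calc _ ≤ (c * ‖v‖ * (1 + ‖α r‖)) ^ 2 := by gcongr
        _ = (c * ‖v‖) ^ 2 * (1 + ‖α r‖) ^ 2 := mul_pow _ _ _
        _ ≤ _ := by gcongr; nlinarith [sq_nonneg (1 - ‖α r‖)]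
  rw [intervalIntegral.integral_const_mul, intervalIntegral.integral_add (by simp) i1,
    intervalIntegral.integral_const, intervalIntegral.integral_const_mul, smul_eq_mul] at this
  rw [energy]
  refine this.trans (le_of_eq ?_)
  rw [energy]
  ring

end Traj

namespace Problem

variable {ε T C : ℝ} {f : E3 → ℝ → ℝ} {g : E3 → ℝ} {γ α p : ℝ → E3} {t s : ℝ} {x : E3}

/-- The value decreases along an optimal trajectory by the running cost. -/
lemma runCost_add_value_le (S : Problem ε T C f g) (ht : 0 ≤ t) (hs : s ∈ Icc t T)
    (h : IsOptimalPair ε T f g x t γ α) :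
    runCost f t s γ α + value ε T f g (γ s) s ≤ value ε T f g x t := by
  obtain ⟨hγ, -, hc⟩ := (S.isOptimalPair_iff ⟨ht, hs.1.trans hs.2⟩).1 h
  have h1 := S.value_le ⟨ht.trans hs.1, hs.2⟩ (hγ.mono S.hε hs.1 le_rfl)
  rw [← S.runCost_add ht hs.1 hs.2 le_rfl hγ] at hc
  linarith

/-- Bellman's principle: the tail of an optimal pair is optimal from its own starting point. -/
lemma cost_tail_le (S : Problem ε T C f g) (ht : 0 ≤ t) (hs : s ∈ Icc t T)
    (h : IsOptimalPair ε T f g x t γ α) :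
    runCost f s T γ α + g (γ T) ≤ value ε T f g (γ s) s := by
  obtain ⟨hγ, h0, hc⟩ := (S.isOptimalPair_iff ⟨ht, hs.1.trans hs.2⟩).1 h
  have h1 := S.value_le_runCost_add ht hs.1 hs.2 (hγ.mono S.hε le_rfl hs.2)
  rw [h0] at h1
  rw [← S.runCost_add ht hs.1 hs.2 le_rfl hγ] at hc
  linarith

/-- Upper bound for the value function around points of an optimal trajectory. -/
lemma exists_value_add_le (S : Problem ε T C f g) (ht : 0 ≤ t) (hs : s ∈ Icc t T)
    (h : IsOptimalPair ε T f g x t γ α) (hp : Adjoint T f g t γ α p) :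
    ∃ K, 0 ≤ K ∧ ∀ v, ‖v‖ ≤ 1 →
      value ε T f g (γ s + v) s ≤ value ε T f g (γ s) s + inner ℝ (p s) v + K * ‖v‖ ^ 2 := by
  have hsT : s ∈ Icc 0 T := ⟨ht.trans hs.1, hs.2⟩
  obtain ⟨hγ, -, -⟩ := (S.isOptimalPair_iff ⟨ht, hs.1.trans hs.2⟩).1 h
  have htail := hγ.mono S.hε hs.1 le_rfl
  have hc := S.cost_tail_le ht hs h
  have hE := S.energy_le hsT htail (by linarith)
  obtain ⟨K, hK, H⟩ := S.exists_cost_expansion (E := S.energyBound) (X := ‖γ s‖ + 1)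
    (by positivity)
  refine ⟨K, hK, fun v hv => ?_⟩
  -- Keep the optimal control on the tail and move only the starting point; the control part of the
  -- expansion then vanishes.
  obtain ⟨z, hz, hz0⟩ := exists_traj S.hε hs.2 (γ s + v) htail.control
  have h1 := H s hsT γ α z α p htail hz (Adjoint.mono S ht hγ hp hs) (by linarith)
    (by rw [hz0]; exact (norm_add_le _ _).trans (by linarith)) hE hE
  have h2 := S.value_le hsT hz
  simp only [sub_self, inner_zero_right, intervalIntegral.integral_zero, energy, norm_zero,
    hz0, add_sub_cancel_left] at h1
  norm_num at h1
  rw [hz0] at h2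
  linarith

/-- Lower bound for the value function around interior points of an optimal trajectory. -/
lemma exists_le_value_add (S : Problem ε T C f g) (hε0 : ε ≠ 0) (ht : 0 ≤ t) (hs : s ∈ Ioc t T)
    (h : IsOptimalPair ε T f g x t γ α) :
    ∃ K, 0 ≤ K ∧ ∃ c : E3 → ℝ, (∀ v, c (-v) = -c v) ∧ ∀ v,
      value ε T f g (γ s) s + c v - K * ‖v‖ ^ 2 ≤ value ε T f g (γ s + v) s := by
  have hC := S.hC
  obtain ⟨hγ', h0, -⟩ := (S.isOptimalPair_iff ⟨ht, hs.1.le.trans hs.2⟩).1 h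
  have hγ := hγ'.mono S.hε le_rfl hs.2
  have hst := sub_pos.2 hs.1
  obtain ⟨K, hK, HK⟩ := hγ.exists_energy_steering_le S.hε hs.1
  -- The odd part is minus the first variation of the running cost under steering. Reaching γ(s) + v
  -- at time s costs at least V(x, t) minus the value there, which turns an upper bound for that
  -- cost into a lower bound for the value. The steering time s - t must be positive.
  refine ⟨K / 2 + (s - t) * C, by positivity, fun v =>
    -∫ r in t..s, (inner ℝ (α r) (steering ε t (s - t) γ α v r) +
      inner ℝ (spaceGradient f (γ r) r) (((r - t) / (s - t)) • v)), fun v => ?_, fun v => ?_⟩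
  · beta_reduce
    rw [neg_inj, ← intervalIntegral.integral_neg]
    refine intervalIntegral.integral_congr fun r _ => ?_
    simp only [steering_neg, smul_neg, inner_neg_right, neg_add]
  have hz := hγ.steer S.hε hε0 hs.1 v
  have hℓ := hγ.control_steering v
  set ℓ := steering ε t (s - t) γ α v with hℓd
  have h1 := S.value_le_runCost_add ht hs.1.le hs.2 hz
  have h2 := S.runCost_add_value_le ht ⟨hs.1.le, hs.2⟩ h
  have h3 := HK v
  simp only [sub_self, zero_div, zero_smul, add_zero, div_self hst.ne', one_smul, h0] at h1
  have i1 := S.intervalIntegrable_run ht hs.1.le hs.2 hγ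
  have i2 : IntervalIntegrable (fun r => inner ℝ (α r) (ℓ r) +
      inner ℝ (spaceGradient f (γ r) r) (((r - t) / (s - t)) • v)) volume t s :=
    (hγ.control.intervalIntegrable_inner hℓ hs.1.le).add
      ((Control.of_continuousOn (S.continuousOn_grad_along ht hs.2 hγ.cont)).intervalIntegrable_inner
        (Control.of_continuousOn (Continuous.continuousOn (by fun_prop))) hs.1.le)
  have i3 := (hℓ.intervalIntegrable_sq hs.1.le).div_const 2
  have := intervalIntegral.integral_mono_on hs.1.le
    (S.intervalIntegrable_run ht hs.1.le hs.2 hz)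
    ((i1.add i2).add (i3.add (intervalIntegrable_const (c := C * ‖v‖ ^ 2)))) fun r hr => by
      have f1 := (abs_le.1 ((S.f_bound r ⟨ht.trans hr.1, hr.2.trans hs.2⟩).taylor (γ r)
        (γ r + ((r - t) / (s - t)) • v))).2
      rw [add_sub_cancel_left] at f1
      have f2 : ‖((r - t) / (s - t)) • v‖ ≤ ‖v‖ := by
        rw [norm_smul, Real.norm_of_nonneg (div_nonneg (sub_nonneg.2 hr.1) hst.le)]
        exact mul_le_of_le_one_left (norm_nonneg _) (by rw [div_le_one hst]; linarith [hr.2])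
      have f3 : C * ‖((r - t) / (s - t)) • v‖ ^ 2 ≤ C * ‖v‖ ^ 2 := by gcongr
      show ‖α r + ℓ r‖ ^ 2 / 2 + f (γ r + ((r - t) / (s - t)) • v) r ≤
        (‖α r‖ ^ 2 / 2 + f (γ r) r) + (inner ℝ (α r) (ℓ r) +
          inner ℝ (spaceGradient f (γ r) r) (((r - t) / (s - t)) • v)) +
          (‖ℓ r‖ ^ 2 / 2 + C * ‖v‖ ^ 2)
      rw [norm_add_sq_real]
      change _ - inner ℝ (spaceGradient f (γ r) r) _ ≤ _ at f1
      linarith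
  rw [intervalIntegral.integral_add (i1.add i2) (i3.add (by simp)),
    intervalIntegral.integral_add i1 i2, intervalIntegral.integral_add i3 (by simp),
    intervalIntegral.integral_const, intervalIntegral.integral_div, smul_eq_mul] at this
  change runCost f t s _ _ ≤ runCost f t s γ α + _ + (energy t s ℓ / 2 + _) at this
  linarith

/-- In the nondegenerate case the value function is differentiable along optimal trajectories,
with gradient given by the adjoint curve. -/
lemma hasGradientAt_value (S : Problem ε T C f g) (hε0 : ε ≠ 0) (ht : 0 ≤ t) (hs : s ∈ Ioc t T)
    (h : IsOptimalPair ε T f g x t γ α) (hp : Adjoint T f g t γ α p) :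
    HasGradientAt (fun y => value ε T f g y s) (p s) (γ s) := by
  obtain ⟨K, hK, H⟩ := S.exists_value_add_le ht ⟨hs.1.le, hs.2⟩ h hp
  obtain ⟨L, hL, c, hc, H'⟩ := S.exists_le_value_add hε0 ht hs h
  refine hasGradientAt_of_quadratic_bounds (K := K + L) hc (fun v _ => ?_) fun v hv => ?_
  · have := H' v
    have : 0 ≤ K * ‖v‖ ^ 2 := by positivity
    linarith
  · have := H v hv
    have : 0 ≤ L * ‖v‖ ^ 2 := by positivity
    linarith

/-- In the nondegenerate case optimal trajectories solve the feedback equation. -/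
theorem isFeedbackSolution_of_isOptimalPair (S : Problem ε T C f g) (hε0 : ε ≠ 0)
    {u : E3 → ℝ → ℝ} (hu : ∀ x, ∀ t ∈ Icc 0 T, u x t = value ε T f g x t) (ht : t ∈ Icc 0 T)
    (h : IsOptimalPair ε T f g x t γ α) : IsFeedbackSolution ε T u x t γ := by
  obtain ⟨p, hp⟩ := S.exists_adjoint ht ((S.isOptimalPair_iff ht).1 h).1
  have hgrad : ∀ s ∈ Ioo t T, HasGradientAt (fun y => u y s) (p s) (γ s) := fun s hs => by
    have : (fun y => u y s) = fun y => value ε T f g y s := by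
      ext y; exact hu y s ⟨ht.1.trans hs.1.le, hs.2.le⟩
    rw [this]
    exact S.hasGradientAt_value hε0 ht.1 ⟨hs.1, hs.2.le⟩ h hp
  refine ⟨h.1.ac, ?_, h.1.init, ?_⟩
  · rw [ae_restrict_iff' measurableSet_Ioo]
    exact ae_of_all _ fun s hs => (hgrad s hs).differentiableAt
  · filter_upwards [h.1.dynamics, S.ae_eq_neg_rowMul_adjoint ht h hp,
      ae_restrict_mem measurableSet_Ioo] with s h1 h2 hs
    rw [h2, mulCol_neg, ← rowMul_transpose] at h1
    rwa [spaceGradient, (hgrad s hs).gradient]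

/-- Rademacher's theorem for the spatial Lipschitz bound. -/
lemma ae_differentiableAt_value (S : Problem ε T C f g) (ht : t ∈ Icc 0 T) :
    ∀ᵐ x : E3, DifferentiableAt ℝ (fun y => value ε T f g y t) x := by
  refine LipschitzWith.ae_differentiableAt (C := S.lipBound.toNNReal)
    (LipschitzWith.of_dist_le_mul fun x y => ?_)
  rw [Real.dist_eq, dist_eq_norm, Real.coe_toNNReal _ S.lipBound_nonneg]
  exact S.abs_value_sub_le ht x y

end Problem

end HeisenbergControl

end

/-! ### Assembly of both parts. -/

theorem lemma3p4 (ε T : ℝ) (hε : ε ∈ Icc (0 : ℝ) 1) (hT : 0 < T)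
    (f : HeisenbergControl.E3 → ℝ → ℝ) (g : HeisenbergControl.E3 → ℝ)
    (hfg : HeisenbergControl.CostData T f g)
    (u : HeisenbergControl.E3 → ℝ → ℝ)
    (hu : HeisenbergControl.IsBoundedViscositySolution ε T f g u) :
    (∀ (x : HeisenbergControl.E3), ∀ t ∈ Icc 0 T, ∀ γ : ℝ → HeisenbergControl.E3,
      HeisenbergControl.IsFeedbackSolution ε T u x t γ →
        HeisenbergControl.IsOptimalPair ε T f g x t γ (HeisenbergControl.feedback ε u γ)) ∧
    (ε ≠ 0 →
      (∀ (x : HeisenbergControl.E3), ∀ t ∈ Icc 0 T,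
        DifferentiableAt ℝ (fun y => u y t) x →
          ∃ γ : ℝ → HeisenbergControl.E3,
            HeisenbergControl.IsFeedbackSolution ε T u x t γ ∧
            HeisenbergControl.IsOptimalTrajectory ε T f g x t γ ∧
            (∀ γ' : ℝ → HeisenbergControl.E3,
              HeisenbergControl.IsFeedbackSolution ε T u x t γ' → EqOn γ' γ (Icc t T)) ∧
            (∀ γ' : ℝ → HeisenbergControl.E3,
              HeisenbergControl.IsOptimalTrajectory ε T f g x t γ' → EqOn γ' γ (Icc t T))) ∧
      (∀ᵐ x : HeisenbergControl.E3,
        ∃ γ : ℝ → HeisenbergControl.E3,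
          HeisenbergControl.IsOptimalTrajectory ε T f g x 0 γ ∧
          ∀ γ' : ℝ → HeisenbergControl.E3,
            HeisenbergControl.IsOptimalTrajectory ε T f g x 0 γ' →
              EqOn γ' γ (Icc 0 T))) := by
  obtain ⟨C, S⟩ := hfg.exists_problem hε hT
  have hv : ∀ x, ∀ t ∈ Icc 0 T, u x t = HeisenbergControl.value ε T f g x t :=
    fun x t ht => hu.eq_value S x ht
  have hslice : ∀ t ∈ Icc 0 T, (fun y => u y t) = fun y => HeisenbergControl.value ε T f g y t :=
    fun t ht => by ext y; exact hv y t ht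
  refine ⟨fun x t ht γ hγ => S.isOptimalPair_of_feedback hv ht hγ, fun hε0 =>
    ⟨fun x t ht hd => ?_, ?_⟩⟩
  · rw [hslice t ht] at hd
    obtain ⟨γ, α, h⟩ := S.exists_isOptimalPair ht hd
    -- Uniqueness for the feedback problem, whose right-hand side need not be Lipschitz, is
    -- inherited from uniqueness of the optimal trajectory: by part (a) every feedback solution is
    -- optimal.
    exact ⟨γ, S.isFeedbackSolution_of_isOptimalPair hε0 hv ht h, ⟨α, h⟩,
      fun γ' h' => S.eqOn_of_isOptimalPair ht hd h (S.isOptimalPair_of_feedback hv ht h'),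
      fun γ' ⟨_, h'⟩ => S.eqOn_of_isOptimalPair ht hd h h'⟩
  · have h0 : (0 : ℝ) ∈ Icc 0 T := ⟨le_rfl, hT.le⟩
    filter_upwards [S.ae_differentiableAt_value h0] with x hd
    obtain ⟨γ, α, h⟩ := S.exists_isOptimalPair h0 hd
    exact ⟨γ, ⟨α, h⟩, fun γ' ⟨_, h'⟩ => S.eqOn_of_isOptimalPair h0 hd h h'⟩
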